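/- Let $q\in L_2(0,\pi)$ be real valued and $h,H\in\mathbb R$. Let $\lambda_0<\lambda_1<\dots$ be the eigenvalues of $-y''+qy=\lambda y$ on $(0,\pi)$ with $y'(0)-hy(0)=0$, $y'(\pi)+Hy(\pi)=0$, and let $\nu_0<\nu_1<\dots$ be the eigenvalues of the same equation with $y'(0)-hy(0)=0$, $y(\pi)=0$. Assume $\lambda_0=0$, and put $\rho_n=\sqrt{\lambda_n}$, $\mu_n=\sqrt{\nu_n}$, $\omega_1=h+\frac12\int_0^\pi q(t)\,dt$, $\omega=\omega_1+H$. For $\rho\in\mathbb C$ let $\varphi(\rho,x)$ be the solution of $-y''+qy=\rho^2y$ with $\varphi(\rho,0)=1$, $\varphi'(\rho,0)=h$, and let $\alpha_n=\int_0^\pi\varphi(\rho_n,x)^2\,dx$ be the norming constants. Let $G(x,t)$, $0\le t\le x\le\pi$, be the continuous kernel with $\varphi(\rho,x)=\cos\rho x+\int_0^xG(x,t)\cos\rho t\,dt$ for all $\rho\in\mathbb C$, $x\in[0,\pi]$. With $P_m$ the Legendre polynomials, $\partial_xG(\pi,t)$ the (left) derivative, which exists for almost every $t\in(0,\pi)$,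 and $j_m$ the spherical Bessel functions, put $$g_n(\pi)=(4n+1)\int_0^\pi G(\pi,t)P_{2n}(t/\pi)\,dt,\qquad \gamma_n(\pi)=(4n+1)\int_0^\pi \partial_xG(\pi,t)P_{2n}(t/\pi)\,dt,\qquad h_n=\gamma_n(\pi)+Hg_n(\pi).$$ Then $\varphi$ and $G$ exist, and the following holds. 1. For all $\rho\in\mathbb C$, $$\varphi(\rho,\pi)=\cos\rho\pi+\sum_{n=0}^\infty(-1)^ng_n(\pi)j_{2n}(\rho\pi),\qquad \varphi'(\rho,\pi)=-\rho\sin\rho\pi+\omega_1\cos\rho\pi+\sum_{n=0}^\infty(-1)^n\gamma_n(\pi)j_{2n}(\rho\pi).$$ 2. The coefficients $g_n(\pi)$ are determined by the second spectrum: $(g_n(\pi))_{n\ge0}$ is the unique real sequence $(c_n)$ with $\sum_n c_n^2/(4n+1)<\infty$ and $$\sum_{n=0}^\infty(-1)^nc_n\,j_{2n}(\mu_k\pi)=-\cos\mu_k\pi,\qquad k=0,1,2,\dots$$ 3. The coefficients $h_n$ and the number $\omega$ are determined by the first spectrum: $(h_n)_{n\ge0}$ is the unique real sequence $(d_n)$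 with $\sum_n d_n^2/(4n+1)<\infty$ and $$d_0\cos\rho_k\pi-\sum_{n=0}^\infty(-1)^nd_n\,j_{2n}(\rho_k\pi)=-\rho_k\sin\rho_k\pi,\qquad k=1,2,\dots,$$ and $\omega=-h_0$. 4. For $n=1,2,\dots$ both series below converge absolutely, and $$\alpha_n=\frac1{2\rho_n}\Bigl(\cos\rho_n\pi+\sum_{k=0}^\infty(-1)^kg_k(\pi)j_{2k}(\rho_n\pi)\Bigr)\Bigl((1+\pi\omega)\sin\rho_n\pi+\pi\rho_n\cos\rho_n\pi+\sum_{k=0}^\infty(-1)^kh_k\bigl(\pi j_{2k+1}(\rho_n\pi)-\tfrac{2k}{\rho_n}j_{2k}(\rho_n\pi)\bigr)\Bigr),$$ while $$\alpha_0=\bigl(1+g_0(\pi)\bigr)\Bigl(\pi+\omega\frac{\pi^2}{3}+h_1\frac{\pi^2}{15}\Bigr).$$ -/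

import Mathlib

open MeasureTheory Set
open scoped Real

noncomputable section

namespace NSBF

/-- The Legendre polynomial `P_n`, evaluated at the real point `x`. Mathlib's shifted Legendre
polynomial is `x ↦ P_n (1 - 2 x)`. -/
def legendreP (n : ℕ) (x : ℝ) : ℝ :=
  Polynomial.aeval ((1 - x) / 2) (Polynomial.shiftedLegendre n)

/-- The spherical Bessel function `j_k(z) = √(π / (2 z)) J_{k + 1/2}(z)`, an entire function of `z`,
by its power series `j_k(z) = z^k ∑_m (-z²/2)^m / (m! (2k + 2m + 1)!!)`. -/
def sphericalBesselJ (k : ℕ) (z : ℂ) : ℂ :=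
  z ^ k * ∑' m : ℕ, (-(z ^ 2) / 2) ^ m /
    ((Nat.factorial m : ℂ) * (Nat.doubleFactorial (2 * k + 2 * m + 1) : ℂ))

/-- `y` is a (Carathéodory) solution on `[0, π]` of `-y'' + q y = z y`, with derivative `dy`:
`y` is continuously differentiable and `y' = dy` is the integral of `(q - z) y`. -/
structure IsSLSolution (q : ℝ → ℝ) (z : ℂ) (y dy : ℝ → ℂ) : Prop where
  deriv : ∀ x ∈ Icc 0 π, HasDerivWithinAt y (dy x) (Icc 0 π) x
  eqn : ∀ x ∈ Icc 0 π, dy x = dy 0 + ∫ t in (0 : ℝ)..x, ((q t : ℂ) - z) * y t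

/-- The set of eigenvalues of `-y'' + q y = z y`, `y'(0) - h y(0) = 0`, `y'(π) + H y(π) = 0`. -/
def robinEigenvalues (q : ℝ → ℝ) (h H : ℝ) : Set ℂ :=
  {z | ∃ y dy : ℝ → ℂ, IsSLSolution q z y dy ∧ (∃ x ∈ Icc 0 π, y x ≠ 0) ∧
    dy 0 - h * y 0 = 0 ∧ dy π + H * y π = 0}

/-- The set of eigenvalues of `-y'' + q y = z y`, `y'(0) - h y(0) = 0`, `y(π) = 0`. -/
def dirichletEigenvalues (q : ℝ → ℝ) (h : ℝ) : Set ℂ :=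
  {z | ∃ y dy : ℝ → ℂ, IsSLSolution q z y dy ∧ (∃ x ∈ Icc 0 π, y x ≠ 0) ∧
    dy 0 - h * y 0 = 0 ∧ y π = 0}

/-- `lam 0 < lam 1 < …` is the list of all elements of `S`. -/
def IsSpectrum (S : Set ℂ) (lam : ℕ → ℝ) : Prop :=
  StrictMono lam ∧ range (fun n => (lam n : ℂ)) = S

/-- `φ(ρ, ·)`, with `x`-derivative `dφ(ρ, ·)`, is for every complex `ρ` the solution of
`-y'' + q y = ρ² y` with `y(0) = 1`, `y'(0) = h`. -/
def IsPhi (q : ℝ → ℝ) (h : ℝ) (φ dφ : ℂ → ℝ → ℂ) : Prop :=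
  ∀ ρ : ℂ, IsSLSolution q (ρ ^ 2) (φ ρ) (dφ ρ) ∧ φ ρ 0 = 1 ∧ dφ ρ 0 = h

/-- `G` is the transmutation kernel of `φ`: it is continuous on `0 ≤ t ≤ x ≤ π`, and
`φ(ρ, x) = cos ρx + ∫₀ˣ G(x, t) cos ρt dt` for all complex `ρ`. -/
def IsTransmutationKernel (φ : ℂ → ℝ → ℂ) (G : ℝ → ℝ → ℝ) : Prop :=
  ContinuousOn (fun p : ℝ × ℝ => G p.1 p.2) {p | 0 ≤ p.2 ∧ p.2 ≤ p.1 ∧ p.1 ≤ π} ∧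
  ∀ ρ : ℂ, ∀ x ∈ Icc 0 π,
    φ ρ x = Complex.cos (ρ * x) + ∫ t in (0 : ℝ)..x, (G x t : ℂ) * Complex.cos (ρ * t)

/-- The coefficients in `G(x, t) = ∑ₙ (gₙ(x) / x) P_{2n}(t / x)`. -/
def gCoeff (G : ℝ → ℝ → ℝ) (n : ℕ) (x : ℝ) : ℝ :=
  (4 * n + 1) * ∫ t in (0 : ℝ)..x, G x t * legendreP (2 * n) (t / x)

/-- The coefficients in `∂ₓG(x, t) = ∑ₙ (γₙ(x) / x) P_{2n}(t / x)`. The derivative is the one from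
the left, inside the triangle where `G` is defined. -/
def gammaCoeff (G : ℝ → ℝ → ℝ) (n : ℕ) (x : ℝ) : ℝ :=
  (4 * n + 1) *
    ∫ t in (0 : ℝ)..x, derivWithin (fun s => G s t) (Icc t x) x * legendreP (2 * n) (t / x)

/-- `hₙ = γₙ(π) + H gₙ(π)`. -/
def hCoeff (G : ℝ → ℝ → ℝ) (H : ℝ) (n : ℕ) : ℝ :=
  gammaCoeff G n π + H * gCoeff G n π

/-- `ω₁ = h + ½ ∫₀^π q`. -/
def omegaOne (q : ℝ → ℝ) (h : ℝ) : ℝ :=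
  h + (1 / 2) * ∫ t in (0 : ℝ)..π, q t

/-- `ω = h + H + ½ ∫₀^π q`. -/
def omega (q : ℝ → ℝ) (h H : ℝ) : ℝ :=
  h + H + (1 / 2) * ∫ t in (0 : ℝ)..π, q t

/-- `αₙ = ∫₀^π φ(ρₙ, x)² dx`, with `ρₙ = √lam n`. -/
def normingConstant (φ : ℂ → ℝ → ℂ) (lam : ℕ → ℝ) (n : ℕ) : ℂ :=
  ∫ x in (0 : ℝ)..π, φ (√(lam n) : ℝ) x ^ 2

/-- The sequences that are Fourier-Legendre coefficients (with respect to `P_{2n}(t / π) / π`) of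
square integrable functions on `(0, π)`. -/
def IsLegendreL2 (c : ℕ → ℝ) : Prop :=
  Summable fun n => c n ^ 2 / (4 * n + 1)

/-- `c` solves `∑ₙ (-1)ⁿ cₙ j_{2n}(μₖ π) = - cos μₖ π`, `k = 0, 1, …`, with `μₖ = √nu k`. -/
def SolvesSecondSystem (nu : ℕ → ℝ) (c : ℕ → ℝ) : Prop :=
  IsLegendreL2 c ∧ ∀ k : ℕ,
    HasSum (fun n : ℕ => (-1 : ℂ) ^ n * c n * sphericalBesselJ (2 * n) ((√(nu k) : ℝ) * π))
      (-Complex.cos ((√(nu k) : ℝ) * π))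

/-- `d` solves `d₀ cos ρₖπ - ∑ₙ (-1)ⁿ dₙ j_{2n}(ρₖ π) = - ρₖ sin ρₖ π`, `k = 1, 2, …`, with
`ρₖ = √lam k`. -/
def SolvesFirstSystem (lam : ℕ → ℝ) (d : ℕ → ℝ) : Prop :=
  IsLegendreL2 d ∧ ∀ k : ℕ, 1 ≤ k →
    HasSum (fun n : ℕ => (-1 : ℂ) ^ n * d n * sphericalBesselJ (2 * n) ((√(lam k) : ℝ) * π))
      (d 0 * Complex.cos ((√(lam k) : ℝ) * π)
        + (√(lam k) : ℝ) * Complex.sin ((√(lam k) : ℝ) * π))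

/-- The `k`-th term `(-1)ᵏ cₖ j_{2k}(ρπ)` of the series in the first factor. -/
def gTerm (c : ℕ → ℝ) (ρ : ℂ) (k : ℕ) : ℂ :=
  (-1 : ℂ) ^ k * c k * sphericalBesselJ (2 * k) (ρ * π)

/-- The `k`-th term `(-1)ᵏ dₖ (π j_{2k+1}(ρπ) - (2k/ρ) j_{2k}(ρπ))` of the series in the second
factor. -/
def hTerm (d : ℕ → ℝ) (ρ : ℂ) (k : ℕ) : ℂ :=
  (-1 : ℂ) ^ k * d k *
    (π * sphericalBesselJ (2 * k + 1) (ρ * π) - 2 * k / ρ * sphericalBesselJ (2 * k) (ρ * π))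

end NSBF

end

noncomputable section

namespace NSBF

/-! The transmutation kernel turns the boundary values of `φ` into entire functions of `w = ρ²`:
`A(ρ²) = φ(ρ, π) = cos ρπ + ∫₀^π g(t) cos ρt dt` and `D(ρ²) = φ'(ρ, π) + H φ(ρ, π) = -ρ sin ρπ + ω
cos ρπ + ∫₀^π f(t) cos ρt dt`, where `g = G(π, ·)` and `f = ∂ₓG(π, ·) + H g` are square integrable.
The zeros of `A` and of `D` are the second and the first spectrum.

Series. The `P_{2n}(t/π)` form an orthogonal basis of `L²(0, π)` (`legendreBasis`), and the
coefficients of `cos ρt` and `-t sin ρt` in it are spherical Bessel expressions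
(`legendreMoment_cos`, `legendreMoment_sin`). Parseval's identity `hasSum_legendreMoment_mul` turns
every integral of `f` or `g` against such a function into a series of the required form.

Uniqueness. A solution of one of the systems is, by Riesz–Fischer, the coefficient sequence of some
`L²` function, and its difference from the expected solution gives an entire function vanishing on
the spectrum. All zeros of `A` and `D` are simple, because the Wronskian identity `A' D - D' A = ∫
φ²` (`IsPhi.deriv_wronskian`) has a positive right side at real points. The quotient by `A` or `D`
is therefore entire; it tends to zero on suitable large circles, by the Riemann–Lebesgue lemma for
`A` and by the extra factor `ρ` for `D`, so it vanishes (`eq_zero_of_vanishing_at_simple_zeros`).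
Completeness of the cosines finishes the argument. In the first system the missing equation `k = 0`
is automatic because `λ₀ = 0`; the same normalisation gives `ω = -h₀` and, through a sign argument
for `A` and `D` on the negative axis, `νₖ > 0`.

Norming constants. At an eigenvalue `D = 0`, so the Wronskian identity reads `αₙ = -D'(λₙ) A(λₙ)`;
it remains to expand `A` and `D'`.

The kernel. In the characteristic coordinates `u = (x + t)/2`, `v = (x - t)/2` it comes from an
integral equation solved by contraction (`exists_goursat_kernel`). Fubini's theorem shows that the
function it defines solves the differential equation, and that its derivative at `π` has the
representation above (`IsGoursatKernel.dpsi_pi_eq`). Square integrability of `∂ₓG(π, ·)` comes from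
that of `q`, the rest being continuous. -/

/-! ### Legendre polynomials: moments, orthogonality, cosine and sine integrals -/

open Polynomial in
theorem integral_iterate_derivative_mul (w g : ℝ[X]) (j : ℕ)
    (h0 : ∀ i < j, (derivative^[i] w).eval 0 = 0) (h1 : ∀ i < j, (derivative^[i] w).eval 1 = 0) :
    ∫ y in (0 : ℝ)..1, (derivative^[j] w).eval y * g.eval y =
      (-1) ^ j * ∫ y in (0 : ℝ)..1, w.eval y * (derivative^[j] g).eval y := by
  induction j generalizing g with
  | zero => simp
  | succ j ih =>
    have key := intervalIntegral.integral_mul_deriv_eq_deriv_mul (a := 0) (b := 1)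
      (u := fun y => g.eval y) (v := fun y => (derivative^[j] w).eval y)
      (u' := fun y => (derivative g).eval y)
      (v' := fun y => (derivative (derivative^[j] w)).eval y)
      (fun y _ => g.hasDerivAt y) (fun y _ => (derivative^[j] w).hasDerivAt y)
      ((derivative g).continuous.intervalIntegrable _ _)
      ((derivative (derivative^[j] w)).continuous.intervalIntegrable _ _)
    rw [h0 j (by lia), h1 j (by lia)] at key
    have := ih (derivative g) (fun i hi => h0 i (by lia)) (fun i hi => h1 i (by lia))
    simp only [Function.iterate_succ_apply', mul_comm (eval _ (derivative (derivative^[j] w)))]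
    rw [key]
    simp only [mul_comm (eval _ (derivative g))]
    rw [this, ← Function.iterate_succ_apply, Function.iterate_succ_apply']
    ring

open Polynomial in
/-- Rodrigues' formula tested against a polynomial. -/
theorem factorial_mul_integral_shiftedLegendre_mul (N : ℕ) (g : ℝ[X]) :
    (N.factorial : ℝ) * ∫ y in (0 : ℝ)..1, aeval y (shiftedLegendre N) * g.eval y =
      (-1) ^ N * ∫ y in (0 : ℝ)..1, (y - y ^ 2) ^ N * (derivative^[N] g).eval y := by
  set w : ℝ[X] := X ^ N * (1 - X) ^ N with hw
  have hrod : ∀ y : ℝ, (N.factorial : ℝ) * aeval y (shiftedLegendre N) =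
      (derivative^[N] w).eval y := by
    intro y
    have := congrArg (fun p => aeval y p) (factorial_mul_shiftedLegendre_eq N)
    simp only [map_mul, map_natCast] at this
    rw [this, ← eval_map_algebraMap, ← iterate_derivative_map]
    simp [hw]
  have h0 : ∀ i < N, (derivative^[i] w).eval 0 = 0 := by
    intro i hi
    -- Each derivative lowers the order of vanishing at an endpoint by at most one, so fewer than
    -- `N` of them leave a zero; this kills all boundary terms.
    have : (X : ℝ[X]) ^ (N - i) ∣ derivative^[i] w :=
      pow_sub_dvd_iterate_derivative_of_pow_dvd _ (Dvd.intro _ rfl)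
    obtain ⟨r, hr⟩ := this
    rw [hr]
    simp [show N - i ≠ 0 by lia]
  have h1 : ∀ i < N, (derivative^[i] w).eval 1 = 0 := by
    intro i hi
    have : (1 - X : ℝ[X]) ^ (N - i) ∣ derivative^[i] w :=
      pow_sub_dvd_iterate_derivative_of_pow_dvd _ (Dvd.intro_left _ rfl)
    obtain ⟨r, hr⟩ := this
    rw [hr]
    simp [show N - i ≠ 0 by lia]
  have := integral_iterate_derivative_mul w g N h0 h1
  rw [← intervalIntegral.integral_const_mul]
  simp_rw [← mul_assoc, hrod]
  rw [this]
  congr 1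
  refine intervalIntegral.integral_congr fun y _ => ?_
  simp only [hw, eval_mul, eval_pow, eval_sub, eval_one, eval_X]
  rw [← mul_pow]
  ring_nf

/-- Integration by parts: the derivative `1 - 2y = -2(y - 1/2)` of `y - y²` trades one factor `y -
y²` for two factors `y - 1/2`, and the boundary terms vanish. -/
theorem integral_sub_sq_pow_mul_succ (N m : ℕ) :
    (2 * (m : ℝ) + 1) * ∫ y in (0 : ℝ)..1, (y - y ^ 2) ^ (N + 1) * (y - 1 / 2) ^ (2 * m) =
      2 * ((N : ℝ) + 1) * ∫ y in (0 : ℝ)..1, (y - y ^ 2) ^ N * (y - 1 / 2) ^ (2 * (m + 1)) := by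
  have key := intervalIntegral.integral_mul_deriv_eq_deriv_mul (a := 0) (b := 1)
      (u := fun y : ℝ => (y - y ^ 2) ^ (N + 1)) (v := fun y => (y - 1 / 2) ^ (2 * m + 1))
      (u' := fun y => ((N + 1 : ℕ) : ℝ) * (y - y ^ 2) ^ N * (1 - 2 * y))
      (v' := fun y => ((2 * m + 1 : ℕ) : ℝ) * (y - 1 / 2) ^ (2 * m))
      (fun y _ => by
        have h := ((hasDerivAt_id y).sub (hasDerivAt_pow 2 y)).pow (N + 1)
        refine h.congr_deriv ?_
        simp)
      (fun y _ => by
        have h := ((hasDerivAt_id y).sub_const (1 / 2)).pow (2 * m + 1)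
        refine h.congr_deriv ?_
        simp)
      (by apply Continuous.intervalIntegrable; fun_prop)
      (by apply Continuous.intervalIntegrable; fun_prop)
  norm_num at key
  rw [← intervalIntegral.integral_const_mul, ← intervalIntegral.integral_const_mul]
  have e1 : ∀ y : ℝ, (2 * (m : ℝ) + 1) * ((y - y ^ 2) ^ (N + 1) * (y - 1 / 2) ^ (2 * m)) =
      (y - y ^ 2) ^ (N + 1) * ((2 * m + 1) * (y - 1 / 2) ^ (2 * m)) := fun y => by ring
  have e2 : ∀ y : ℝ, 2 * ((N : ℝ) + 1) * ((y - y ^ 2) ^ N * (y - 1 / 2) ^ (2 * (m + 1))) =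
      - ((N + 1) * (y - y ^ 2) ^ N * (1 - 2 * y) * (y - 1 / 2) ^ (2 * m + 1)) := fun y => by
    ring
  simp_rw [e1, e2]
  rw [key, intervalIntegral.integral_neg]

/-- A Beta integral centred at `1/2`, in division-free form. The induction lowers `N` while raising
`m`, so `m` must be general; the product of factorials depends on the two through `m + N` up to
elementary factors. -/
theorem integral_sub_sq_pow_mul (N m : ℕ) :
    (∫ y in (0 : ℝ)..1, (y - y ^ 2) ^ N * (y - 1 / 2) ^ (2 * m)) *
      ((2 : ℝ) ^ m * m.factorial * 4 ^ (m + N) * (Nat.doubleFactorial (2 * m + 2 * N + 1))) =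
      (2 : ℝ) ^ N * N.factorial * (2 * m).factorial := by
  induction N generalizing m with
  | zero =>
    have h : ∫ y in (0 : ℝ)..1, (y - y ^ 2) ^ 0 * (y - 1 / 2) ^ (2 * m) =
        1 / ((4 : ℝ) ^ m * (2 * m + 1)) := by
      simp only [pow_zero, one_mul]
      rw [intervalIntegral.integral_comp_sub_right (fun y => y ^ (2 * m)), integral_pow]
      have : (0 - 1 / 2 : ℝ) ^ (2 * m + 1) = - (1 / 2) ^ (2 * m + 1) := by
        rw [show (0 - 1 / 2 : ℝ) = - (1 / 2) by ring, Odd.neg_pow (by simp)]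
      rw [this, show (1 - 1 / 2 : ℝ) = 1 / 2 by ring]
      have h4 : (4 : ℝ) ^ m = 2 ^ (2 * m) := by rw [pow_mul]; norm_num
      rw [h4]
      push_cast
      field_simp
      ring_nf
      rw [← mul_pow]
      norm_num
    have h2 : ((2 * m + 1).factorial : ℝ) =
        (Nat.doubleFactorial (2 * m + 1)) * (2 ^ m * m.factorial) := by
      rw [Nat.factorial_eq_mul_doubleFactorial, Nat.doubleFactorial_two_mul]
      push_cast; ring
    rw [Nat.factorial_succ] at h2
    push_cast at h2
    rw [h]
    simp only [mul_zero, add_zero, pow_zero, Nat.factorial_zero, Nat.cast_one, one_mul]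
    field_simp
    linarith
  | succ N ih =>
    have h := integral_sub_sq_pow_mul_succ N m
    have h2 := ih (m + 1)
    rw [show 2 * (m + 1) + 2 * N + 1 = 2 * m + 2 * (N + 1) + 1 by ring,
      show m + 1 + N = m + (N + 1) by ring] at h2
    rw [show (2 * (m + 1)).factorial = (2 * m + 2) * ((2 * m + 1) * (2 * m).factorial) by
      rw [show 2 * (m + 1) = 2 * m + 1 + 1 by ring, Nat.factorial_succ, Nat.factorial_succ],
      Nat.factorial_succ m] at h2
    rw [Nat.factorial_succ N]
    push_cast at h2 ⊢
    have hm : (2 * (m : ℝ) + 1) ≠ 0 := by positivity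
    have hm2 : ((m : ℝ) + 1) ≠ 0 := by positivity
    apply mul_left_cancel₀ hm
    apply mul_left_cancel₀ hm2
    rw [← mul_assoc (2 * (m : ℝ) + 1), h]
    linear_combination (N + 1) * h2

theorem legendreP_neg (N : ℕ) (x : ℝ) : legendreP N (-x) = (-1) ^ N * legendreP N x := by
  unfold legendreP
  rw [Polynomial.shiftedLegendre_eval_symm]
  congr 3
  ring

@[fun_prop]
theorem continuous_legendreP (N : ℕ) : Continuous (legendreP N) := by
  unfold legendreP
  fun_prop

/-- The substitution `x = 1 - 2y` maps `[0, 1]` onto `[-1, 1]`, where evenness doubles the integral.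
It carries half-interval integrals of even functions to the setting of shifted Legendre polynomials.
-/
theorem integral_unit_eq_of_even (f : ℝ → ℝ) (hf : Continuous f) (heven : ∀ x, f (-x) = f x) :
    ∫ x in (0 : ℝ)..1, f x = ∫ y in (0 : ℝ)..1, f (1 - 2 * y) := by
  have h1 := intervalIntegral.integral_comp_sub_mul f (a := 0) (b := 1) (c := 2) (by norm_num) 1
  rw [h1]
  have h2 := intervalIntegral.integral_comp_neg f (a := 0) (b := 1)
  simp_rw [heven] at h2
  have h3 := intervalIntegral.integral_add_adjacent_intervals (a := -1) (b := 0) (c := 1)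
    (hf.intervalIntegrable (μ := volume) _ _) (hf.intervalIntegrable _ _)
  norm_num at h1 h2 ⊢
  linarith

theorem legendreP_one_sub (N : ℕ) (y : ℝ) :
    legendreP N (1 - 2 * y) = Polynomial.aeval y (Polynomial.shiftedLegendre N) := by
  unfold legendreP
  congr 1
  simp

-- Rodrigues' formula moves `2n` derivatives onto `(y - 1/2)^(2k)`. For `k < n` the descending
-- factorial is zero, so the truncated exponent `2k - 2n` is harmless.
open Polynomial in
theorem integral_pow_mul_legendreP_eq (n k : ℕ) :
    ∫ x in (0 : ℝ)..1, x ^ (2 * k) * legendreP (2 * n) x =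
      4 ^ k * ((2 * k).descFactorial (2 * n) / (2 * n).factorial) *
        ∫ y in (0 : ℝ)..1, (y - y ^ 2) ^ (2 * n) * (y - 1 / 2) ^ (2 * k - 2 * n) := by
  rw [integral_unit_eq_of_even _ (by fun_prop)
    (fun x => by rw [legendreP_neg, pow_mul (-1 : ℝ)]; simp [pow_mul])]
  simp_rw [legendreP_one_sub]
  have h := factorial_mul_integral_shiftedLegendre_mul (2 * n) ((X - C (1 / 2)) ^ (2 * k))
  rw [iterate_derivative_X_sub_pow] at h
  simp only [nsmul_eq_mul, eval_mul, eval_natCast, eval_pow, eval_sub, eval_X, eval_C] at h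
  have e : ∀ y : ℝ, (y - y ^ 2) ^ (2 * n) * (((2 * k).descFactorial (2 * n) : ℝ) *
      (y - 1 / 2) ^ (2 * k - 2 * n)) = ((2 * k).descFactorial (2 * n) : ℝ) *
      ((y - y ^ 2) ^ (2 * n) * (y - 1 / 2) ^ (2 * k - 2 * n)) := fun y => by ring
  simp_rw [e] at h
  rw [intervalIntegral.integral_const_mul] at h
  have e2 : ∀ y : ℝ, (1 - 2 * y) ^ (2 * k) * aeval y (shiftedLegendre (2 * n)) =
      4 ^ k * (aeval y (shiftedLegendre (2 * n)) * (y - 1 / 2) ^ (2 * k)) := fun y => by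
    have : (4 : ℝ) ^ k = 2 ^ (2 * k) := by rw [pow_mul]; norm_num
    rw [this, show 1 - 2 * y = -(2 * (y - 1 / 2)) by ring, Even.neg_pow (by simp), mul_pow]
    ring
  simp_rw [e2]
  rw [intervalIntegral.integral_const_mul, mul_assoc]
  congr 1
  have hf : ((2 * n).factorial : ℝ) ≠ 0 := by positivity
  rw [pow_mul] at h
  rw [div_mul_eq_mul_div, eq_div_iff hf, mul_comm, h]
  simp

theorem integral_pow_mul_legendreP_of_lt {n k : ℕ} (hk : k < n) :
    ∫ x in (0 : ℝ)..1, x ^ (2 * k) * legendreP (2 * n) x = 0 := by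
  rw [integral_pow_mul_legendreP_eq, Nat.descFactorial_eq_zero_iff_lt.2 (by lia)]
  simp

theorem integral_pow_mul_legendreP (n m : ℕ) :
    ∫ x in (0 : ℝ)..1, x ^ (2 * (n + m)) * legendreP (2 * n) x =
      (2 * (n + m)).factorial /
        (2 ^ m * m.factorial * Nat.doubleFactorial (2 * (2 * n) + 2 * m + 1)) := by
  rw [integral_pow_mul_legendreP_eq]
  have h := integral_sub_sq_pow_mul (2 * n) m
  rw [show 2 * (n + m) - 2 * n = 2 * m by lia]
  have hd : ((2 * m).factorial : ℝ) * (2 * (n + m)).descFactorial (2 * n) =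
      (2 * (n + m)).factorial := by
    have := Nat.factorial_mul_descFactorial (n := 2 * (n + m)) (k := 2 * n) (by lia)
    rw [show 2 * (n + m) - 2 * n = 2 * m by lia] at this
    exact_mod_cast this
  have hdf : (Nat.doubleFactorial (2 * (2 * n) + 2 * m + 1) : ℝ) ≠ 0 :=
    Nat.cast_ne_zero.2 (Nat.doubleFactorial_pos _).ne'
  rw [show 2 * m + 2 * (2 * n) + 1 = 2 * (2 * n) + 2 * m + 1 by ring,
    show m + 2 * n = (n + m) + n by ring, pow_add (4 : ℝ) (n + m) n,
    show (2 : ℝ) ^ (2 * n) = 4 ^ n by rw [pow_mul]; norm_num] at h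
  have h4 : (4 : ℝ) ^ n ≠ 0 := by positivity
  have hf : ((2 * n).factorial : ℝ) ≠ 0 := by positivity
  have hf2 : ((2 * m).factorial : ℝ) ≠ 0 := by positivity
  rw [← hd]
  set I := ∫ y in (0 : ℝ)..1, (y - y ^ 2) ^ (2 * n) * (y - 1 / 2) ^ (2 * m)
  field_simp
  apply mul_left_cancel₀ h4
  linear_combination (norm := ring_nf) h

-- After Rodrigues' formula, `N` derivatives annihilate a polynomial of degree `M < N`; for `M = N`
-- only the leading coefficient survives and a Beta integral remains.
open Polynomial in
theorem integral_shiftedLegendre_mul (N M : ℕ) (h : M ≤ N) :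
    ∫ y in (0 : ℝ)..1, aeval y (shiftedLegendre N) * aeval y (shiftedLegendre M) =
      if M = N then 1 / (2 * N + 1 : ℝ) else 0 := by
  have key := factorial_mul_integral_shiftedLegendre_mul N ((shiftedLegendre M).map (algebraMap ℤ ℝ))
  simp only [eval_map_algebraMap] at key
  have hdeg : ((shiftedLegendre M).map (algebraMap ℤ ℝ)).natDegree ≤ M :=
    natDegree_map_le.trans (natDegree_shiftedLegendre M).le
  have hf : (N.factorial : ℝ) ≠ 0 := by positivity
  split_ifs with hMN
  · subst hMN
    have hd : derivative^[M] ((shiftedLegendre M).map (algebraMap ℤ ℝ)) =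
        C ((M.factorial : ℝ) * ((-1) ^ M * (M + M).choose M)) := by
      ext k
      rw [coeff_iterate_derivative, coeff_map, coeff_shiftedLegendre, coeff_C]
      split_ifs with hk
      · subst hk
        simp [Nat.descFactorial_self]
      · simp [Nat.choose_eq_zero_of_lt (show M < k + M by lia)]
    rw [hd] at key
    simp only [eval_C] at key
    have hb := integral_sub_sq_pow_mul M 0
    simp only [mul_zero, pow_zero, mul_one, zero_add, Nat.factorial_zero, Nat.cast_one,
      one_mul] at hb
    rw [intervalIntegral.integral_mul_const] at key
    have hc : ((M + M).choose M : ℝ) * (M.factorial * M.factorial) = (M + M).factorial := by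
      have := Nat.add_choose_mul_factorial_mul_factorial M M
      rw [← mul_assoc]
      exact_mod_cast this
    have h2 : ((2 * M + 1).factorial : ℝ) =
        (Nat.doubleFactorial (2 * M + 1)) * (2 ^ M * M.factorial) := by
      rw [Nat.factorial_eq_mul_doubleFactorial, Nat.doubleFactorial_two_mul]
      push_cast; ring
    rw [Nat.factorial_succ, ← two_mul M] at *
    have hdf : (Nat.doubleFactorial (2 * M + 1) : ℝ) ≠ 0 :=
      Nat.cast_ne_zero.2 (Nat.doubleFactorial_pos _).ne'
    have h1 : ((-1 : ℝ) ^ M) * (-1) ^ M = 1 := by rw [← mul_pow]; simp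
    set I := ∫ y in (0 : ℝ)..1, (y - y ^ 2) ^ M
    set J := ∫ y in (0 : ℝ)..1, aeval y (shiftedLegendre M) * aeval y (shiftedLegendre M)
    have hJ : J = ((2 * M).choose M) * I := by
      apply mul_left_cancel₀ hf
      rw [key]
      linear_combination (I * M.factorial * (2 * M).choose M) * h1
    rw [hJ]
    have hM1 : (2 * (M : ℝ) + 1) ≠ 0 := by positivity
    rw [eq_div_iff hM1]
    push_cast at h2
    have h4 : (4 : ℝ) ^ M = 2 ^ M * 2 ^ M := by rw [← mul_pow]; norm_num
    rw [h4] at hb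
    have hne : (2 : ℝ) ^ M * 2 ^ M * (Nat.doubleFactorial (2 * M + 1)) * M.factorial ≠ 0 := by
      positivity
    apply mul_right_cancel₀ hne
    rw [← hc] at h2
    have h2M : (2 : ℝ) ^ M ≠ 0 := by positivity
    have e : ((2 * M).choose M : ℝ) * ((2 * M + 1) * M.factorial) =
      (Nat.doubleFactorial (2 * M + 1)) * 2 ^ M := by
      apply mul_right_cancel₀ hf
      linear_combination h2
    linear_combination ((2 * M).choose M : ℝ) * (2 * M + 1) * M.factorial * hb +
      2 ^ M * M.factorial * e
  · rw [iterate_derivative_eq_zero (lt_of_le_of_lt hdeg (lt_of_le_of_ne h hMN))] at key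
    simp only [eval_zero, mul_zero, intervalIntegral.integral_zero] at key
    exact (mul_eq_zero.1 key).resolve_left hf

theorem integral_legendreP_mul (n m : ℕ) :
    ∫ x in (0 : ℝ)..1, legendreP (2 * n) x * legendreP (2 * m) x =
      if n = m then 1 / (4 * n + 1 : ℝ) else 0 := by
  rw [integral_unit_eq_of_even _ (by fun_prop)
    (fun x => by simp [legendreP_neg, pow_mul])]
  simp_rw [legendreP_one_sub]
  rcases le_total m n with h | h
  · rw [integral_shiftedLegendre_mul _ _ (by lia)]
    by_cases hnm : n = m
    · subst hnm; simp; ring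
    · rw [if_neg (by lia), if_neg hnm]
  · simp_rw [mul_comm (Polynomial.aeval _ (Polynomial.shiftedLegendre (2 * n)))]
    rw [integral_shiftedLegendre_mul _ _ (by lia)]
    by_cases hnm : n = m
    · subst hnm; simp; ring
    · rw [if_neg (by lia), if_neg hnm]

/-- Termwise integration by dominated convergence. The powers `x^(2k)` with `k < n` are orthogonal
to `P_{2n}`, which is why the series starts at `k = n`. -/
theorem hasSum_integral_mul_legendreP {a : ℕ → ℂ} (ha : Summable fun k => ‖a k‖) {g : ℝ → ℂ}
    (hg : ∀ x ∈ Icc (0 : ℝ) 1, HasSum (fun k => a k * (x : ℂ) ^ (2 * k)) (g x)) (n : ℕ) :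
    HasSum (fun m => a (n + m) * ((2 * (n + m)).factorial /
        (2 ^ m * m.factorial * Nat.doubleFactorial (2 * (2 * n) + 2 * m + 1)) : ℂ))
      (∫ x in (0 : ℝ)..1, g x * legendreP (2 * n) x) := by
  obtain ⟨C, hC⟩ := isCompact_Icc.exists_bound_of_continuousOn (s := Icc (0 : ℝ) 1)
    (continuous_legendreP (2 * n)).continuousOn
  have h1 : HasSum (fun k => ∫ x in (0 : ℝ)..1, a k * (x : ℂ) ^ (2 * k) * legendreP (2 * n) x)
      (∫ x in (0 : ℝ)..1, g x * legendreP (2 * n) x) := by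
    apply intervalIntegral.hasSum_integral_of_dominated_convergence (fun k _ => ‖a k‖ * C)
    · intro k
      apply Continuous.aestronglyMeasurable
      fun_prop
    · intro k
      refine ae_of_all _ fun x hx => ?_
      rw [uIoc_of_le zero_le_one] at hx
      have hP := hC x ⟨hx.1.le, hx.2⟩
      have hx1 : |x| ^ (2 * k) ≤ 1 := pow_le_one₀ (abs_nonneg x) (abs_le.2 ⟨by linarith [hx.1], hx.2⟩)
      rw [norm_mul, norm_mul, norm_pow, Complex.norm_real, Complex.norm_real, Real.norm_eq_abs x]
      calc ‖a k‖ * |x| ^ (2 * k) * ‖legendreP (2 * n) x‖ ≤ ‖a k‖ * 1 * C := by gcongr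
        _ = _ := by ring
    · exact ae_of_all _ fun x _ => ha.mul_right C
    · exact intervalIntegrable_const
    · refine ae_of_all _ fun x hx => ?_
      rw [uIoc_of_le zero_le_one] at hx
      exact (hg x ⟨hx.1.le, hx.2⟩).mul_right _
  have h2 : ∀ k, ∫ x in (0 : ℝ)..1, a k * (x : ℂ) ^ (2 * k) * legendreP (2 * n) x =
      a k * ((∫ x in (0 : ℝ)..1, x ^ (2 * k) * legendreP (2 * n) x : ℝ) : ℂ) := by
    intro k
    rw [← intervalIntegral.integral_ofReal, ← intervalIntegral.integral_const_mul]
    refine intervalIntegral.integral_congr fun x _ => ?_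
    push_cast
    ring
  simp_rw [h2] at h1
  have h3 : ∑ i ∈ Finset.range n,
      a i * ((∫ x in (0 : ℝ)..1, x ^ (2 * i) * legendreP (2 * n) x : ℝ) : ℂ) = 0 := by
    refine Finset.sum_eq_zero fun i hi => ?_
    rw [integral_pow_mul_legendreP_of_lt (Finset.mem_range.1 hi)]
    simp
  rw [← hasSum_nat_add_iff' n, h3, sub_zero] at h1
  refine h1.congr_fun ?_ |> fun h => h
  intro m
  rw [add_comm m n, integral_pow_mul_legendreP]
  push_cast
  ring

theorem summable_norm_cos_coeff (z : ℂ) :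
    Summable fun k : ℕ => ‖(-1) ^ k * z ^ (2 * k) / ((2 * k).factorial : ℂ)‖ :=
  (Complex.hasSum_cos z).summable.norm

/-- The Fourier transform of the Legendre polynomial `P_{2n}`. -/
theorem integral_cos_mul_legendreP (n : ℕ) (z : ℂ) :
    ∫ x in (0 : ℝ)..1, Complex.cos (z * x) * legendreP (2 * n) x =
      (-1) ^ n * sphericalBesselJ (2 * n) z := by
  have h := hasSum_integral_mul_legendreP (summable_norm_cos_coeff z)
    (g := fun x => Complex.cos (z * x)) (fun x _ => by
      refine (Complex.hasSum_cos (z * x)).congr_fun fun k => ?_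
      rw [mul_pow]; ring) n
  rw [← h.tsum_eq, sphericalBesselJ, ← tsum_mul_left, ← tsum_mul_left]
  refine tsum_congr fun m => ?_
  have hf : ((2 * (n + m)).factorial : ℂ) ≠ 0 := Nat.cast_ne_zero.2 (Nat.factorial_ne_zero _)
  have hf2 : ((m).factorial : ℂ) ≠ 0 := Nat.cast_ne_zero.2 (Nat.factorial_ne_zero _)
  have hdf : (Nat.doubleFactorial (2 * (2 * n) + 2 * m + 1) : ℂ) ≠ 0 :=
    Nat.cast_ne_zero.2 (Nat.doubleFactorial_pos _).ne'
  rw [div_pow, neg_pow (z ^ 2)]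
  field_simp
  ring

/-- The Legendre coefficients of `-x sin(zx)`, the derivative of those of `cos(zx)`. -/
theorem integral_sin_mul_legendreP (n : ℕ) {z : ℂ} (hz : z ≠ 0) :
    ∫ x in (0 : ℝ)..1, -(x * Complex.sin (z * x)) * legendreP (2 * n) x =
      (-1) ^ n * (2 * n / z * sphericalBesselJ (2 * n) z - sphericalBesselJ (2 * n + 1) z) := by
  -- The coefficients of `z ∂_z cos(zx) = -zx sin(zx)`.
  set A : ℕ → ℂ := fun k => (2 * k : ℂ) * ((-1) ^ k * z ^ (2 * k) / ((2 * k).factorial : ℂ)) with hA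
  have hAs : ∀ k, A (k + 1) = -((-1) ^ k * z ^ (2 * k + 1) / ((2 * k + 1).factorial : ℂ) * z) := by
    intro k
    have hf : ((2 * k + 1).factorial : ℂ) ≠ 0 := Nat.cast_ne_zero.2 (Nat.factorial_ne_zero _)
    have h2 : (2 * (k : ℂ) + 2) ≠ 0 := by exact_mod_cast (show 2 * k + 2 ≠ 0 by lia)
    simp only [hA]
    rw [show 2 * (k + 1) = 2 * k + 1 + 1 by ring, Nat.factorial_succ]
    push_cast
    rw [show (2 * (k : ℂ) + 1 + 1) = 2 * k + 2 by ring, show 2 * ((k : ℂ) + 1) = 2 * k + 2 by ring]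
    field_simp
    ring
  have hgs : ∀ x : ℝ, HasSum (fun k => A k * (x : ℂ) ^ (2 * k))
      (z * (-(x * Complex.sin (z * x)))) := by
    intro x
    rw [← hasSum_nat_add_iff' 1]
    have h0 : ∑ i ∈ Finset.range 1, A i * (x : ℂ) ^ (2 * i) = 0 := by simp [hA]
    rw [h0, sub_zero]
    have := (Complex.hasSum_sin (z * x)).mul_left (-(z * x))
    convert! this using 1
    · ext k
      rw [hAs, mul_pow]
      ring
    · ring
  have hsum : Summable fun k => ‖A k‖ := by
    have := (hgs 1).summable.norm
    simpa using this
  have h := hasSum_integral_mul_legendreP hsum (fun x _ => hgs x) n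
  have hcos := hasSum_integral_mul_legendreP (summable_norm_cos_coeff z)
    (g := fun x => Complex.cos (z * x)) (fun x _ => by
      refine (Complex.hasSum_cos (z * x)).congr_fun fun k => ?_
      rw [mul_pow]; ring) n
  -- This is `z j_k' = k j_k - z j_{k+1}` with `k = 2n`: subtracting `2n` times the cosine series
  -- leaves the factor `2(n + m) - 2n = 2m`, so the term `m = 0` drops out and the shifted series is
  -- that of `j_{2n+1}`.
  have hd := h.sub (hcos.mul_left (2 * n : ℂ))
  rw [← hasSum_nat_add_iff' 1] at hd
  have h0 : ∀ (f : ℕ → ℂ) (_ : f 0 = 0), ∑ i ∈ Finset.range 1, f i = 0 := by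
    intro f hf; simpa using hf
  rw [h0 _ (by simp only [hA]; push_cast; ring), sub_zero] at hd
  have key : ∑' m : ℕ, (-(z ^ 2) / 2) ^ m /
    ((Nat.factorial m : ℂ) * (Nat.doubleFactorial (2 * (2 * n + 1) + 2 * m + 1) : ℂ)) =
      -(-1) ^ n * (z ^ (2 * n + 2))⁻¹ *
      ((∫ x in (0 : ℝ)..1, z * (-(x * Complex.sin (z * x))) * legendreP (2 * n) x) -
        2 * n * ∫ x in (0 : ℝ)..1, Complex.cos (z * x) * legendreP (2 * n) x) := by
    rw [← (hd.mul_left (-(-1) ^ n * (z ^ (2 * n + 2))⁻¹)).tsum_eq]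
    refine tsum_congr fun m => ?_
    have hf : ((2 * (n + (m + 1))).factorial : ℂ) ≠ 0 :=
      Nat.cast_ne_zero.2 (Nat.factorial_ne_zero _)
    have hf2 : ((m).factorial : ℂ) ≠ 0 := Nat.cast_ne_zero.2 (Nat.factorial_ne_zero _)
    have hdf : (Nat.doubleFactorial (2 * (2 * n) + 2 * (m + 1) + 1) : ℂ) ≠ 0 :=
      Nat.cast_ne_zero.2 (Nat.doubleFactorial_pos _).ne'
    have hm : ((m : ℂ) + 1) ≠ 0 := by exact_mod_cast (show m + 1 ≠ 0 by lia)
    have h1 : ((-1 : ℂ) ^ n) * (-1) ^ n = 1 := by rw [← mul_pow]; simp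
    simp only [hA]
    rw [show 2 * (2 * n + 1) + 2 * m + 1 = 2 * (2 * n) + 2 * (m + 1) + 1 by ring,
      Nat.factorial_succ m]
    rw [div_pow, neg_pow (z ^ 2)]
    push_cast
    field_simp
    rw [show (n : ℂ) + (m + 1) - n = m + 1 by ring]
    rw [show 2 * (n + (m + 1)) = (2 * n + 2) + 2 * m by ring, pow_add z, pow_add (-1 : ℂ) n,
      pow_succ (-1 : ℂ) m]
    field_simp
    linear_combination (-(z ^ 2 * z ^ (2 * m) * z ^ (2 * n) * 2 ^ m * 2)) * h1
  rw [show sphericalBesselJ (2 * n + 1) z = z ^ (2 * n + 1) * _ from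
    congrArg (fun w => z ^ (2 * n + 1) * w) key]
  rw [integral_cos_mul_legendreP]
  simp_rw [mul_assoc z]
  rw [intervalIntegral.integral_const_mul]
  have h1 : ((-1 : ℂ) ^ n) * (-1) ^ n = 1 := by rw [← mul_pow]; simp
  set I := ∫ x in (0 : ℝ)..1, -(x * Complex.sin (z * x)) * legendreP (2 * n) x
  field_simp
  linear_combination z ^ (2 * n + 2) * (2 * (-1) ^ n * n * sphericalBesselJ (2 * n) z - z * I) * h1

/-! ### Completeness of cosines and of even Legendre polynomials -/

/-- An integrable function orthogonal to all powers of a function with continuous inverse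
vanishes almost everywhere. -/
theorem ae_eq_zero_of_integral_mul_pow_eq_zero {f : ℝ → ℂ} (hf : IntervalIntegrable f volume 0 π)
    {e v : ℝ → ℝ} {a b : ℝ} (he : Continuous e) (hv : ContinuousOn v (Icc a b))
    (hmaps : ∀ t ∈ Icc 0 π, e t ∈ Icc a b) (hinv : ∀ t ∈ Icc 0 π, v (e t) = t)
    (h0 : ∀ k : ℕ, ∫ t in (0 : ℝ)..π, f t * (e t : ℂ) ^ k = 0) :
    ∀ᵐ t, t ∈ Ioo 0 π → f t = 0 := by
  have hfi : IntegrableOn f (Ioc 0 π) := (intervalIntegrable_iff_integrableOn_Ioc_of_le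
    Real.pi_pos.le).1 hf
  refine isOpen_Ioo.ae_eq_zero_of_integral_contDiff_smul_eq_zero
    ((hfi.mono_set Ioo_subset_Ioc_self).locallyIntegrableOn) fun g hg _ hsupp => ?_
  have hgi : ∫ x, g x • f x = ∫ t in (0 : ℝ)..π, f t * (g t : ℂ) := by
    rw [intervalIntegral.integral_of_le Real.pi_pos.le, setIntegral_eq_integral_of_forall_compl_eq_zero]
    · simp [mul_comm]
    · intro x hx
      have : g x = 0 := by
        by_contra hne
        exact hx (Ioo_subset_Ioc_self (hsupp (subset_tsupport _ hne)))
      simp [this]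
  rw [hgi]
  have hint : ∀ {u : ℝ → ℝ}, Continuous u →
      IntervalIntegrable (fun t => f t * (u t : ℂ)) volume 0 π := fun {u} hu =>
    hf.mul_continuousOn (Complex.continuous_ofReal.comp hu).continuousOn
  have hpoly : ∀ p : Polynomial ℝ, ∫ t in (0 : ℝ)..π, f t * ((p.eval (e t) : ℝ) : ℂ) = 0 := by
    intro p
    simp_rw [Polynomial.eval_eq_sum_range]
    push_cast
    simp_rw [Finset.mul_sum]
    rw [intervalIntegral.integral_finsetSum]
    · refine Finset.sum_eq_zero fun i _ => ?_
      have : ∀ t, f t * ((p.coeff i : ℂ) * (e t : ℂ) ^ i) = p.coeff i * (f t * (e t : ℂ) ^ i) :=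
        fun t => by ring
      simp_rw [this]
      rw [intervalIntegral.integral_const_mul, h0, mul_zero]
    · intro i _
      have := hint (u := fun t => p.coeff i * e t ^ i) (by fun_prop)
      simpa using this
  have hbound : ∀ ε > 0, ‖∫ t in (0 : ℝ)..π, f t * (g t : ℂ)‖ ≤ ε * ∫ t in (0 : ℝ)..π, ‖f t‖ := by
    intro ε hε
    -- Weierstrass approximation in the variable `y = e t`: since `v` inverts `e`, the test function
    -- `g` is uniformly close to a polynomial in `e`.
    obtain ⟨p, hp⟩ := exists_polynomial_near_of_continuousOn a b (fun y => g (v y))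
      (hg.continuous.comp_continuousOn hv) ε hε
    have h1 : ∫ t in (0 : ℝ)..π, f t * (g t : ℂ) =
        ∫ t in (0 : ℝ)..π, f t * ((g t - p.eval (e t) : ℝ) : ℂ) := by
      have hs := intervalIntegral.integral_sub (hint hg.continuous)
        (hint (u := fun t => p.eval (e t)) (by fun_prop))
      rw [hpoly, sub_zero] at hs
      rw [← hs]
      refine intervalIntegral.integral_congr fun t _ => ?_
      push_cast
      ring
    rw [h1, ← intervalIntegral.integral_const_mul]
    refine intervalIntegral.norm_integral_le_of_norm_le Real.pi_pos.le (ae_of_all _ fun t ht => ?_)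
      (hf.norm.const_mul ε)
    have ht' : t ∈ Icc 0 π := ⟨ht.1.le, ht.2⟩
    have := hp (e t) (hmaps t ht')
    rw [hinv t ht', abs_sub_comm] at this
    rw [norm_mul, Complex.norm_real, Real.norm_eq_abs, mul_comm]
    gcongr
  have hlim : ‖∫ t in (0 : ℝ)..π, f t * (g t : ℂ)‖ ≤ 0 := by
    have h0 : 0 ≤ ∫ t in (0 : ℝ)..π, ‖f t‖ :=
      intervalIntegral.integral_nonneg Real.pi_pos.le fun t _ => norm_nonneg _
    refine le_of_forall_pos_le_add fun ε hε => ?_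
    have := hbound (ε / ((∫ t in (0 : ℝ)..π, ‖f t‖) + 1)) (by positivity)
    refine this.trans ?_
    rw [zero_add, div_mul_eq_mul_div, div_le_iff₀ (by positivity)]
    nlinarith
  exact norm_le_zero_iff.1 hlim

theorem ae_eq_zero_of_integral_cos_eq_zero {f : ℝ → ℂ} (hf : IntervalIntegrable f volume 0 π)
    (h0 : ∀ n : ℕ, ∫ t in (0 : ℝ)..π, f t * Complex.cos (n * t) = 0) :
    ∀ᵐ t, t ∈ Ioo 0 π → f t = 0 := by
  refine ae_eq_zero_of_integral_mul_pow_eq_zero hf Real.continuous_cos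
    (Real.continuous_arccos.continuousOn (s := Icc (-1) 1)) (fun t _ => Real.cos_mem_Icc t)
    (fun t ht => Real.arccos_cos ht.1 ht.2) fun k => ?_
  -- The extra factor `cos nt` makes the induction on `k` run: one factor `cos t` is absorbed by the
  -- product-to-sum formula, which shifts `n` by one in both directions.
  have key : ∀ k n : ℕ, ∫ t in (0 : ℝ)..π, f t * (Real.cos t : ℂ) ^ k * Complex.cos (n * t) = 0 := by
    intro k
    induction k with
    | zero => intro n; simpa using h0 n
    | succ k ih =>
      have hint : ∀ n : ℕ, IntervalIntegrable
          (fun t => f t * (Real.cos t : ℂ) ^ k * Complex.cos (n * t)) volume 0 π := fun n => by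
        simp_rw [mul_assoc]
        exact hf.mul_continuousOn (by fun_prop)
      intro n
      cases n with
      | zero =>
        have := ih 1
        simpa [pow_succ, mul_assoc] using this
      | succ n =>
        have e : ∀ t : ℝ, f t * (Real.cos t : ℂ) ^ (k + 1) * Complex.cos ((n + 1 : ℕ) * t) =
            (1 / 2) * (f t * (Real.cos t : ℂ) ^ k * Complex.cos ((n + 2 : ℕ) * t) +
              f t * (Real.cos t : ℂ) ^ k * Complex.cos ((n : ℕ) * t)) := by
          intro t
          have h1 := Complex.cos_add ((n + 1 : ℕ) * t) t
          have h2 := Complex.cos_sub ((n + 1 : ℕ) * t) t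
          rw [show ((n + 1 : ℕ) : ℂ) * t + t = (n + 2 : ℕ) * t by push_cast; ring] at h1
          rw [show ((n + 1 : ℕ) : ℂ) * t - t = (n : ℕ) * t by push_cast; ring] at h2
          rw [h1, h2]
          push_cast
          ring
        simp_rw [e]
        rw [intervalIntegral.integral_const_mul, intervalIntegral.integral_add (hint _) (hint _),
          ih, ih]
        simp
  simpa using key k 0

/-- The moments of `f` against the even Legendre polynomials `P_{2n}(t / π)`. -/
def legendreMoment (f : ℝ → ℂ) (n : ℕ) : ℂ :=
  ∫ t in (0 : ℝ)..π, f t * legendreP (2 * n) (t / π)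

-- Exact degree and vanishing odd coefficients allow the even monomials to be recovered successively
-- from the even Legendre polynomials.
open Polynomial in
theorem exists_legendreP_polynomial (n : ℕ) : ∃ p : ℝ[X], p.natDegree = 2 * n ∧
    (∀ x, p.eval x = legendreP (2 * n) x) ∧ ∀ i, Odd i → p.coeff i = 0 := by
  set p : ℝ[X] := ((shiftedLegendre (2 * n)).map (algebraMap ℤ ℝ)).comp (C (1 / 2) * (1 - X))
    with hp
  have heval : ∀ x, p.eval x = legendreP (2 * n) x := by
    intro x
    rw [hp, eval_comp, eval_map_algebraMap, legendreP]
    congr 2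
    simp only [eval_mul, eval_C, eval_sub, eval_one, eval_X]
    ring
  refine ⟨p, ?_, heval, fun i hi => ?_⟩
  · have h1 : (C (1 / 2 : ℝ) * (1 - X)).natDegree = 1 := by
      rw [natDegree_C_mul (by norm_num), ← natDegree_neg, neg_sub]
      exact natDegree_X_sub_C (1 : ℝ)
    rw [hp, natDegree_comp, h1, mul_one, natDegree_map_eq_of_injective
      (by exact (algebraMap ℤ ℝ).injective_int), natDegree_shiftedLegendre]
  · have h2 : p.comp (C (-1) * X) = p := by
      refine Polynomial.funext fun x => ?_
      rw [eval_comp, heval, heval]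
      simp [legendreP_neg, pow_mul]
    have h3 := congrArg (fun q => q.coeff i) h2
    beta_reduce at h3
    rw [comp_C_mul_X_coeff, hi.neg_one_pow] at h3
    linarith

/-- By strong induction all moments against `(t/π)^(2k)` vanish: `P_{2k}` contributes that monomial
with nonzero leading coefficient, and all its other terms are odd (absent) or of lower even degree
(already handled). -/
theorem ae_eq_zero_of_legendreMoment_eq_zero {f : ℝ → ℂ} (hf : IntervalIntegrable f volume 0 π)
    (h0 : ∀ n : ℕ, legendreMoment f n = 0) : ∀ᵐ t, t ∈ Ioo 0 π → f t = 0 := by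
  have hpi := Real.pi_pos
  refine ae_eq_zero_of_integral_mul_pow_eq_zero (e := fun t => (t / π) ^ 2)
    (v := fun y => π * √y) (a := 0) (b := 1) hf (by fun_prop) (by fun_prop)
    (fun t ht => ⟨by positivity, pow_le_one₀ (div_nonneg ht.1 hpi.le) ((div_le_one hpi).2 ht.2)⟩)
    (fun t ht => by
      rw [Real.sqrt_sq (div_nonneg ht.1 hpi.le)]; field_simp) fun k => ?_
  induction k using Nat.strong_induction_on with
  | _ k ih =>
    obtain ⟨p, hdeg, heval, hodd⟩ := exists_legendreP_polynomial k
    have h := h0 k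
    unfold legendreMoment at h
    simp_rw [← heval, Polynomial.eval_eq_sum_range] at h
    push_cast at h
    simp_rw [Finset.mul_sum] at h
    rw [intervalIntegral.integral_finsetSum (fun i _ => hf.mul_continuousOn (by fun_prop))] at h
    have e : ∀ i (t : ℝ), f t * ((p.coeff i : ℂ) * ((t : ℂ) / π) ^ i) =
        p.coeff i * (f t * ((t : ℂ) / π) ^ i) := fun i t => by ring
    simp_rw [e, intervalIntegral.integral_const_mul] at h
    rw [Finset.sum_eq_single (2 * k)] at h
    · have hne : p.coeff (2 * k) ≠ 0 := by
        rw [← hdeg]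
        refine Polynomial.leadingCoeff_ne_zero.2 fun hp0 => ?_
        have := integral_legendreP_mul k k
        simp_rw [← heval, hp0] at this
        simp at this
        have hk : (4 * (k : ℝ) + 1) ≠ 0 := by positivity
        exact hk this.symm
      have := (mul_eq_zero.1 h).resolve_left (by exact_mod_cast hne)
      rw [← this]
      refine intervalIntegral.integral_congr fun t _ => ?_
      push_cast
      ring
    · intro i hi hne
      rcases Nat.even_or_odd i with hev | hod
      · obtain ⟨j, rfl⟩ := hev
        have hj : j < k := by
          have := Finset.mem_range.1 hi
          lia
        have := ih j hj
        rw [← two_mul]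
        simp_rw [pow_mul]
        push_cast at this
        rw [this, mul_zero]
      · rw [hodd i hod]; simp
    · intro hn
      exact absurd (Finset.mem_range.2 (by lia)) hn

/-! ### Even Legendre polynomials as a Hilbert basis; Parseval and Riesz–Fischer -/

theorem setIntegral_Ioo_eq (f : ℝ → ℂ) : ∫ t in Ioo 0 π, f t = ∫ t in (0 : ℝ)..π, f t := by
  rw [intervalIntegral.integral_of_le Real.pi_pos.le, integral_Ioc_eq_integral_Ioo]

theorem MemLp.intervalIntegrable_of_two {E : Type*} [NormedAddCommGroup E] {f : ℝ → E}
    (hf : MemLp f 2 (volume.restrict (Ioo 0 π))) : IntervalIntegrable f volume 0 π := by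
  rw [intervalIntegrable_iff_integrableOn_Ioo_of_le Real.pi_pos.le]
  exact hf.integrable (by norm_num)

theorem memLp_two_of_continuous {E : Type*} [NormedAddCommGroup E] {f : ℝ → E}
    (hf : Continuous f) : MemLp f 2 (volume.restrict (Ioo 0 π)) := by
  obtain ⟨C, hC⟩ := isCompact_Icc.exists_bound_of_continuousOn (s := Icc (0 : ℝ) π)
    hf.continuousOn
  refine MemLp.of_bound hf.aestronglyMeasurable C ?_
  exact (ae_restrict_iff' measurableSet_Ioo).2 (ae_of_all _ fun t ht => hC t (Ioo_subset_Icc_self ht))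

theorem inner_toLp_eq {f g : ℝ → ℂ} (hf : MemLp f 2 (volume.restrict (Ioo 0 π)))
    (hg : MemLp g 2 (volume.restrict (Ioo 0 π))) :
    inner ℂ (hf.toLp f) (hg.toLp g) = ∫ t in (0 : ℝ)..π, (starRingEnd ℂ) (f t) * g t := by
  rw [L2.inner_def, ← setIntegral_Ioo_eq]
  refine integral_congr_ae ?_
  filter_upwards [hf.coeFn_toLp, hg.coeFn_toLp] with t h1 h2
  rw [h1, h2, RCLike.inner_apply, mul_comm]

/-- The normalised even Legendre polynomials on `(0, π)`. -/
def legendreFun (n : ℕ) (t : ℝ) : ℂ := (√((4 * n + 1) / π) * legendreP (2 * n) (t / π) : ℝ)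

theorem memLp_legendreFun (n : ℕ) : MemLp (legendreFun n) 2 (volume.restrict (Ioo 0 π)) := by
  apply memLp_two_of_continuous
  unfold legendreFun
  fun_prop

theorem conj_legendreFun (n : ℕ) (t : ℝ) :
    (starRingEnd ℂ) (legendreFun n t) = legendreFun n t := Complex.conj_ofReal _

theorem integral_legendreFun_mul (n m : ℕ) :
    ∫ t in (0 : ℝ)..π, legendreFun n t * legendreFun m t = if n = m then 1 else 0 := by
  have h1 : ∀ t : ℝ, legendreFun n t * legendreFun m t =
      ((√((4 * n + 1) / π) * √((4 * m + 1) / π) *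
        (fun x => legendreP (2 * n) x * legendreP (2 * m) x) (t / π) : ℝ) : ℂ) := by
    intro t
    unfold legendreFun
    push_cast
    ring
  simp_rw [h1]
  have h2 := intervalIntegral.integral_comp_div (a := 0) (b := π)
    (fun x => legendreP (2 * n) x * legendreP (2 * m) x) Real.pi_pos.ne'
  rw [intervalIntegral.integral_ofReal, intervalIntegral.integral_const_mul, h2, zero_div, div_self Real.pi_pos.ne',
    integral_legendreP_mul]
  split_ifs with h
  · subst h
    rw [Real.mul_self_sqrt (by positivity)]
    have : (4 * (n : ℝ) + 1) ≠ 0 := by positivity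
    have hp := Real.pi_pos.ne'
    rw [smul_eq_mul]
    field_simp
    simp
  · simp

theorem integral_legendreFun_mul_eq (f : ℝ → ℂ) (n : ℕ) :
    ∫ t in (0 : ℝ)..π, legendreFun n t * f t = √((4 * n + 1) / π) * legendreMoment f n := by
  unfold legendreMoment
  rw [← intervalIntegral.integral_const_mul]
  refine intervalIntegral.integral_congr fun t _ => ?_
  simp only [legendreFun]
  push_cast
  ring

theorem orthonormal_legendreFun :
    Orthonormal ℂ (fun n => (memLp_legendreFun n).toLp (legendreFun n)) := by
  rw [orthonormal_iff_ite]
  intro n m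
  rw [inner_toLp_eq]
  simp_rw [conj_legendreFun]
  rw [integral_legendreFun_mul]

/-- The Hilbert basis of normalised even Legendre polynomials of `L²(0, π)`. -/
def legendreBasis : HilbertBasis ℕ ℂ (Lp ℂ 2 (volume.restrict (Ioo 0 π))) :=
  HilbertBasis.mkOfOrthogonalEqBot orthonormal_legendreFun (by
    rw [Submodule.eq_bot_iff]
    intro f hf
    have hfm := Lp.memLp f
    have h0 : ∀ᵐ t, t ∈ Ioo 0 π → f t = 0 := by
      refine ae_eq_zero_of_legendreMoment_eq_zero (MemLp.intervalIntegrable_of_two hfm) fun n => ?_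
      have h := (Submodule.mem_orthogonal _ f).1 hf _ (Submodule.subset_span (mem_range_self n))
      have h2 := inner_toLp_eq (memLp_legendreFun n) hfm
      rw [Lp.toLp_coeFn] at h2
      rw [h2] at h
      simp_rw [conj_legendreFun] at h
      rw [integral_legendreFun_mul_eq] at h
      refine (mul_eq_zero.1 h).resolve_left ?_
      have : 0 < √((4 * (n : ℝ) + 1) / π) := Real.sqrt_pos.2 (by positivity)
      exact_mod_cast this.ne'
    rw [Lp.eq_zero_iff_ae_eq_zero]
    exact (ae_restrict_iff' measurableSet_Ioo).2 h0)

theorem legendreBasis_apply (n : ℕ) :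
    legendreBasis n = (memLp_legendreFun n).toLp (legendreFun n) := by
  simp [legendreBasis]

theorem inner_legendreBasis_toLp {f : ℝ → ℂ} (hf : MemLp f 2 (volume.restrict (Ioo 0 π))) (n : ℕ) :
    inner ℂ (legendreBasis n) (hf.toLp f) = √((4 * n + 1) / π) * legendreMoment f n := by
  rw [legendreBasis_apply, inner_toLp_eq]
  simp_rw [conj_legendreFun]
  rw [integral_legendreFun_mul_eq]

theorem MemLp.conj {f : ℝ → ℂ} {μ : Measure ℝ} (hf : MemLp f 2 μ) :
    MemLp (fun t => (starRingEnd ℂ) (f t)) 2 μ :=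
  (memLp_congr_norm (hf.1.star) hf.1 (ae_of_all _ fun t => norm_star (f t))).2 hf

/-- Parseval's identity for the even Legendre polynomials. -/
theorem hasSum_legendreMoment_mul {f g : ℝ → ℂ} (hf : MemLp f 2 (volume.restrict (Ioo 0 π)))
    (hg : MemLp g 2 (volume.restrict (Ioo 0 π))) :
    HasSum (fun n : ℕ => (4 * n + 1) / π * legendreMoment f n * legendreMoment g n)
      (∫ t in (0 : ℝ)..π, f t * g t) := by
  -- Conjugating `f` in the conjugate-linear slot makes the pairing bilinear.
  have h := legendreBasis.hasSum_inner_mul_inner ((MemLp.conj hf).toLp _) (hg.toLp g)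
  rw [inner_toLp_eq] at h
  simp only [RingHomCompTriple.comp_apply, RingHom.id_apply] at h
  refine h.congr_fun fun n => ?_
  rw [inner_legendreBasis_toLp, legendreBasis_apply, inner_toLp_eq]
  simp only [RingHomCompTriple.comp_apply, RingHom.id_apply]
  simp_rw [mul_comm (f _)]
  rw [integral_legendreFun_mul_eq]
  have h2 : ((√((4 * (n : ℝ) + 1) / π) : ℝ) : ℂ) * (√((4 * (n : ℝ) + 1) / π) : ℝ) =
      (4 * n + 1) / π := by
    rw [← Complex.ofReal_mul, Real.mul_self_sqrt (by positivity)]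
    push_cast
    ring
  rw [← h2]
  ring

theorem legendreMoment_ofReal (f : ℝ → ℝ) (n : ℕ) :
    legendreMoment (fun t => (f t : ℂ)) n =
      ((∫ t in (0 : ℝ)..π, f t * legendreP (2 * n) (t / π) : ℝ) : ℂ) := by
  unfold legendreMoment
  rw [← intervalIntegral.integral_ofReal]
  simp

theorem isLegendreL2_of_memLp {f : ℝ → ℝ} (hf : MemLp f 2 (volume.restrict (Ioo 0 π))) :
    IsLegendreL2 fun n => (4 * n + 1) * ∫ t in (0 : ℝ)..π, f t * legendreP (2 * n) (t / π) := by
  have h := (hasSum_legendreMoment_mul (f := fun t => (f t : ℂ)) (g := fun t => (f t : ℂ))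
    hf.ofReal hf.ofReal).summable
  simp_rw [legendreMoment_ofReal] at h
  have h2 : Summable fun n : ℕ => (4 * (n : ℝ) + 1) / π *
      (∫ t in (0 : ℝ)..π, f t * legendreP (2 * n) (t / π)) *
      (∫ t in (0 : ℝ)..π, f t * legendreP (2 * n) (t / π)) := by
    rw [← Complex.summable_ofReal]
    refine h.congr fun n => ?_
    push_cast
    ring
  refine (h2.mul_left π).congr fun n => ?_
  have : (4 * (n : ℝ) + 1) ≠ 0 := by positivity
  have hp := Real.pi_pos.ne'
  field_simp

/-- Riesz–Fischer. The basis vectors carry the factor `√((4n+1)/π)`, so the Hilbert coordinate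
belonging to the moment `c n / (4n+1)` is that factor times the moment; its square sums to a
multiple of the series in `IsLegendreL2`. -/
theorem exists_memLp_of_isLegendreL2 {c : ℕ → ℝ} (hc : IsLegendreL2 c) :
    ∃ f : ℝ → ℂ, MemLp f 2 (volume.restrict (Ioo 0 π)) ∧
      ∀ n : ℕ, (4 * n + 1) * legendreMoment f n = c n := by
  have hp := Real.pi_pos
  have hmem : Memℓp (fun n : ℕ => ((√((4 * n + 1) / π) * (c n / (4 * n + 1)) : ℝ) : ℂ)) 2 := by
    refine memℓp_gen ?_
    refine (hc.mul_left (1 / π)).congr fun n => ?_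
    have h1 : (4 * (n : ℝ) + 1) ≠ 0 := by positivity
    rw [Complex.norm_real]
    simp only [ENNReal.toReal_ofNat, Real.rpow_ofNat, Real.norm_eq_abs, sq_abs]
    rw [mul_pow, Real.sq_sqrt (by positivity)]
    field_simp
  set F := legendreBasis.repr.symm ⟨_, hmem⟩ with hF
  refine ⟨F, Lp.memLp F, fun n => ?_⟩
  have h := inner_legendreBasis_toLp (Lp.memLp F) n
  rw [Lp.toLp_coeFn, ← legendreBasis.repr_apply_apply, hF, LinearIsometryEquiv.apply_symm_apply,
    ← hF] at h
  have h1 : (4 * (n : ℂ) + 1) ≠ 0 := by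
    have : (4 * n + 1 : ℕ) ≠ 0 := by lia
    exact_mod_cast this
  have h2 : ((√((4 * (n : ℝ) + 1) / π) : ℝ) : ℂ) ≠ 0 := by
    have : 0 < √((4 * (n : ℝ) + 1) / π) := Real.sqrt_pos.2 (by positivity)
    exact_mod_cast this.ne'
  simp only [Complex.ofReal_mul] at h
  have h3 := mul_left_cancel₀ h2 h
  rw [← h3]
  push_cast
  field_simp

theorem legendreMoment_cos (ρ : ℂ) (n : ℕ) :
    legendreMoment (fun t => Complex.cos (ρ * t)) n =
      π * ((-1) ^ n * sphericalBesselJ (2 * n) (ρ * π)) := by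
  rw [← integral_cos_mul_legendreP]
  have h := intervalIntegral.integral_comp_div (a := 0) (b := π)
    (fun x : ℝ => Complex.cos (ρ * π * x) * legendreP (2 * n) x) Real.pi_pos.ne'
  rw [zero_div, div_self Real.pi_pos.ne'] at h
  unfold legendreMoment
  rw [← Complex.real_smul, ← h]
  refine intervalIntegral.integral_congr fun t _ => ?_
  have hp : (π : ℂ) ≠ 0 := by exact_mod_cast Real.pi_pos.ne'
  push_cast
  congr 2
  field_simp

theorem legendreMoment_sin {ρ : ℂ} (hρ : ρ ≠ 0) (n : ℕ) :
    legendreMoment (fun t => -(t * Complex.sin (ρ * t))) n =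
      π * ((-1) ^ n * (2 * n / ρ * sphericalBesselJ (2 * n) (ρ * π)
        - π * sphericalBesselJ (2 * n + 1) (ρ * π))) := by
  have hp : (π : ℂ) ≠ 0 := by exact_mod_cast Real.pi_pos.ne'
  have h0 := integral_sin_mul_legendreP n (mul_ne_zero hρ hp)
  have h := intervalIntegral.integral_comp_div (a := 0) (b := π)
    (fun x : ℝ => -(x * Complex.sin (ρ * π * x)) * legendreP (2 * n) x) Real.pi_pos.ne'
  rw [zero_div, div_self Real.pi_pos.ne', h0, Complex.real_smul] at h
  have h2 : legendreMoment (fun t => -(t * Complex.sin (ρ * t))) n =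
      π * ∫ t in (0 : ℝ)..π, -(((t / π : ℝ) : ℂ) * Complex.sin (ρ * π * ((t / π : ℝ) : ℂ))) *
        legendreP (2 * n) (t / π) := by
    unfold legendreMoment
    rw [← intervalIntegral.integral_const_mul]
    refine intervalIntegral.integral_congr fun t _ => ?_
    push_cast
    rw [show ρ * π * ((t : ℂ) / π) = ρ * t by field_simp]
    field_simp
  rw [h2, h]
  field_simp

/-! ### Cosine transforms as entire functions of the squared frequency -/

theorem intervalIntegrable_ofReal {f : ℝ → ℝ} {a b : ℝ} (hf : IntervalIntegrable f volume a b) :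
    IntervalIntegrable (fun t => (f t : ℂ)) volume a b := ⟨hf.1.ofReal, hf.2.ofReal⟩

/-- The entire function `w ↦ cos √w`. -/
def cosSqrt (w : ℂ) : ℂ := ∑' n : ℕ, (-w) ^ n / ((2 * n).factorial : ℂ)

theorem cosSqrt_sq (z : ℂ) : cosSqrt (z ^ 2) = Complex.cos z := by
  rw [cosSqrt, ← (Complex.hasSum_cos z).tsum_eq]
  refine tsum_congr fun n => ?_
  rw [neg_pow, pow_mul]

theorem differentiable_cosSqrt : Differentiable ℂ cosSqrt := by
  intro z
  have h : DifferentiableOn ℂ cosSqrt (Metric.ball 0 (‖z‖ + 1)) := by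
    refine Complex.differentiableOn_tsum_of_summable_norm
      (u := fun n => (‖z‖ + 1) ^ n / (n.factorial : ℝ)) (Real.summable_pow_div_factorial _)
      (fun n => by fun_prop) Metric.isOpen_ball fun n w hw => ?_
    rw [norm_div, norm_pow, norm_neg, Complex.norm_natCast]
    have hw' : ‖w‖ ≤ ‖z‖ + 1 := by simpa using (Metric.mem_ball.1 hw).le
    have : (n.factorial : ℝ) ≤ (2 * n).factorial := by
      exact_mod_cast Nat.factorial_le (by lia)
    gcongr
  exact (h z (by simp)).differentiableAt (Metric.isOpen_ball.mem_nhds (by simp))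

@[fun_prop]
theorem continuous_cosSqrt : Continuous cosSqrt := differentiable_cosSqrt.continuous

@[fun_prop]
theorem continuous_deriv_cosSqrt : Continuous (deriv cosSqrt) :=
  (differentiable_cosSqrt.contDiff (n := 1)).continuous_deriv le_rfl

theorem differentiable_deriv_cosSqrt : Differentiable ℂ (deriv cosSqrt) := by
  have h : ContDiff ℂ (1 + 1) cosSqrt := differentiable_cosSqrt.contDiff
  exact (contDiff_succ_iff_deriv.1 h).2.2.differentiable (by norm_num)

theorem mul_deriv_cosSqrt_sq (z : ℂ) : 2 * z * deriv cosSqrt (z ^ 2) = -Complex.sin z := by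
  have h1 := (differentiable_cosSqrt (z ^ 2)).hasDerivAt.comp z (hasDerivAt_pow 2 z)
  have h2 : cosSqrt ∘ (fun z => z ^ 2) = Complex.cos := by
    ext z; exact cosSqrt_sq z
  rw [h2] at h1
  have := h1.unique (Complex.hasDerivAt_cos z)
  rw [← this]
  push_cast
  ring

/-- Division of `2z · cosSqrt'(z²) = -sin z` by `z`, in the limit `z → 0`. -/
theorem deriv_cosSqrt_zero : deriv cosSqrt 0 = -1 / 2 := by
  have h1 : Filter.Tendsto (fun z : ℂ => 2 * deriv cosSqrt (z ^ 2)) (nhdsWithin 0 {0}ᶜ)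
      (nhds (2 * deriv cosSqrt (0 ^ 2))) := by
    refine Filter.Tendsto.mono_left (Continuous.tendsto ?_ 0) nhdsWithin_le_nhds
    fun_prop
  have h2 := (Complex.hasDerivAt_sin 0).tendsto_slope.neg
  have h3 := tendsto_nhds_unique (h1.congr' ?_) h2
  · simp at h3
    linear_combination h3 / 2
  · filter_upwards [self_mem_nhdsWithin] with z hz
    have hz' : z ≠ 0 := hz
    have := mul_deriv_cosSqrt_sq z
    rw [slope_def_field]
    simp only [Complex.sin_zero, sub_zero]
    field_simp
    linear_combination this

theorem norm_cos_le (z : ℂ) : ‖Complex.cos z‖ ≤ Real.exp |z.im| := by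
  rw [Complex.cos, norm_div, Complex.norm_ofNat, div_le_iff₀ (by norm_num)]
  refine (norm_add_le _ _).trans ?_
  rw [Complex.norm_exp, Complex.norm_exp]
  have h1 : Real.exp (z * Complex.I).re ≤ Real.exp |z.im| :=
    Real.exp_le_exp.2 (by simp; exact neg_le_abs _)
  have h2 : Real.exp (-z * Complex.I).re ≤ Real.exp |z.im| :=
    Real.exp_le_exp.2 (by simp; exact le_abs_self _)
  linarith

theorem norm_sin_le (z : ℂ) : ‖Complex.sin z‖ ≤ Real.exp |z.im| := by
  have := norm_cos_le (z - π / 2)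
  rw [Complex.cos_sub_pi_div_two] at this
  have h : (z - π / 2).im = z.im := by
    rw [Complex.sub_im, show (π / 2 : ℂ) = ((π / 2 : ℝ) : ℂ) by push_cast; ring, Complex.ofReal_im,
      sub_zero]
  rwa [h] at this

theorem abs_im_mul_ofReal_le (ρ : ℂ) {t : ℝ} (ht : t ∈ Icc 0 π) : |(ρ * t).im| ≤ π * |ρ.im| := by
  rw [Complex.im_mul_ofReal, abs_mul, abs_of_nonneg ht.1, mul_comm]
  gcongr
  exact ht.2

theorem norm_cos_mul_le (ρ : ℂ) {t : ℝ} (ht : t ∈ Icc 0 π) :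
    ‖Complex.cos (ρ * t)‖ ≤ Real.exp (π * |ρ.im|) :=
  (norm_cos_le _).trans (Real.exp_le_exp.2 (abs_im_mul_ofReal_le ρ ht))

theorem norm_sin_mul_le (ρ : ℂ) {t : ℝ} (ht : t ∈ Icc 0 π) :
    ‖Complex.sin (ρ * t)‖ ≤ Real.exp (π * |ρ.im|) :=
  (norm_sin_le _).trans (Real.exp_le_exp.2 (abs_im_mul_ofReal_le ρ ht))

/-- The cosine transform of `f` on `(0, π)` as a function of the square of the frequency. -/
def cosTransform (f : ℝ → ℂ) (w : ℂ) : ℂ := ∫ t in (0 : ℝ)..π, f t * cosSqrt (w * t ^ 2)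

theorem cosTransform_sq (f : ℝ → ℂ) (ρ : ℂ) :
    cosTransform f (ρ ^ 2) = ∫ t in (0 : ℝ)..π, f t * Complex.cos (ρ * t) := by
  simp_rw [cosTransform, ← mul_pow, cosSqrt_sq]

theorem norm_cosTransform_sq_le {f : ℝ → ℂ} (hf : IntervalIntegrable f volume 0 π) (ρ : ℂ) :
    ‖cosTransform f (ρ ^ 2)‖ ≤ (∫ t in (0 : ℝ)..π, ‖f t‖) * Real.exp (π * |ρ.im|) := by
  rw [cosTransform_sq, ← intervalIntegral.integral_mul_const]
  refine intervalIntegral.norm_integral_le_of_norm_le Real.pi_pos.le (ae_of_all _ fun t ht => ?_)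
    (hf.norm.mul_const _)
  rw [norm_mul]
  gcongr
  exact norm_cos_mul_le ρ ⟨ht.1.le, ht.2⟩

theorem hasDerivAt_cosTransform {f : ℝ → ℂ} (hf : IntervalIntegrable f volume 0 π) (w : ℂ) :
    HasDerivAt (cosTransform f)
      (∫ t in (0 : ℝ)..π, f t * (t ^ 2 * deriv cosSqrt (w * t ^ 2))) w := by
  have hcont : Continuous fun p : ℂ × ℝ => (p.2 : ℂ) ^ 2 * deriv cosSqrt (p.1 * p.2 ^ 2) := by
    fun_prop
  obtain ⟨C, hC⟩ := ((isCompact_closedBall w 1).prod (isCompact_Icc (a := (0 : ℝ)) (b := π))).exists_bound_of_continuousOn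
    hcont.continuousOn
  refine (intervalIntegral.hasDerivAt_integral_of_dominated_loc_of_deriv_le (μ := volume)
    (F := fun w t => f t * cosSqrt (w * t ^ 2)) (a := 0) (b := π)
    (F' := fun w t => f t * (t ^ 2 * deriv cosSqrt (w * t ^ 2))) (bound := fun t => ‖f t‖ * C)
    (Metric.closedBall_mem_nhds w one_pos) ?_ ?_ ?_ ?_ ?_ ?_).2
  · refine Filter.Eventually.of_forall fun x => ?_
    exact ((hf.mul_continuousOn (by fun_prop)).def').aestronglyMeasurable
  · exact hf.mul_continuousOn (by fun_prop)
  · exact ((hf.mul_continuousOn (by fun_prop)).def').aestronglyMeasurable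
  · refine ae_of_all _ fun t ht x hx => ?_
    rw [uIoc_of_le Real.pi_pos.le] at ht
    rw [norm_mul]
    gcongr
    exact hC (x, t) ⟨hx, ht.1.le, ht.2⟩
  · exact hf.norm.mul_const _
  · refine ae_of_all _ fun t _ x _ => ?_
    have h1 : HasDerivAt (fun x : ℂ => x * (t : ℂ) ^ 2) ((t : ℂ) ^ 2) x := by
      simpa using (hasDerivAt_id x).mul_const ((t : ℂ) ^ 2)
    have := ((differentiable_cosSqrt (x * t ^ 2)).hasDerivAt.comp x h1).const_mul (f t)
    refine this.congr_deriv ?_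
    ring

theorem differentiable_cosTransform {f : ℝ → ℂ} (hf : IntervalIntegrable f volume 0 π) :
    Differentiable ℂ (cosTransform f) := fun w => (hasDerivAt_cosTransform hf w).differentiableAt

theorem mul_deriv_cosTransform_sq {f : ℝ → ℂ} (hf : IntervalIntegrable f volume 0 π) (ρ : ℂ) :
    2 * ρ * deriv (cosTransform f) (ρ ^ 2) =
      ∫ t in (0 : ℝ)..π, f t * -(t * Complex.sin (ρ * t)) := by
  rw [(hasDerivAt_cosTransform hf _).deriv, ← intervalIntegral.integral_const_mul]
  refine intervalIntegral.integral_congr fun t _ => ?_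
  have := mul_deriv_cosSqrt_sq (ρ * t)
  rw [← mul_pow]
  linear_combination f t * t * this

theorem deriv_cosTransform_zero {f : ℝ → ℂ} (hf : IntervalIntegrable f volume 0 π) :
    deriv (cosTransform f) 0 = -1 / 2 * ∫ t in (0 : ℝ)..π, f t * t ^ 2 := by
  rw [(hasDerivAt_cosTransform hf _).deriv, ← intervalIntegral.integral_const_mul]
  refine intervalIntegral.integral_congr fun t _ => ?_
  simp only [zero_mul, deriv_cosSqrt_zero]
  ring

/-- A Riemann–Lebesgue lemma, uniform in the complex frequency. -/
theorem exists_norm_cosTransform_ofReal_le {f : ℝ → ℝ} (hf : IntervalIntegrable f volume 0 π)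
    {ε : ℝ} (hε : 0 < ε) : ∃ R : ℝ, ∀ ρ : ℂ, R ≤ ‖ρ‖ →
      ‖cosTransform (fun t => (f t : ℂ)) (ρ ^ 2)‖ ≤ ε * Real.exp (π * |ρ.im|) := by
  have hpi := Real.pi_pos
  have hfi : Integrable f (volume.restrict (Ioc 0 π)) :=
    (intervalIntegrable_iff_integrableOn_Ioc_of_le hpi.le).1 hf
  obtain ⟨g, hg, -⟩ := hfi.exists_boundedContinuous_integral_sub_le (half_pos hε)
  -- The `L¹` errors are `ε/2` for `g` and `π · ε/(4π)` for the polynomial, together `3ε/4`. The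
  -- last quarter is left for the transform of `p`, which is `O(1/‖ρ‖)` times the exponential after
  -- one integration by parts; `B` is the constant there.
  obtain ⟨p, hp⟩ := exists_polynomial_near_of_continuousOn 0 π g g.continuous.continuousOn
    (ε / (4 * π)) (by positivity)
  have hfp : ∫ t in (0 : ℝ)..π, ‖f t - p.eval t‖ ≤ 3 / 4 * ε := by
    have h1 : IntervalIntegrable (fun t => ‖f t - g t‖) volume 0 π :=
      (hf.sub (g.continuous.intervalIntegrable _ _)).norm
    have h2 : ∫ t in (0 : ℝ)..π, ‖f t - p.eval t‖ ≤
        ∫ t in (0 : ℝ)..π, (‖f t - g t‖ + ε / (4 * π)) := by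
      refine intervalIntegral.integral_mono_on hpi.le
        (hf.sub (p.continuous.intervalIntegrable _ _)).norm (h1.add intervalIntegrable_const)
        fun t ht => ?_
      have := (hp t ht).le
      rw [abs_sub_comm] at this
      calc ‖f t - p.eval t‖ = ‖(f t - g t) + (g t - p.eval t)‖ := by ring_nf
        _ ≤ _ := (norm_add_le _ _).trans (by gcongr; exact this)
    refine h2.trans ?_
    rw [intervalIntegral.integral_add h1 intervalIntegrable_const,
      intervalIntegral.integral_of_le hpi.le, intervalIntegral.integral_const]
    have : (π - 0) • (ε / (4 * π)) = ε / 4 := by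
      rw [smul_eq_mul]; field_simp; ring
    rw [this]
    linarith
  set B := ‖p.eval π‖ + ∫ t in (0 : ℝ)..π, ‖p.derivative.eval t‖ with hB
  refine ⟨4 * B / ε + 1, fun ρ hρ => ?_⟩
  have hB0 : 0 ≤ B := add_nonneg (norm_nonneg _)
    (intervalIntegral.integral_nonneg hpi.le fun t _ => norm_nonneg _)
  have hρpos : 0 < ‖ρ‖ := lt_of_lt_of_le (by positivity) hρ
  have hρ0 : ρ ≠ 0 := norm_pos_iff.1 hρpos
  have hpart : ‖cosTransform (fun t => ((p.eval t : ℝ) : ℂ)) (ρ ^ 2)‖ ≤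
      B / ‖ρ‖ * Real.exp (π * |ρ.im|) := by
    have key := intervalIntegral.integral_mul_deriv_eq_deriv_mul (a := 0) (b := π)
      (u := fun t : ℝ => ((p.eval t : ℝ) : ℂ)) (v := fun t : ℝ => Complex.sin (ρ * t) / ρ)
      (u' := fun t => ((p.derivative.eval t : ℝ) : ℂ)) (v' := fun t : ℝ => Complex.cos (ρ * t))
      (fun t _ => (p.hasDerivAt t).ofReal_comp)
      (fun t _ => by
        have h1 : HasDerivAt (fun t : ℝ => ρ * (t : ℂ)) ρ t := by
          simpa using (Complex.ofRealCLM.hasDerivAt (x := t)).const_mul ρ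
        have := ((Complex.hasDerivAt_sin (ρ * t)).comp t h1).div_const ρ
        refine this.congr_deriv ?_
        field_simp)
      (by apply Continuous.intervalIntegrable; fun_prop)
      (by apply Continuous.intervalIntegrable; fun_prop)
    rw [cosTransform_sq, key]
    have hi : ‖∫ t in (0 : ℝ)..π, ((p.derivative.eval t : ℝ) : ℂ) * (Complex.sin (ρ * t) / ρ)‖ ≤
        ∫ t in (0 : ℝ)..π, ‖p.derivative.eval t‖ * (Real.exp (π * |ρ.im|) / ‖ρ‖) := by
      refine intervalIntegral.norm_integral_le_of_norm_le hpi.le (ae_of_all _ fun t ht => ?_)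
        (by apply Continuous.intervalIntegrable; fun_prop)
      rw [norm_mul, norm_div, Complex.norm_real]
      gcongr
      exact norm_sin_mul_le ρ ⟨ht.1.le, ht.2⟩
    rw [intervalIntegral.integral_mul_const] at hi
    refine (norm_sub_le _ _).trans ?_
    have h3 : ‖((p.eval π : ℝ) : ℂ) * (Complex.sin (ρ * π) / ρ) -
        ((p.eval 0 : ℝ) : ℂ) * (Complex.sin (ρ * (0 : ℝ)) / ρ)‖ ≤
        ‖p.eval π‖ * (Real.exp (π * |ρ.im|) / ‖ρ‖) := by
      simp only [Complex.ofReal_zero, mul_zero, Complex.sin_zero, zero_div, sub_zero]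
      rw [norm_mul, norm_div, Complex.norm_real]
      gcongr
      exact norm_sin_mul_le ρ ⟨hpi.le, le_rfl⟩
    calc _ ≤ _ := add_le_add h3 hi
      _ = _ := by rw [hB]; ring
  have hsplit : cosTransform (fun t => (f t : ℂ)) (ρ ^ 2) =
      cosTransform (fun t => ((f t - p.eval t : ℝ) : ℂ)) (ρ ^ 2) +
        cosTransform (fun t => ((p.eval t : ℝ) : ℂ)) (ρ ^ 2) := by
    have hc : Continuous fun t : ℝ => cosSqrt (ρ ^ 2 * t ^ 2) := by fun_prop
    unfold cosTransform
    rw [← intervalIntegral.integral_add]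
    · refine intervalIntegral.integral_congr fun t _ => ?_
      push_cast
      ring
    · exact IntervalIntegrable.mul_continuousOn (intervalIntegrable_ofReal (hf.sub (p.continuous.intervalIntegrable _ _)))
        hc.continuousOn
    · apply Continuous.intervalIntegrable
      fun_prop
  rw [hsplit]
  refine (norm_add_le _ _).trans ?_
  have h1 := norm_cosTransform_sq_le (f := fun t => ((f t - p.eval t : ℝ) : ℂ))
    (intervalIntegrable_ofReal (hf.sub (p.continuous.intervalIntegrable _ _))) ρ
  simp_rw [Complex.norm_real] at h1
  have h2 : B / ‖ρ‖ ≤ ε / 4 := by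
    rw [div_le_iff₀ hρpos]
    have : 4 * B / ε * ε = 4 * B := by field_simp
    nlinarith
  calc _ ≤ 3 / 4 * ε * Real.exp (π * |ρ.im|) + ε / 4 * Real.exp (π * |ρ.im|) := by
        refine add_le_add (h1.trans ?_) (hpart.trans ?_) <;> gcongr
    _ = _ := by ring

theorem exists_norm_cosTransform_le {f : ℝ → ℂ} (hf : IntervalIntegrable f volume 0 π)
    {ε : ℝ} (hε : 0 < ε) : ∃ R : ℝ, ∀ ρ : ℂ, R ≤ ‖ρ‖ →
      ‖cosTransform f (ρ ^ 2)‖ ≤ ε * Real.exp (π * |ρ.im|) := by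
  have hre : IntervalIntegrable (fun t => (f t).re) volume 0 π := ⟨hf.1.re, hf.2.re⟩
  have him : IntervalIntegrable (fun t => (f t).im) volume 0 π := ⟨hf.1.im, hf.2.im⟩
  obtain ⟨R1, h1⟩ := exists_norm_cosTransform_ofReal_le hre (half_pos hε)
  obtain ⟨R2, h2⟩ := exists_norm_cosTransform_ofReal_le him (half_pos hε)
  refine ⟨max R1 R2, fun ρ hρ => ?_⟩
  have hc : Continuous fun t : ℝ => cosSqrt (ρ ^ 2 * t ^ 2) := by fun_prop
  have hsplit : cosTransform f (ρ ^ 2) = cosTransform (fun t => ((f t).re : ℂ)) (ρ ^ 2) +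
      Complex.I * cosTransform (fun t => ((f t).im : ℂ)) (ρ ^ 2) := by
    unfold cosTransform
    rw [← intervalIntegral.integral_const_mul, ← intervalIntegral.integral_add
      (IntervalIntegrable.mul_continuousOn (intervalIntegrable_ofReal hre) hc.continuousOn)
      ((IntervalIntegrable.mul_continuousOn (intervalIntegrable_ofReal him) hc.continuousOn).const_mul _)]
    refine intervalIntegral.integral_congr fun t _ => ?_
    nth_rewrite 1 [← Complex.re_add_im (f t)]
    ring
  rw [hsplit]
  refine (norm_add_le _ _).trans ?_
  rw [norm_mul, Complex.norm_I, one_mul]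
  have := h1 ρ (le_of_max_le_left hρ)
  have := h2 ρ (le_of_max_le_right hρ)
  linarith

/-! ### A uniqueness principle for entire functions; cosine and sine on large circles -/

/-- An entire function that vanishes at the zeros, all simple, of another one and is negligible
with respect to it on arbitrarily large circles is zero. -/
theorem eq_zero_of_vanishing_at_simple_zeros {F Φ : ℂ → ℂ} (hF : Differentiable ℂ F)
    (hΦ : Differentiable ℂ Φ) (hz : ∀ z, Φ z = 0 → F z = 0 ∧ deriv Φ z ≠ 0)
    (hb : ∀ ε > 0, ∀ R : ℝ, ∃ r > R, ∀ z, ‖z‖ = r → Φ z ≠ 0 ∧ ‖F z‖ ≤ ε * ‖Φ z‖) (z : ℂ) :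
    F z = 0 := by
  classical
  -- The quotient `F / Φ` with its removable singularities filled in; near a zero of `Φ` it is the
  -- quotient of the two `dslope`s.
  set Q : ℂ → ℂ := fun z => if Φ z = 0 then deriv F z / deriv Φ z else F z / Φ z with hQ
  have hQd : Differentiable ℂ Q := by
    intro w
    by_cases hw : Φ w = 0
    · obtain ⟨hFw, hdw⟩ := hz w hw
      have hdF : DifferentiableAt ℂ (dslope F w) w :=
        ((Complex.differentiableOn_dslope (s := univ) (c := w) Filter.univ_mem).2
          hF.differentiableOn w (mem_univ w)).differentiableAt Filter.univ_mem
      have hdΦ : DifferentiableAt ℂ (dslope Φ w) w :=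
        ((Complex.differentiableOn_dslope (s := univ) (c := w) Filter.univ_mem).2
          hΦ.differentiableOn w (mem_univ w)).differentiableAt Filter.univ_mem
      have hne : dslope Φ w w ≠ 0 := by rwa [dslope_same]
      refine (hdF.div hdΦ hne).congr_of_eventuallyEq ?_
      filter_upwards [hdΦ.continuousAt.eventually_ne hne] with u hu
      by_cases huw : u = w
      · subst huw
        simp [hQ, hw]
      · rw [dslope_of_ne _ huw, slope_def_field, hw, sub_zero] at hu
        have hΦu : Φ u ≠ 0 := fun h => hu (by simp [h])
        have huw' : u - w ≠ 0 := sub_ne_zero.2 huw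
        simp only [hQ, if_neg hΦu, Pi.div_apply, dslope_of_ne _ huw, slope_def_field, hw, hFw,
          sub_zero]
        field_simp
    · refine ((hF w).div (hΦ w) hw).congr_of_eventuallyEq ?_
      filter_upwards [(hΦ w).continuousAt.eventually_ne hw] with u hu
      simp [hQ, hu]
  by_cases hzz : Φ z = 0
  · exact (hz z hzz).1
  -- Maximum modulus principle on a circle enclosing `z`.
  have hle : ∀ ε > 0, ‖Q z‖ ≤ ε := by
    intro ε hε
    obtain ⟨r, hr, hrb⟩ := hb ε hε (max ‖z‖ 0)
    refine Complex.norm_le_of_forall_mem_frontier_norm_le (U := Metric.ball 0 r)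
      Metric.isBounded_ball hQd.diffContOnCl (fun w hw => ?_)
      (subset_closure (by simpa using lt_of_le_of_lt (le_max_left _ _) hr))
    rw [frontier_ball _ (lt_of_le_of_lt (le_max_right _ _) hr).ne', mem_sphere_zero_iff_norm] at hw
    obtain ⟨h1, h2⟩ := hrb w hw
    simp only [hQ, if_neg h1]
    rw [norm_div, div_le_iff₀ (norm_pos_iff.2 h1)]
    exact h2
  have h0 : Q z = 0 := norm_le_zero_iff.1 (le_of_forall_pos_le_add fun ε hε => by
    simpa using hle ε hε)
  simp only [hQ, if_neg hzz] at h0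
  exact (div_eq_zero_iff.1 h0).resolve_right hzz

theorem norm_sq_cos (z : ℂ) : ‖Complex.cos z‖ ^ 2 = Real.cos z.re ^ 2 + Real.sinh z.im ^ 2 := by
  have h : Complex.cos z = ((Real.cos z.re * Real.cosh z.im : ℝ) : ℂ) -
      ((Real.sin z.re * Real.sinh z.im : ℝ) : ℂ) * Complex.I := by
    nth_rewrite 1 [← Complex.re_add_im z]
    rw [Complex.cos_add_mul_I]
    push_cast
    ring
  rw [← Complex.normSq_eq_norm_sq, h, Complex.normSq_apply]
  simp only [Complex.sub_re, Complex.sub_im, Complex.mul_re, Complex.mul_im, Complex.ofReal_re,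
    Complex.ofReal_im, Complex.I_re, Complex.I_im]
  have h1 := Real.cosh_sq z.im
  have h2 := Real.sin_sq_add_cos_sq z.re
  ring_nf
  rw [h1]
  linear_combination Real.sinh z.im ^ 2 * h2

theorem norm_sq_sin (z : ℂ) : ‖Complex.sin z‖ ^ 2 = Real.sin z.re ^ 2 + Real.sinh z.im ^ 2 := by
  have h := norm_sq_cos (z - ((π / 2 : ℝ) : ℂ))
  rw [Complex.sub_re, Complex.sub_im, Complex.ofReal_re, Complex.ofReal_im, sub_zero,
    Real.cos_sub_pi_div_two] at h
  rw [← h]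
  push_cast
  rw [Complex.cos_sub_pi_div_two]

/-- For `|b| < 1` the left side is at most `1/4`, and `A` alone suffices. For `|b| ≥ 1` the term `A`
can be dropped, since `sinh y ≥ exp y / 4` at `y = π|b|`. -/
theorem exp_le_of_norm_sq {A N b : ℝ} (hN : 0 ≤ N) (hA : 0 ≤ A) (h : N ^ 2 = A + Real.sinh (b * π) ^ 2)
    (hAb : |b| < 1 → 1 / 2 ≤ A) : Real.exp (-π) / 4 * Real.exp (π * |b|) ≤ N := by
  have hpi := Real.pi_gt_three
  have he : Real.exp (-π) ≤ 1 := Real.exp_le_one_iff.2 (by linarith)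
  refine abs_le_of_sq_le_sq' ?_ hN |>.2
  rw [h]
  rcases lt_or_ge |b| 1 with hb | hb
  · have h1 : Real.exp (-π) * Real.exp (π * |b|) ≤ 1 := by
      rw [← Real.exp_add]
      exact Real.exp_le_one_iff.2 (by nlinarith)
    have h2 : 0 < Real.exp (-π) * Real.exp (π * |b|) := by positivity
    have := hAb hb
    nlinarith [sq_nonneg (Real.sinh (b * π))]
  · have h1 : Real.sinh (b * π) ^ 2 = Real.sinh (π * |b|) ^ 2 := by
      rcases abs_cases b with ⟨h, _⟩ | ⟨h, _⟩ <;> rw [h]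
      · rw [mul_comm]
      · rw [mul_neg, Real.sinh_neg, mul_comm]; ring
    rw [h1]
    set y := π * |b|
    have hy : 1 ≤ y := by nlinarith
    have h2 : Real.exp y / 4 ≤ Real.sinh y := by
      rw [Real.sinh_eq]
      have h3 : Real.exp (-y) ≤ 1 := Real.exp_le_one_iff.2 (by linarith)
      have h4 := Real.add_one_le_exp y
      linarith
    have h5 : Real.exp (-π) / 4 * Real.exp y ≤ Real.exp y / 4 := by
      have := Real.exp_pos y
      nlinarith
    have h6 : 0 ≤ Real.exp (-π) / 4 * Real.exp y := by positivity
    nlinarith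

theorem half_le_cos_sq {d : ℝ} (h0 : 0 ≤ d) (h1 : d ≤ 1 / 4) : 1 / 2 ≤ Real.cos (π * d) ^ 2 := by
  have hpi := Real.pi_pos
  rw [Real.cos_sq]
  have : 0 ≤ Real.cos (2 * (π * d)) := Real.cos_nonneg_of_mem_Icc
    ⟨by nlinarith, by nlinarith⟩
  linarith

/-- From `(r - |re|)(r + |re|) = im² < 1` and `r ≥ 4`: near the real axis the circle stays close to
`±r`, so its radius can be chosen to keep `cos` or `sin` away from zero there. -/
theorem sub_abs_re_mem {ρ : ℂ} {r : ℝ} (hr : 4 ≤ r) (hρ : ‖ρ‖ = r) (hb : |ρ.im| < 1) :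
    0 ≤ r - |ρ.re| ∧ r - |ρ.re| ≤ 1 / 4 := by
  have h1 : |ρ.re| ≤ r := hρ ▸ Complex.abs_re_le_norm ρ
  refine ⟨by linarith, ?_⟩
  have h2 : r ^ 2 = |ρ.re| ^ 2 + |ρ.im| ^ 2 := by
    rw [← hρ, ← Complex.normSq_eq_norm_sq, Complex.normSq_apply, sq_abs, sq_abs]
    ring
  by_contra hcon
  push Not at hcon
  nlinarith [abs_nonneg ρ.re, abs_nonneg ρ.im]

theorem exp_le_norm_cos {ρ : ℂ} {n : ℕ} (hn : 4 ≤ n) (hρ : ‖ρ‖ = n) :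
    Real.exp (-π) / 4 * Real.exp (π * |ρ.im|) ≤ ‖Complex.cos (ρ * π)‖ := by
  refine exp_le_of_norm_sq (A := Real.cos (ρ * π).re ^ 2) (norm_nonneg _) (sq_nonneg _)
    (by rw [norm_sq_cos, Complex.im_mul_ofReal]) fun hb => ?_
  obtain ⟨h1, h2⟩ := sub_abs_re_mem (by exact_mod_cast hn) hρ hb
  refine (half_le_cos_sq h1 h2).trans (le_of_eq ?_)
  rw [mul_sub, mul_comm π, Real.cos_nat_mul_pi_sub, mul_pow, ← pow_mul, mul_comm n 2, pow_mul,
    Complex.re_mul_ofReal, mul_comm π]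
  rcases abs_cases ρ.re with ⟨h, _⟩ | ⟨h, _⟩ <;> rw [h] <;> simp

theorem exp_le_norm_sin {ρ : ℂ} {n : ℕ} (hn : 4 ≤ n) (hρ : ‖ρ‖ = n + 1 / 2) :
    Real.exp (-π) / 4 * Real.exp (π * |ρ.im|) ≤ ‖Complex.sin (ρ * π)‖ := by
  refine exp_le_of_norm_sq (A := Real.sin (ρ * π).re ^ 2) (norm_nonneg _) (sq_nonneg _)
    (by rw [norm_sq_sin, Complex.im_mul_ofReal]) fun hb => ?_
  have hn' : (4 : ℝ) ≤ n := by exact_mod_cast hn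
  obtain ⟨h1, h2⟩ := sub_abs_re_mem (by linarith) hρ hb
  refine (half_le_cos_sq h1 h2).trans (le_of_eq ?_)
  rw [show π * ((n : ℝ) + 1 / 2 - |ρ.re|) = n * π - (|ρ.re| * π - π / 2) by ring,
    Real.cos_nat_mul_pi_sub, mul_pow, ← pow_mul, mul_comm n 2, pow_mul, Real.cos_sub_pi_div_two,
    Complex.re_mul_ofReal]
  rcases abs_cases ρ.re with ⟨h, _⟩ | ⟨h, _⟩ <;> rw [h] <;> simp

/-! ### Integrals with a merely integrable weight: continuity in parameters, Fubini -/

theorem LocallyIntegrable.intervalIntegrable {E : Type*} [NormedAddCommGroup E] {κ : ℝ → E}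
    (hκ : LocallyIntegrable κ) {a b : ℝ} : IntervalIntegrable κ volume a b :=
  (hκ.integrableOn_isCompact isCompact_uIcc).intervalIntegrable

/-- Dominated convergence, the bound being `‖κ‖` times the maximum of `H` on a compact
neighbourhood. The potential is not continuous, so it is kept as a separate weight depending on the
integration variable only. -/
theorem continuous_integral_mul {𝕜 X : Type*} [RCLike 𝕜] [TopologicalSpace X]
    [FirstCountableTopology X] [LocallyCompactSpace X] {κ : ℝ → 𝕜} (hκ : LocallyIntegrable κ)
    {H : X → ℝ → 𝕜} (hH : Continuous fun p : X × ℝ => H p.1 p.2) {α β : X → ℝ}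
    (hα : Continuous α) (hβ : Continuous β) :
    Continuous fun x => ∫ s in (α x)..(β x), κ s * H x s := by
  have hint : ∀ x a b, IntervalIntegrable (fun s => κ s * H x s) volume a b := fun x a b =>
    (LocallyIntegrable.intervalIntegrable hκ).mul_continuousOn
      (hH.comp (Continuous.prodMk_right x)).continuousOn
  have key : ∀ {γ : X → ℝ}, Continuous γ → Continuous fun x => ∫ s in (0 : ℝ)..(γ x), κ s * H x s := by
    intro γ hγ
    rw [continuous_iff_continuousAt]
    intro x₀
    obtain ⟨K, hK, hKx⟩ := exists_compact_mem_nhds x₀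
    set R := |γ x₀| + 1
    have hR0 : 0 < R := by positivity
    obtain ⟨C, hC⟩ := (hK.prod (isCompact_Icc (a := -R) (b := R))).exists_bound_of_continuousOn
      hH.continuousOn
    have h := intervalIntegral.continuousAt_parametric_primitive_of_dominated (μ := volume)
      (F := fun x s => κ s * H x s) (fun s => ‖κ s‖ * C) (-R) R (a₀ := 0) (b₀ := γ x₀) (x₀ := x₀)
      (fun x => ((hint x (-R) R).def').aestronglyMeasurable)
      (by
        filter_upwards [hKx] with x hx
        refine (ae_restrict_iff' measurableSet_uIoc).2 (ae_of_all _ fun s hs => ?_)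
        rw [uIoc_of_le (by linarith)] at hs
        rw [norm_mul]
        gcongr
        exact hC (x, s) ⟨hx, hs.1.le, hs.2⟩)
      ((LocallyIntegrable.intervalIntegrable hκ).norm.mul_const C)
      (ae_of_all _ fun s => (continuous_const.mul
        (hH.comp (Continuous.prodMk_left s))).continuousAt)
      ⟨by linarith, hR0⟩ ⟨by linarith [neg_abs_le (γ x₀)], by linarith [le_abs_self (γ x₀)]⟩
      (by simp)
    exact h.comp (f := fun x => (x, γ x)) (continuousAt_id.prodMk hγ.continuousAt)
  have h2 : (fun x => ∫ s in (α x)..(β x), κ s * H x s) =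
      fun x => (∫ s in (0 : ℝ)..(β x), κ s * H x s) - ∫ s in (0 : ℝ)..(α x), κ s * H x s := by
    ext x
    rw [intervalIntegral.integral_interval_sub_left (hint _ _ _) (hint _ _ _)]
  rw [h2]
  exact (key hβ).sub (key hα)

/-- Fubini's theorem on a triangle. -/
theorem integral_triangle_swap {F : ℝ → ℝ → ℂ} {a b : ℝ} (hab : a ≤ b)
    (hF : IntegrableOn (fun p : ℝ × ℝ => F p.1 p.2) (Ioc a b ×ˢ Ioc a b)) :
    ∫ u in a..b, ∫ s in a..u, F u s = ∫ s in a..b, ∫ u in s..b, F u s := by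
  set T : Set (ℝ × ℝ) := {p | p.2 ≤ p.1} with hT
  have hTm : MeasurableSet T := measurableSet_le measurable_snd measurable_fst
  have hI : IntegrableOn (T.indicator fun p : ℝ × ℝ => F p.1 p.2) (Ioc a b ×ˢ Ioc a b) :=
    Integrable.indicator hF hTm
  rw [IntegrableOn, Measure.volume_eq_prod, ← Measure.prod_restrict] at hI
  have hsw := integral_integral_swap (f := fun u s => T.indicator (fun p : ℝ × ℝ => F p.1 p.2) (u, s))
    (by exact hI)
  have hL : ∀ u ∈ Ioc a b, ∫ s in Ioc a b, T.indicator (fun p : ℝ × ℝ => F p.1 p.2) (u, s) =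
      ∫ s in a..u, F u s := by
    intro u hu
    rw [intervalIntegral.integral_of_le hu.1.le]
    have : ∀ s, T.indicator (fun p : ℝ × ℝ => F p.1 p.2) (u, s) =
        (Iic u).indicator (fun s => F u s) s := fun s => by
      simp [indicator, hT]
    simp_rw [this]
    rw [setIntegral_indicator measurableSet_Iic]
    congr 2
    ext s
    simp only [mem_inter_iff, mem_Ioc, mem_Iic]
    constructor
    · rintro ⟨⟨h1, _⟩, h3⟩; exact ⟨h1, h3⟩
    · rintro ⟨h1, h3⟩; exact ⟨⟨h1, h3.trans hu.2⟩, h3⟩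
  have hR : ∀ s ∈ Ioc a b, ∫ u in Ioc a b, T.indicator (fun p : ℝ × ℝ => F p.1 p.2) (u, s) =
      ∫ u in s..b, F u s := by
    intro s hs
    have hIcc : ∫ u in Ioc s b, F u s = ∫ u in Icc s b, F u s := integral_Icc_eq_integral_Ioc.symm
    rw [intervalIntegral.integral_of_le hs.2, hIcc]
    have : ∀ u, T.indicator (fun p : ℝ × ℝ => F p.1 p.2) (u, s) =
        (Ici s).indicator (fun u => F u s) u := fun u => by
      simp [indicator, hT]
    simp_rw [this]
    rw [setIntegral_indicator measurableSet_Ici]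
    congr 2
    ext u
    simp only [mem_inter_iff, mem_Ioc, mem_Ici, mem_Icc]
    constructor
    · rintro ⟨⟨_, h1⟩, h3⟩; exact ⟨h3, h1⟩
    · rintro ⟨h1, h3⟩; exact ⟨⟨lt_of_lt_of_le hs.1 h1, h3⟩, h1⟩
  rw [intervalIntegral.integral_of_le hab, intervalIntegral.integral_of_le hab,
    ← setIntegral_congr_fun measurableSet_Ioc hL, ← setIntegral_congr_fun measurableSet_Ioc hR]
  exact hsw

theorem integrableOn_square_mul {κ : ℝ → ℂ} (hκ : LocallyIntegrable κ) {H : ℝ → ℝ → ℂ}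
    (hH : Continuous fun p : ℝ × ℝ => H p.1 p.2) (a b : ℝ) :
    IntegrableOn (fun p : ℝ × ℝ => κ p.2 * H p.1 p.2) (Ioc a b ×ˢ Ioc a b) := by
  obtain ⟨C, hC⟩ := ((isCompact_Icc (a := a) (b := b)).prod
    (isCompact_Icc (a := a) (b := b))).exists_bound_of_continuousOn hH.continuousOn
  have hκi : IntegrableOn κ (Ioc a b) :=
    (hκ.integrableOn_isCompact isCompact_Icc).mono_set Ioc_subset_Icc_self
  have h1 : IntegrableOn (fun p : ℝ × ℝ => κ p.2) (Ioc a b ×ˢ Ioc a b) := by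
    rw [IntegrableOn, Measure.volume_eq_prod, ← Measure.prod_restrict]
    exact hκi.comp_snd _
  refine Integrable.mul_bdd (c := C) h1 hH.aestronglyMeasurable ?_
  refine (ae_restrict_iff' (measurableSet_Ioc.prod measurableSet_Ioc)).2 (ae_of_all _ fun p hp => ?_)
  exact hC p ⟨Ioc_subset_Icc_self hp.1, Ioc_subset_Icc_self hp.2⟩

theorem integral_triangle_swap_mul {κ : ℝ → ℂ} (hκ : LocallyIntegrable κ) {H : ℝ → ℝ → ℂ}
    (hH : Continuous fun p : ℝ × ℝ => H p.1 p.2) {a b : ℝ} (hab : a ≤ b) :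
    ∫ u in a..b, ∫ s in a..u, κ s * H u s = ∫ s in a..b, κ s * ∫ u in s..b, H u s := by
  rw [integral_triangle_swap hab (integrableOn_square_mul hκ hH a b)]
  simp_rw [intervalIntegral.integral_const_mul]

/-- The reflection `p ↦ a + b - p` reduces the region `p + s ≤ a + b` to an ordinary triangle. -/
theorem integral_antitriangle_swap {κ : ℝ → ℂ} (hκ : LocallyIntegrable κ) {f : ℝ → ℂ}
    (hf : Continuous f) {a b : ℝ} (hab : a ≤ b) :
    ∫ p in a..b, f p * ∫ s in a..(a + b - p), κ s =
      ∫ s in a..b, κ s * ∫ p in a..(a + b - s), f p := by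
  have h1 := intervalIntegral.integral_comp_sub_left (a := a) (b := b)
    (fun p => f p * ∫ s in a..(a + b - p), κ s) (a + b)
  rw [show a + b - b = a by ring, show a + b - a = b by ring] at h1
  rw [← h1]
  have h2 := integral_triangle_swap_mul hκ (H := fun u _ => f (a + b - u)) (by fun_prop) hab
  simp_rw [intervalIntegral.integral_mul_const] at h2
  have h3 : ∀ x, f (a + b - x) * ∫ s in a..(a + b - (a + b - x)), κ s =
      (∫ s in a..x, κ s) * f (a + b - x) := fun x => by
    rw [show a + b - (a + b - x) = x by ring, mul_comm]
  simp_rw [h3, h2]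
  refine intervalIntegral.integral_congr fun s _ => ?_
  rw [intervalIntegral.integral_comp_sub_left (fun p => f p), show a + b - b = a by ring]

theorem abs_integral_mul_le {κ H : ℝ → ℝ} (hκ : Integrable κ) {C a b : ℝ} (hC : 0 ≤ C)
    (hH : ∀ s, |H s| ≤ C) : |∫ s in a..b, κ s * H s| ≤ (∫ s, |κ s|) * C := by
  have h1 : |∫ s in a..b, κ s * H s| ≤ |∫ s in a..b, |κ s| * C| :=
    intervalIntegral.norm_integral_le_abs_of_norm_le (ae_of_all _ fun s => by
      rw [Real.norm_eq_abs, abs_mul]; gcongr; exact hH s)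
      ((hκ.abs.mul_const C).intervalIntegrable)
  rw [intervalIntegral.integral_mul_const, abs_mul, abs_of_nonneg hC] at h1
  refine h1.trans ?_
  gcongr
  rw [← Real.norm_eq_abs]
  refine (intervalIntegral.norm_integral_le_integral_norm_uIoc).trans ?_
  simp only [Real.norm_eq_abs, abs_abs]
  exact setIntegral_le_integral hκ.abs (ae_of_all _ fun s => abs_nonneg _)

/-! ### The Goursat kernel and the solution it generates -/

/-- The integral equation, in characteristic coordinates, for the transmutation kernel. -/
theorem exists_goursat_kernel {κ : ℝ → ℝ} (hκ : Integrable κ) (h : ℝ) :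
    ∃ G : ℝ → ℝ → ℝ, Continuous (fun p : ℝ × ℝ => G p.1 p.2) ∧ ∀ u ≥ 0, ∀ v,
      G u v = h + (∫ a in (0 : ℝ)..u, κ a) +
        ∫ a in (0 : ℝ)..u, ∫ s in a..(a + v), κ s * G a (s - a) := by
  set I := ∫ s, |κ s| with hI
  have hI0 : 0 ≤ I := integral_nonneg fun s => abs_nonneg _
  -- The unknown of the contraction is `exp(-Ku) G(u, v)`. With this weight the integral operator
  -- has norm at most `I / K ≤ 1/2`, for any size of the potential.
  set K := 2 * I + 1 with hK
  have hK0 : 0 < K := by positivity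
  have hJc : ∀ g : BoundedContinuousFunction (ℝ × ℝ) ℝ, Continuous fun p : ℝ × ℝ =>
      ∫ s in p.1..(p.1 + p.2), κ s * (Real.exp (K * p.1) * g (p.1, s - p.1)) := fun g =>
    continuous_integral_mul hκ.locallyIntegrable (by fun_prop) (by fun_prop) (by fun_prop)
  have hJb : ∀ (g : ℝ × ℝ → ℝ) (C : ℝ), 0 ≤ C → (∀ p, |g p| ≤ C) → ∀ a v,
      |∫ s in a..(a + v), κ s * (Real.exp (K * a) * g (a, s - a))| ≤
        I * (Real.exp (K * a) * C) := by
    intro g C hC hg a v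
    refine abs_integral_mul_le hκ (by positivity) fun s => ?_
    rw [abs_mul, Real.abs_exp]
    gcongr
    exact hg _
  have hexp : ∀ u : ℝ, ∫ a in (0 : ℝ)..u, Real.exp (K * a) = (Real.exp (K * u) - 1) / K := by
    intro u
    rw [intervalIntegral.integral_comp_mul_left (fun a => Real.exp a) hK0.ne', integral_exp]
    simp
    ring
  have hIb : ∀ (g : ℝ × ℝ → ℝ) (C : ℝ), 0 ≤ C → (∀ p, |g p| ≤ C) → ∀ u ≥ 0, ∀ v,
      |Real.exp (-(K * u)) * ∫ a in (0 : ℝ)..u,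
        ∫ s in a..(a + v), κ s * (Real.exp (K * a) * g (a, s - a))| ≤ I / K * C := by
    intro g C hC hg u hu v
    have h1 : |∫ a in (0 : ℝ)..u, ∫ s in a..(a + v), κ s * (Real.exp (K * a) * g (a, s - a))| ≤
        ∫ a in (0 : ℝ)..u, I * C * Real.exp (K * a) := by
      rw [← Real.norm_eq_abs]
      refine intervalIntegral.norm_integral_le_of_norm_le hu (ae_of_all _ fun a _ => ?_)
        (by apply Continuous.intervalIntegrable; fun_prop)
      refine (hJb g C hC hg a v).trans (le_of_eq (by ring))
    rw [intervalIntegral.integral_const_mul, hexp] at h1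
    rw [abs_mul, Real.abs_exp]
    calc _ ≤ Real.exp (-(K * u)) * (I * C * ((Real.exp (K * u) - 1) / K)) := by gcongr
      _ = I / K * C * (1 - Real.exp (-(K * u))) := by
        have : Real.exp (-(K * u)) * Real.exp (K * u) = 1 := by rw [← Real.exp_add]; simp
        field_simp
        linear_combination I * C * this
      _ ≤ I / K * C * 1 := by
        gcongr
        linarith [Real.exp_pos (-(K * u))]
      _ = _ := mul_one _
  have hcont : ∀ g : BoundedContinuousFunction (ℝ × ℝ) ℝ, Continuous fun p : ℝ × ℝ =>
      Real.exp (-(K * max p.1 0)) * (h + ∫ a in (0 : ℝ)..(max p.1 0), κ a) +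
      Real.exp (-(K * max p.1 0)) * ∫ a in (0 : ℝ)..(max p.1 0), ∫ s in a..(a + p.2),
        κ s * (Real.exp (K * a) * g (a, s - a)) := by
    intro g
    have h1 : Continuous fun p : ℝ × ℝ => ∫ a in (0 : ℝ)..(max p.1 0), κ a := by
      have := continuous_integral_mul (X := ℝ × ℝ) (H := fun _ _ => 1) hκ.locallyIntegrable
        (by fun_prop) (continuous_const (y := (0 : ℝ)))
        (show Continuous fun p : ℝ × ℝ => max p.1 0 by fun_prop)
      simpa using this
    have h2 : Continuous fun p : ℝ × ℝ => ∫ a in (0 : ℝ)..(max p.1 0), ∫ s in a..(a + p.2),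
        κ s * (Real.exp (K * a) * g (a, s - a)) := by
      refine intervalIntegral.continuous_parametric_intervalIntegral_of_continuous ?_ (by fun_prop)
      exact (hJc g).comp (f := fun p : (ℝ × ℝ) × ℝ => (p.2, p.1.2)) (by fun_prop)
    fun_prop
  -- Replacing `u` by `max u 0` lets the operator act on bounded functions on the whole plane; for
  -- `u ≥ 0` nothing changes.
  set T : BoundedContinuousFunction (ℝ × ℝ) ℝ → BoundedContinuousFunction (ℝ × ℝ) ℝ := fun g =>
    BoundedContinuousFunction.ofNormedAddCommGroup _ (hcont g) (|h| + I + I / K * ‖g‖) (by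
      intro p
      have hu : (0 : ℝ) ≤ max p.1 0 := le_max_right _ _
      have h1 := hIb g ‖g‖ (norm_nonneg _) (fun p => g.norm_coe_le_norm p) _ hu p.2
      have h2 : |∫ a in (0 : ℝ)..(max p.1 0), κ a| ≤ I := by
        have := abs_integral_mul_le (a := 0) (b := max p.1 0) (H := fun _ => 1) hκ zero_le_one
          (fun _ => by simp)
        simpa using this
      have h3 : Real.exp (-(K * max p.1 0)) ≤ 1 :=
        Real.exp_le_one_iff.2 (by simp only [Left.neg_nonpos_iff]; positivity)
      refine (norm_add_le _ _).trans (add_le_add ?_ h1)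
      rw [norm_mul, Real.norm_eq_abs, Real.abs_exp]
      calc _ ≤ 1 * (|h| + I) := by
            gcongr
            exact (norm_add_le _ _).trans (add_le_add le_rfl h2)
        _ = _ := one_mul _) with hTdef
  have hT : ContractingWith (1 / 2) T := by
    refine ⟨by norm_num, LipschitzWith.of_dist_le_mul fun g₁ g₂ => ?_⟩
    refine (BoundedContinuousFunction.dist_le (by positivity)).2 fun p => ?_
    have hu : (0 : ℝ) ≤ max p.1 0 := le_max_right _ _
    have h1 := hIb (g₁ - g₂) (dist g₁ g₂) dist_nonneg (fun p => by
      have := BoundedContinuousFunction.dist_coe_le_dist (f := g₁) (g := g₂) p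
      rwa [Real.dist_eq] at this) _ hu p.2
    have hsub : ∀ a, ∫ s in a..(a + p.2), κ s * (Real.exp (K * a) * (⇑g₁ - ⇑g₂) (a, s - a)) =
        (∫ s in a..(a + p.2), κ s * (Real.exp (K * a) * g₁ (a, s - a))) -
        ∫ s in a..(a + p.2), κ s * (Real.exp (K * a) * g₂ (a, s - a)) := by
      intro a
      rw [← intervalIntegral.integral_sub
        (hκ.intervalIntegrable.mul_continuousOn (by fun_prop))
        (hκ.intervalIntegrable.mul_continuousOn (by fun_prop))]
      refine intervalIntegral.integral_congr fun s _ => ?_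
      simp only [Pi.sub_apply]
      ring
    simp_rw [hsub] at h1
    have hii : ∀ g : BoundedContinuousFunction (ℝ × ℝ) ℝ, IntervalIntegrable
        (fun a => ∫ s in a..(a + p.2), κ s * (Real.exp (K * a) * g (a, s - a))) volume 0
        (max p.1 0) := fun g =>
      ((hJc g).comp (f := fun a : ℝ => (a, p.2)) (by fun_prop)).intervalIntegrable _ _
    rw [intervalIntegral.integral_sub (hii g₁) (hii g₂), mul_sub] at h1
    have h2 : dist (T g₁ p) (T g₂ p) ≤ I / K * dist g₁ g₂ := by
      rw [Real.dist_eq]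
      refine le_trans (le_of_eq ?_) h1
      simp only [hTdef, BoundedContinuousFunction.coe_ofNormedAddCommGroup]
      congr 1
      ring
    refine h2.trans ?_
    have : I / K ≤ 1 / 2 := by
      rw [div_le_iff₀ hK0]; linarith
    simp only [NNReal.coe_div, NNReal.coe_one, NNReal.coe_ofNat]
    gcongr
  set g := ContractingWith.fixedPoint T hT
  have hfix : T g = g := hT.fixedPoint_isFixedPt
  refine ⟨fun u v => Real.exp (K * u) * g (u, v), by fun_prop, fun u hu v => ?_⟩
  have h1 := congrArg (fun f => f (u, v)) hfix
  simp only [hTdef, BoundedContinuousFunction.coe_ofNormedAddCommGroup, max_eq_left hu] at h1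
  beta_reduce
  rw [← h1]
  have : Real.exp (K * u) * Real.exp (-(K * u)) = 1 := by rw [← Real.exp_add]; simp
  rw [mul_add, ← mul_assoc, this, ← mul_assoc, this]
  ring

/-- `sin(ρy) / ρ`, also for `ρ = 0`. -/
def sinDiv (ρ : ℂ) (y : ℝ) : ℂ := ∫ τ in (0 : ℝ)..y, Complex.cos (ρ * τ)

theorem hasDerivAt_sinDiv (ρ : ℂ) (y : ℝ) : HasDerivAt (sinDiv ρ) (Complex.cos (ρ * y)) y :=
  (show Continuous fun τ : ℝ => Complex.cos (ρ * τ) by fun_prop).integral_hasStrictDerivAt 0 y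
    |>.hasDerivAt

@[fun_prop]
theorem continuous_sinDiv (ρ : ℂ) : Continuous (sinDiv ρ) :=
  continuous_iff_continuousAt.2 fun y => (hasDerivAt_sinDiv ρ y).continuousAt

@[simp]
theorem sinDiv_zero (ρ : ℂ) : sinDiv ρ 0 = 0 := by simp [sinDiv]

theorem hasDerivAt_mul_ofReal (ρ : ℂ) (y : ℝ) : HasDerivAt (fun y : ℝ => ρ * (y : ℂ)) ρ y := by
  simpa using (Complex.ofRealCLM.hasDerivAt (x := y)).const_mul ρ

theorem hasDerivAt_cos_mul (ρ : ℂ) (y : ℝ) :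
    HasDerivAt (fun y : ℝ => Complex.cos (ρ * y)) (-ρ * Complex.sin (ρ * y)) y := by
  have := (Complex.hasDerivAt_cos (ρ * y)).comp y (hasDerivAt_mul_ofReal ρ y)
  exact this.congr_deriv (by ring)

theorem hasDerivAt_sin_mul (ρ : ℂ) (y : ℝ) :
    HasDerivAt (fun y : ℝ => Complex.sin (ρ * y)) (ρ * Complex.cos (ρ * y)) y := by
  have := (Complex.hasDerivAt_sin (ρ * y)).comp y (hasDerivAt_mul_ofReal ρ y)
  exact this.congr_deriv (by ring)

theorem integral_cos_mul (ρ : ℂ) (y : ℝ) :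
    ∫ τ in (0 : ℝ)..y, Complex.cos (ρ * τ) = sinDiv ρ y := rfl

theorem integral_mul_sin_mul (ρ : ℂ) (y : ℝ) :
    ∫ τ in (0 : ℝ)..y, -ρ * Complex.sin (ρ * τ) = Complex.cos (ρ * y) - 1 := by
  rw [intervalIntegral.integral_eq_sub_of_hasDerivAt (fun τ _ => hasDerivAt_cos_mul ρ τ)
    (by apply Continuous.intervalIntegrable; fun_prop)]
  simp

theorem mul_sinDiv (ρ : ℂ) (y : ℝ) : ρ * sinDiv ρ y = Complex.sin (ρ * y) := by
  rw [sinDiv, ← intervalIntegral.integral_const_mul,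
    intervalIntegral.integral_eq_sub_of_hasDerivAt (fun τ _ => hasDerivAt_sin_mul ρ τ)
    (by apply Continuous.intervalIntegrable; fun_prop)]
  simp

theorem sq_mul_integral_sinDiv (ρ : ℂ) (y : ℝ) :
    ρ ^ 2 * ∫ τ in (0 : ℝ)..y, sinDiv ρ τ = 1 - Complex.cos (ρ * y) := by
  have h := integral_mul_sin_mul ρ y
  have : ∀ τ : ℝ, -ρ * Complex.sin (ρ * τ) = -(ρ ^ 2 * sinDiv ρ τ) := fun τ => by
    rw [← mul_sinDiv]; ring
  simp_rw [this] at h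
  rw [intervalIntegral.integral_neg, intervalIntegral.integral_const_mul] at h
  linear_combination -h

/-- The addition theorem identifies the derivative in `y` of both sides. This formula creates the
factor `sin(ρ(x - s)) / ρ` of the Volterra equation. -/
theorem integral_cos_shift (ρ : ℂ) (a y x : ℝ) :
    ∫ p in a..(a + y), Complex.cos (ρ * (2 * p - x)) =
      sinDiv ρ y * Complex.cos (ρ * (2 * a + y - x)) := by
  have h1 := intervalIntegral.integral_comp_add_left (a := 0) (b := y)
    (fun p : ℝ => Complex.cos (ρ * (2 * p - x))) a
  rw [add_zero] at h1
  rw [← h1]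
  have hd : ∀ τ : ℝ, HasDerivAt
      (fun τ : ℝ => sinDiv ρ τ * Complex.cos (ρ * (2 * a + τ - x)))
      (Complex.cos (ρ * (2 * ((a + τ : ℝ) : ℂ) - x))) τ := by
    intro τ
    have h2 : HasDerivAt (fun τ : ℝ => Complex.cos (ρ * (2 * a + τ - x)))
        (-ρ * Complex.sin (ρ * (2 * a + τ - x))) τ := by
      have h3 : HasDerivAt (fun τ : ℝ => ρ * (2 * a + (τ : ℂ) - x)) ρ τ := by
        simpa using (((Complex.ofRealCLM.hasDerivAt (x := τ)).const_add (2 * (a : ℂ))).sub_const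
          (x : ℂ)).const_mul ρ
      exact ((Complex.hasDerivAt_cos _).comp τ h3).congr_deriv (by ring)
    refine ((hasDerivAt_sinDiv ρ τ).mul h2).congr_deriv ?_
    have h4 := Complex.cos_add (ρ * τ) (ρ * (2 * a + τ - x))
    rw [← mul_sinDiv] at h4
    push_cast
    rw [show ρ * (2 * ((a : ℂ) + τ) - x) = ρ * τ + ρ * (2 * a + τ - x) by ring, h4]
    ring
  rw [intervalIntegral.integral_eq_sub_of_hasDerivAt (fun τ _ => hd τ)
    (by apply Continuous.intervalIntegrable; fun_prop)]
  simp

/-- `G` solves the Goursat problem for `κ` in characteristic coordinates. -/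
def IsGoursatKernel (κ : ℝ → ℝ) (h : ℝ) (G : ℝ → ℝ → ℝ) : Prop :=
  Continuous (fun p : ℝ × ℝ => G p.1 p.2) ∧ ∀ u ≥ 0, ∀ v,
    G u v = h + (∫ a in (0 : ℝ)..u, κ a) +
      ∫ a in (0 : ℝ)..u, ∫ s in a..(a + v), κ s * G a (s - a)

/-- The function with transmutation kernel `G`. -/
def psi (G : ℝ → ℝ → ℝ) (ρ : ℂ) (x : ℝ) : ℂ :=
  Complex.cos (ρ * x) + ∫ p in (0 : ℝ)..x, (G p (x - p) : ℂ) * Complex.cos (ρ * (2 * p - x))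

/-- The derivative of `psi`. -/
def dpsi (κ : ℝ → ℝ) (h : ℝ) (G : ℝ → ℝ → ℝ) (ρ : ℂ) (x : ℝ) : ℂ :=
  -ρ * Complex.sin (ρ * x) + h * Complex.cos (ρ * x) +
    ∫ s in (0 : ℝ)..x, (κ s : ℂ) * (Complex.cos (ρ * (x - s)) * psi G ρ s)

theorem integrableOn_square_mul_fst {κ : ℝ → ℂ} (hκ : LocallyIntegrable κ) {H : ℝ → ℝ → ℂ}
    (hH : Continuous fun p : ℝ × ℝ => H p.1 p.2) (a b : ℝ) :
    IntegrableOn (fun p : ℝ × ℝ => κ p.1 * H p.1 p.2) (Ioc a b ×ˢ Ioc a b) := by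
  have h := integrableOn_square_mul hκ (H := fun u s => H s u)
    (hH.comp (f := fun p : ℝ × ℝ => (p.2, p.1)) (by fun_prop)) a b
  rw [IntegrableOn, Measure.volume_eq_prod, ← Measure.prod_restrict] at h ⊢
  exact h.swap

theorem integral_triangle_swap_mul_fst {κ : ℝ → ℂ} (hκ : LocallyIntegrable κ) {H : ℝ → ℝ → ℂ}
    (hH : Continuous fun p : ℝ × ℝ => H p.1 p.2) {a b : ℝ} (hab : a ≤ b) :
    ∫ s in a..b, ∫ u in s..b, κ u * H u s = ∫ u in a..b, κ u * ∫ s in a..u, H u s := by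
  rw [← integral_triangle_swap hab (integrableOn_square_mul_fst hκ hH a b)]
  simp_rw [intervalIntegral.integral_const_mul]

theorem LocallyIntegrable.mul_continuous_complex {κ : ℝ → ℂ} (hκ : LocallyIntegrable κ) {f : ℝ → ℂ}
    (hf : Continuous f) : LocallyIntegrable fun s => κ s * f s := by
  rw [locallyIntegrable_iff]
  intro k hk
  exact (hκ.integrableOn_isCompact hk).mul_continuousOn hf.continuousOn hk

section
variable {κ : ℝ → ℝ} {h : ℝ} {G : ℝ → ℝ → ℝ}

theorem IsGoursatKernel.continuous_comp {X : Type*} [TopologicalSpace X] (hG : IsGoursatKernel κ h G)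
    {u v : X → ℝ} (hu : Continuous u) (hv : Continuous v) :
    Continuous fun x => (G (u x) (v x) : ℂ) :=
  Complex.continuous_ofReal.comp (hG.1.comp (hu.prodMk hv))

theorem IsGoursatKernel.continuous_psi (hG : IsGoursatKernel κ h G) (ρ : ℂ) :
    Continuous (psi G ρ) := by
  unfold psi
  refine Continuous.add (by fun_prop) ?_
  refine intervalIntegral.continuous_parametric_intervalIntegral_of_continuous ?_ continuous_id
  exact (hG.continuous_comp (u := fun p : ℝ × ℝ => p.2) (v := fun p => p.1 - p.2)
    (by fun_prop) (by fun_prop)).mul (by fun_prop)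

/-- The Volterra equation of `psi`. -/
theorem IsGoursatKernel.psi_eq (hG : IsGoursatKernel κ h G) (hκ : Integrable κ) (ρ : ℂ) {x : ℝ}
    (hx : 0 ≤ x) : psi G ρ x = Complex.cos (ρ * x) + h * sinDiv ρ x +
      ∫ s in (0 : ℝ)..x, (κ s : ℂ) * (sinDiv ρ (x - s) * psi G ρ s) := by
  have hκc : LocallyIntegrable fun s => (κ s : ℂ) := hκ.ofReal.locallyIntegrable
  set c : ℝ → ℂ := fun p => Complex.cos (ρ * (2 * p - x)) with hc
  have hcc : Continuous c := by fun_prop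
  set J : ℝ → ℝ → ℂ := fun a p => ∫ s in a..(a + x - p), (κ s : ℂ) * (G a (s - a) : ℂ) with hJ
  have hJc : Continuous fun p : ℝ × ℝ => J p.1 p.2 :=
    continuous_integral_mul hκc (X := ℝ × ℝ) (H := fun p s => (G p.1 (s - p.1) : ℂ))
      (hG.continuous_comp (u := fun p : (ℝ × ℝ) × ℝ => p.1.1) (v := fun p => p.2 - p.1.1)
        (by fun_prop) (by fun_prop)) (by fun_prop) (by fun_prop)
  have hQc : Continuous fun p : ℝ => ∫ s in (0 : ℝ)..p, (κ s : ℂ) := by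
    have := continuous_integral_mul (X := ℝ) hκc (H := fun _ _ => 1) (by fun_prop)
      (continuous_const (y := (0 : ℝ))) continuous_id
    simpa using this
  have hDc : Continuous fun p : ℝ => ∫ a in (0 : ℝ)..p, J a p :=
    intervalIntegral.continuous_parametric_intervalIntegral_of_continuous (f := fun p a => J a p)
      (hJc.comp (f := fun p : ℝ × ℝ => (p.2, p.1)) (by fun_prop)) continuous_id
  -- Inserting the equation of `G` gives three terms: the constant `h`, the primitive of `κ`, and
  -- the double integral. They produce respectively `h sin ρx / ρ`, the `cos ρs` part of `psi G ρ s`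
  -- under the integral, and the remaining part.
  have hsplit : ∫ p in (0 : ℝ)..x, (G p (x - p) : ℂ) * c p =
      h * (∫ p in (0 : ℝ)..x, c p) + (∫ p in (0 : ℝ)..x, (∫ s in (0 : ℝ)..p, (κ s : ℂ)) * c p) +
        ∫ p in (0 : ℝ)..x, (∫ a in (0 : ℝ)..p, J a p) * c p := by
    have i1 : Continuous fun p => (h : ℂ) * c p := by fun_prop
    have i2 : Continuous fun p => (∫ s in (0 : ℝ)..p, (κ s : ℂ)) * c p := hQc.mul hcc
    have i3 : Continuous fun p => (∫ a in (0 : ℝ)..p, J a p) * c p := hDc.mul hcc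
    have i12 : Continuous fun p => (h : ℂ) * c p + (∫ s in (0 : ℝ)..p, (κ s : ℂ)) * c p := i1.add i2
    rw [← intervalIntegral.integral_const_mul, ← intervalIntegral.integral_add
      (i1.intervalIntegrable _ _) (i2.intervalIntegrable _ _), ← intervalIntegral.integral_add
      (i12.intervalIntegrable _ _) (i3.intervalIntegrable _ _)]
    refine intervalIntegral.integral_congr fun p hp => ?_
    rw [uIcc_of_le hx] at hp
    have e := congrArg (fun r : ℝ => (r : ℂ)) (hG.2 p hp.1 (x - p))
    simp only [Complex.ofReal_add, ← intervalIntegral.integral_ofReal, Complex.ofReal_mul] at e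
    rw [e, hJ]
    simp_rw [add_sub_assoc]
    ring
  have h1 : ∫ p in (0 : ℝ)..x, c p = sinDiv ρ x := by
    have := integral_cos_shift ρ 0 x x
    rw [zero_add] at this
    rw [hc, this]
    simp
  have h2 : ∫ p in (0 : ℝ)..x, (∫ s in (0 : ℝ)..p, (κ s : ℂ)) * c p =
      ∫ s in (0 : ℝ)..x, (κ s : ℂ) * (sinDiv ρ (x - s) * Complex.cos (ρ * s)) := by
    simp_rw [← intervalIntegral.integral_mul_const]
    rw [integral_triangle_swap_mul hκc (H := fun p _ => c p) (by fun_prop) hx]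
    refine intervalIntegral.integral_congr fun s _ => ?_
    have := integral_cos_shift ρ s (x - s) x
    rw [add_sub_cancel] at this
    rw [hc, this]
    congr 4
    push_cast
    ring
  have h3 : ∫ p in (0 : ℝ)..x, (∫ a in (0 : ℝ)..p, J a p) * c p =
      ∫ s in (0 : ℝ)..x, (κ s : ℂ) * (sinDiv ρ (x - s) *
        ∫ a in (0 : ℝ)..s, (G a (s - a) : ℂ) * Complex.cos (ρ * (2 * a - s))) := by
    have hsw := integral_triangle_swap_mul (κ := fun _ => 1) (locallyIntegrable_const 1)
      (H := fun p a => J a p * c p)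
      ((hJc.comp (f := fun p : ℝ × ℝ => (p.2, p.1)) (by fun_prop)).mul (by fun_prop)) hx
    simp only [one_mul, intervalIntegral.integral_mul_const] at hsw
    rw [hsw]
    -- For fixed `a` the constraint is `p + s ≤ a + x`; integrating over `p` first makes
    -- `integral_cos_shift` applicable and centres the remaining cosine at `2a - s`, as in the
    -- definition of `psi`.
    have hin : ∀ a ∈ uIcc 0 x, ∫ p in a..x, J a p * c p =
        ∫ s in a..x, (κ s : ℂ) * ((G a (s - a) : ℂ) * Complex.cos (ρ * (2 * a - s)) *
          sinDiv ρ (x - s)) := by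
      intro a ha
      rw [uIcc_of_le hx] at ha
      have h4 := integral_antitriangle_swap (LocallyIntegrable.mul_continuous_complex hκc
        (hG.continuous_comp (u := fun _ : ℝ => a) (v := fun s => s - a) (by fun_prop)
        (by fun_prop))) hcc ha.2
      simp_rw [mul_comm (c _)] at h4
      rw [hJ, h4]
      refine intervalIntegral.integral_congr fun s _ => ?_
      have := integral_cos_shift ρ a (x - s) x
      rw [add_sub_assoc, hc, this]
      rw [show (2 * (a : ℂ) + ((x - s : ℝ) : ℂ) - x) = 2 * a - s by push_cast; ring]
      ring
    rw [intervalIntegral.integral_congr hin]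
    rw [integral_triangle_swap_mul_fst hκc (H := fun s a => (G a (s - a) : ℂ) *
      Complex.cos (ρ * (2 * a - s)) * sinDiv ρ (x - s)) ?_ hx]
    · refine intervalIntegral.integral_congr fun s _ => ?_
      rw [intervalIntegral.integral_mul_const, mul_comm (sinDiv ρ (x - s))]
    · exact ((hG.continuous_comp (u := fun p : ℝ × ℝ => p.2) (v := fun p => p.1 - p.2)
        (by fun_prop) (by fun_prop)).mul (by fun_prop)).mul (by fun_prop)
  have hψ := hG.continuous_psi ρ
  have h5 : ∫ s in (0 : ℝ)..x, (κ s : ℂ) * (sinDiv ρ (x - s) * psi G ρ s) =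
      (∫ s in (0 : ℝ)..x, (κ s : ℂ) * (sinDiv ρ (x - s) * Complex.cos (ρ * s))) +
      ∫ s in (0 : ℝ)..x, (κ s : ℂ) * (sinDiv ρ (x - s) *
        ∫ a in (0 : ℝ)..s, (G a (s - a) : ℂ) * Complex.cos (ρ * (2 * a - s))) := by
    have hpc : Continuous fun s : ℝ =>
        ∫ a in (0 : ℝ)..s, (G a (s - a) : ℂ) * Complex.cos (ρ * (2 * a - s)) := by
      have : (fun s : ℝ => ∫ a in (0 : ℝ)..s, (G a (s - a) : ℂ) * Complex.cos (ρ * (2 * a - s))) =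
          fun s => psi G ρ s - Complex.cos (ρ * s) := by
        ext s; simp [psi]
      rw [this]
      fun_prop
    rw [← intervalIntegral.integral_add
      ((LocallyIntegrable.intervalIntegrable hκc).mul_continuousOn (by fun_prop))
      ((LocallyIntegrable.intervalIntegrable hκc).mul_continuousOn (by fun_prop))]
    refine intervalIntegral.integral_congr fun s _ => ?_
    simp only [psi]
    ring
  rw [h5, ← h2, ← h3, ← h1]
  conv_lhs => rw [psi]
  rw [hsplit]
  ring

end

section
variable {κ : ℝ → ℝ} {h : ℝ} {G : ℝ → ℝ → ℝ}

theorem IsGoursatKernel.continuous_dpsi (hG : IsGoursatKernel κ h G) (hκ : Integrable κ) (ρ : ℂ) :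
    Continuous (dpsi κ h G ρ) := by
  have hψ := hG.continuous_psi ρ
  unfold dpsi
  refine Continuous.add (by fun_prop) ?_
  exact continuous_integral_mul (X := ℝ)
    (H := fun x s => Complex.cos (ρ * (x - s)) * psi G ρ s) hκ.ofReal.locallyIntegrable
    (by fun_prop) continuous_const continuous_id

/-- The Volterra equation is the integral of the formula for `dpsi`, by Fubini; working in
integrated form avoids differentiating under an integral with weight `κ`. -/
theorem IsGoursatKernel.integral_dpsi (hG : IsGoursatKernel κ h G) (hκ : Integrable κ) (ρ : ℂ)
    {x : ℝ} (hx : 0 ≤ x) : ∫ u in (0 : ℝ)..x, dpsi κ h G ρ u = psi G ρ x - 1 := by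
  have hψ := hG.continuous_psi ρ
  have hκc : LocallyIntegrable fun s => (κ s : ℂ) := hκ.ofReal.locallyIntegrable
  have hc : Continuous fun x : ℝ =>
      ∫ s in (0 : ℝ)..x, (κ s : ℂ) * (Complex.cos (ρ * (x - s)) * psi G ρ s) :=
    continuous_integral_mul (X := ℝ) (H := fun x s => Complex.cos (ρ * (x - s)) * psi G ρ s) hκc
      (by fun_prop) continuous_const continuous_id
  unfold dpsi
  rw [intervalIntegral.integral_add ((by fun_prop : Continuous fun x : ℝ =>
      -ρ * Complex.sin (ρ * x) + h * Complex.cos (ρ * x)).intervalIntegrable _ _)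
      (hc.intervalIntegrable _ _),
    intervalIntegral.integral_add ((by fun_prop : Continuous fun x : ℝ =>
      -ρ * Complex.sin (ρ * x)).intervalIntegrable _ _) ((by fun_prop : Continuous fun x : ℝ =>
      h * Complex.cos (ρ * x)).intervalIntegrable _ _),
    integral_mul_sin_mul, intervalIntegral.integral_const_mul, integral_cos_mul,
    integral_triangle_swap_mul hκc (H := fun x s => Complex.cos (ρ * (x - s)) * psi G ρ s)
      (by fun_prop) hx, hG.psi_eq hκ ρ hx]
  have h1 : ∀ s : ℝ, ∫ u in s..x, Complex.cos (ρ * (u - s)) * psi G ρ s =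
      sinDiv ρ (x - s) * psi G ρ s := by
    intro s
    rw [intervalIntegral.integral_mul_const]
    have := intervalIntegral.integral_comp_sub_right (a := s) (b := x)
      (fun u : ℝ => Complex.cos (ρ * u)) s
    rw [sub_self, integral_cos_mul] at this
    rw [← this]
    push_cast
    rfl
  simp_rw [h1]
  ring

theorem IsGoursatKernel.dpsi_eq (hG : IsGoursatKernel κ h G) (hκ : Integrable κ) (ρ : ℂ)
    {x : ℝ} (hx : 0 ≤ x) : dpsi κ h G ρ x = h + ∫ t in (0 : ℝ)..x, ((κ t : ℂ) - ρ ^ 2) * psi G ρ t := by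
  have hψ := hG.continuous_psi ρ
  have hκc : LocallyIntegrable fun s => (κ s : ℂ) := hκ.ofReal.locallyIntegrable
  have hi : ∀ {f : ℝ → ℂ}, Continuous f → ∀ a b, IntervalIntegrable (fun s => (κ s : ℂ) * f s)
    volume a b := fun hf a b => (LocallyIntegrable.intervalIntegrable hκc).mul_continuousOn hf.continuousOn
  have hVc : Continuous fun x : ℝ =>
      ∫ s in (0 : ℝ)..x, (κ s : ℂ) * (sinDiv ρ (x - s) * psi G ρ s) :=
    continuous_integral_mul (X := ℝ) (H := fun x s => sinDiv ρ (x - s) * psi G ρ s) hκc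
      (by fun_prop) continuous_const continuous_id
  have h1 : ∫ t in (0 : ℝ)..x, psi G ρ t = sinDiv ρ x + h * (∫ t in (0 : ℝ)..x, sinDiv ρ t) +
      ∫ s in (0 : ℝ)..x, (κ s : ℂ) * ((∫ t in (0 : ℝ)..(x - s), sinDiv ρ t) * psi G ρ s) := by
    have e : ∫ t in (0 : ℝ)..x, psi G ρ t = ∫ t in (0 : ℝ)..x, (Complex.cos (ρ * t) +
        h * sinDiv ρ t + ∫ s in (0 : ℝ)..t, (κ s : ℂ) * (sinDiv ρ (t - s) * psi G ρ s)) := by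
      refine intervalIntegral.integral_congr fun t ht => ?_
      rw [uIcc_of_le hx] at ht
      exact hG.psi_eq hκ ρ ht.1
    rw [e, intervalIntegral.integral_add ((by fun_prop : Continuous fun x : ℝ =>
        Complex.cos (ρ * x) + h * sinDiv ρ x).intervalIntegrable _ _)
        (hVc.intervalIntegrable _ _),
      intervalIntegral.integral_add ((by fun_prop : Continuous fun x : ℝ =>
        Complex.cos (ρ * x)).intervalIntegrable _ _) ((by fun_prop : Continuous fun x : ℝ =>
        h * sinDiv ρ x).intervalIntegrable _ _), intervalIntegral.integral_const_mul,
      integral_cos_mul, integral_triangle_swap_mul hκc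
        (H := fun t s => sinDiv ρ (t - s) * psi G ρ s) (by fun_prop) hx]
    congr 1
    refine intervalIntegral.integral_congr fun s _ => ?_
    have := intervalIntegral.integral_comp_sub_right (a := s) (b := x) (sinDiv ρ) s
    rw [sub_self] at this
    rw [intervalIntegral.integral_mul_const, this]
  have h2 : ∫ t in (0 : ℝ)..x, ((κ t : ℂ) - ρ ^ 2) * psi G ρ t =
      (∫ t in (0 : ℝ)..x, (κ t : ℂ) * psi G ρ t) - ρ ^ 2 * ∫ t in (0 : ℝ)..x, psi G ρ t := by
    rw [← intervalIntegral.integral_const_mul, ← intervalIntegral.integral_sub (hi hψ _ _)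
      ((by fun_prop : Continuous fun t => ρ ^ 2 * psi G ρ t).intervalIntegrable _ _)]
    refine intervalIntegral.integral_congr fun s _ => ?_
    ring
  have h3 : ∫ s in (0 : ℝ)..x, (κ s : ℂ) * (Complex.cos (ρ * (x - s)) * psi G ρ s) =
      (∫ t in (0 : ℝ)..x, (κ t : ℂ) * psi G ρ t) - ρ ^ 2 *
      ∫ s in (0 : ℝ)..x, (κ s : ℂ) * ((∫ t in (0 : ℝ)..(x - s), sinDiv ρ t) * psi G ρ s) := by
    have hcs : Continuous fun s : ℝ => ∫ t in (0 : ℝ)..(x - s), sinDiv ρ t :=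
      intervalIntegral.continuous_parametric_intervalIntegral_of_continuous
        (f := fun _ t => sinDiv ρ t) (by fun_prop) (by fun_prop)
    have hcψ : Continuous fun s : ℝ => (∫ t in (0 : ℝ)..(x - s), sinDiv ρ t) * psi G ρ s :=
      hcs.mul hψ
    rw [← intervalIntegral.integral_const_mul, ← intervalIntegral.integral_sub (hi hψ _ _)
      ((hi hcψ _ _).const_mul _)]
    refine intervalIntegral.integral_congr fun s _ => ?_
    have := sq_mul_integral_sinDiv ρ (x - s)
    push_cast at this
    linear_combination ((κ s : ℂ) * psi G ρ s) * this
  have h4 := sq_mul_integral_sinDiv ρ x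
  have h5 := mul_sinDiv ρ x
  rw [dpsi, h3, h2, h1]
  linear_combination ρ * h5 + h * h4

theorem IsGoursatKernel.psi_zero (ρ : ℂ) : psi G ρ 0 = 1 := by simp [psi]

theorem IsGoursatKernel.dpsi_zero (ρ : ℂ) : dpsi κ h G ρ 0 = h := by simp [dpsi]

theorem IsGoursatKernel.isSLSolution (hG : IsGoursatKernel κ h G) (hκ : Integrable κ) {q : ℝ → ℝ}
    (hq : ∀ x ∈ Icc 0 π, κ x = q x) (ρ : ℂ) :
    IsSLSolution q (ρ ^ 2) (psi G ρ) (dpsi κ h G ρ) := by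
  refine ⟨fun x hx => ?_, fun x hx => ?_⟩
  · have h1 : HasDerivAt (fun x => 1 + ∫ u in (0 : ℝ)..x, dpsi κ h G ρ u) (dpsi κ h G ρ x) x :=
      (((hG.continuous_dpsi hκ ρ).integral_hasStrictDerivAt 0 x).hasDerivAt).const_add 1
    refine h1.hasDerivWithinAt.congr (fun y hy => ?_) ?_
    · rw [hG.integral_dpsi hκ ρ hy.1]; ring
    · rw [hG.integral_dpsi hκ ρ hx.1]; ring
  · rw [dpsi_zero, hG.dpsi_eq hκ ρ hx.1]
    congr 1
    refine intervalIntegral.integral_congr fun t ht => ?_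
    rw [uIcc_of_le hx.1] at ht
    simp only [hq t ⟨ht.1, ht.2.trans hx.2⟩]

end

/-! ### Uniqueness for the initial value problem -/

section
variable {q : ℝ → ℝ} {z : ℂ} {y dy : ℝ → ℂ}

theorem IsSLSolution.continuousOn (hy : IsSLSolution q z y dy) : ContinuousOn y (Icc 0 π) :=
  fun x hx => (hy.deriv x hx).continuousWithinAt

theorem intervalIntegrable_sub_mul (hq : IntervalIntegrable q volume 0 π) (z : ℂ) {y : ℝ → ℂ}
    (hy : ContinuousOn y (Icc 0 π)) :
    IntervalIntegrable (fun t => ((q t : ℂ) - z) * y t) volume 0 π := by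
  refine ((intervalIntegrable_ofReal hq).sub intervalIntegrable_const).mul_continuousOn ?_
  rwa [uIcc_of_le Real.pi_pos.le]

theorem IsSLSolution.continuousOn_deriv (hy : IsSLSolution q z y dy)
    (hq : IntervalIntegrable q volume 0 π) : ContinuousOn dy (Icc 0 π) := by
  have h1 := intervalIntegral.continuousOn_primitive_interval'
    (intervalIntegrable_sub_mul hq z hy.continuousOn) left_mem_uIcc
  rw [uIcc_of_le Real.pi_pos.le] at h1
  exact (continuousOn_const.add h1).congr fun x hx => hy.eqn x hx

theorem IsSLSolution.integral_deriv (hy : IsSLSolution q z y dy)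
    (hq : IntervalIntegrable q volume 0 π) {x : ℝ} (hx : x ∈ Icc 0 π) :
    ∫ t in (0 : ℝ)..x, dy t = y x - y 0 := by
  refine intervalIntegral.integral_eq_sub_of_hasDerivAt_of_le hx.1
    (hy.continuousOn.mono (Icc_subset_Icc_right hx.2)) (fun t ht => ?_) ?_
  · exact (hy.deriv t ⟨ht.1.le, ht.2.le.trans hx.2⟩).hasDerivAt
      (Icc_mem_nhds ht.1 (ht.2.trans_le hx.2))
  · refine ContinuousOn.intervalIntegrable ?_
    rw [uIcc_of_le hx.1]
    exact (hy.continuousOn_deriv hq).mono (Icc_subset_Icc_right hx.2)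

theorem IsSLSolution.const_mul_sub {y₂ dy₂ : ℝ → ℂ} (hy : IsSLSolution q z y dy)
    (hy₂ : IsSLSolution q z y₂ dy₂) (hq : IntervalIntegrable q volume 0 π) (c : ℂ) :
    IsSLSolution q z (fun x => y x - c * y₂ x) (fun x => dy x - c * dy₂ x) := by
  refine ⟨fun x hx => (hy.deriv x hx).sub ((hy₂.deriv x hx).const_mul c), fun x hx => ?_⟩
  have hsub : uIcc 0 x ⊆ uIcc 0 π := by
    rw [uIcc_of_le hx.1, uIcc_of_le Real.pi_pos.le]; exact Icc_subset_Icc_right hx.2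
  have i1 := (intervalIntegrable_sub_mul hq z hy.continuousOn).mono_set hsub
  have i2 := (intervalIntegrable_sub_mul hq z hy₂.continuousOn).mono_set hsub
  have : ∀ t, ((q t : ℂ) - z) * (y t - c * y₂ t) =
      ((q t : ℂ) - z) * y t - c * (((q t : ℂ) - z) * y₂ t) := fun t => by ring
  simp_rw [this]
  rw [intervalIntegral.integral_sub i1 (i2.const_mul c), intervalIntegral.integral_const_mul,
    hy.eqn x hx, hy₂.eqn x hx]
  ring

/-- With `M` the maximum of `exp(-Kx) ‖y x‖`, integrating the equation twice gives `M ≤ (L / K) M`;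
the choice `K = L + 1` forces `M = 0`. -/
theorem IsSLSolution.eq_zero (hy : IsSLSolution q z y dy) (hq : IntervalIntegrable q volume 0 π)
    (h0 : y 0 = 0) (h0' : dy 0 = 0) : ∀ x ∈ Icc 0 π, y x = 0 ∧ dy x = 0 := by
  have hpi := Real.pi_pos
  have hsub : ∀ {x}, x ∈ Icc 0 π → uIcc 0 x ⊆ uIcc 0 π := fun {x} hx => by
    rw [uIcc_of_le hx.1, uIcc_of_le hpi.le]; exact Icc_subset_Icc_right hx.2
  have hqz : IntervalIntegrable (fun t => ‖(q t : ℂ) - z‖) volume 0 π :=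
    ((intervalIntegrable_ofReal hq).sub intervalIntegrable_const).norm
  set L := ∫ t in (0 : ℝ)..π, ‖(q t : ℂ) - z‖ with hL
  have hL0 : 0 ≤ L := intervalIntegral.integral_nonneg hpi.le fun t _ => norm_nonneg _
  set K := L + 1 with hK
  have hK0 : 0 < K := by positivity
  obtain ⟨x₀, hx₀, hmax⟩ := isCompact_Icc.exists_isMaxOn (nonempty_Icc.2 hpi.le)
    (f := fun x => Real.exp (-(K * x)) * ‖y x‖)
    ((by fun_prop : Continuous fun x : ℝ => Real.exp (-(K * x))).continuousOn.mul
      hy.continuousOn.norm)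
  set M := Real.exp (-(K * x₀)) * ‖y x₀‖ with hM
  have hM0 : 0 ≤ M := by positivity
  have hexp : ∀ x : ℝ, Real.exp (K * x) * Real.exp (-(K * x)) = 1 := fun x => by
    rw [← Real.exp_add]; simp
  have hyM : ∀ x ∈ Icc 0 π, ‖y x‖ ≤ M * Real.exp (K * x) := by
    intro x hx
    have h1 : Real.exp (-(K * x)) * ‖y x‖ ≤ M := hmax hx
    calc ‖y x‖ = (Real.exp (K * x) * Real.exp (-(K * x))) * ‖y x‖ := by rw [hexp, one_mul]
      _ = Real.exp (K * x) * (Real.exp (-(K * x)) * ‖y x‖) := by ring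
      _ ≤ Real.exp (K * x) * M := by gcongr
      _ = _ := mul_comm _ _
  have hdy : ∀ x ∈ Icc 0 π, ‖dy x‖ ≤ L * M * Real.exp (K * x) := by
    intro x hx
    rw [hy.eqn x hx, h0', zero_add]
    have h1 : ‖∫ t in (0 : ℝ)..x, ((q t : ℂ) - z) * y t‖ ≤
        ∫ t in (0 : ℝ)..x, ‖(q t : ℂ) - z‖ * (M * Real.exp (K * x)) := by
      refine intervalIntegral.norm_integral_le_of_norm_le hx.1 (ae_of_all _ fun t ht => ?_)
        ((hqz.mono_set (hsub hx)).mul_const _)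
      rw [norm_mul]
      gcongr
      refine (hyM t ⟨ht.1.le, ht.2.trans hx.2⟩).trans ?_
      gcongr
      exact ht.2
    rw [intervalIntegral.integral_mul_const] at h1
    have h2 : ∫ t in (0 : ℝ)..x, ‖(q t : ℂ) - z‖ ≤ L :=
      intervalIntegral.integral_mono_interval le_rfl hx.1 hx.2
        (ae_of_all _ fun t => norm_nonneg _) hqz
    calc _ ≤ _ := h1
      _ ≤ L * (M * Real.exp (K * x)) := by gcongr
      _ = _ := by ring
  have hy2 : ‖y x₀‖ ≤ L * M * (Real.exp (K * x₀) / K) := by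
    have h1 := hy.integral_deriv hq hx₀
    rw [h0, sub_zero] at h1
    rw [← h1]
    have h2 : ‖∫ t in (0 : ℝ)..x₀, dy t‖ ≤ ∫ t in (0 : ℝ)..x₀, L * M * Real.exp (K * t) :=
      intervalIntegral.norm_integral_le_of_norm_le hx₀.1 (ae_of_all _ fun t ht =>
        hdy t ⟨ht.1.le, ht.2.trans hx₀.2⟩) (by apply Continuous.intervalIntegrable; fun_prop)
    refine h2.trans ?_
    rw [intervalIntegral.integral_const_mul,
      intervalIntegral.integral_comp_mul_left (fun a => Real.exp a) hK0.ne', integral_exp]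
    gcongr
    simp only [mul_zero, Real.exp_zero, smul_eq_mul]
    rw [inv_mul_eq_div]
    gcongr
    linarith
  have hM2 : M ≤ L * M / K := by
    calc M ≤ Real.exp (-(K * x₀)) * (L * M * (Real.exp (K * x₀) / K)) := by rw [hM]; gcongr
      _ = (Real.exp (K * x₀) * Real.exp (-(K * x₀))) * (L * M / K) := by ring
      _ = _ := by rw [hexp, one_mul]
  have hM3 : M = 0 := by
    rw [le_div_iff₀ hK0] at hM2
    nlinarith
  intro x hx
  have h1 := hyM x hx
  have h2 := hdy x hx
  rw [hM3] at h1 h2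
  simp only [zero_mul, mul_zero] at h1 h2
  exact ⟨norm_le_zero_iff.1 h1, norm_le_zero_iff.1 h2⟩

theorem IsSLSolution.unique {y₂ dy₂ : ℝ → ℂ} (hy : IsSLSolution q z y dy)
    (hy₂ : IsSLSolution q z y₂ dy₂) (hq : IntervalIntegrable q volume 0 π) {c : ℂ}
    (h0 : y 0 = c * y₂ 0) (h0' : dy 0 = c * dy₂ 0) :
    ∀ x ∈ Icc 0 π, y x = c * y₂ x ∧ dy x = c * dy₂ x := by
  intro x hx
  have h := (hy.const_mul_sub hy₂ hq c).eq_zero hq (by simp [h0]) (by simp [h0']) x hx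
  exact ⟨sub_eq_zero.1 h.1, sub_eq_zero.1 h.2⟩

end

/-! ### The transmutation kernel and its uniqueness -/

/-- Both sides are the integral over `[-x, x]`; on the right `t = 2p - x`, where `p` is the
characteristic coordinate `u`. -/
theorem integral_fold {f : ℝ → ℂ} {x : ℝ} (hf : IntervalIntegrable f volume (-x) x) :
    ∫ t in (0 : ℝ)..x, (f t + f (-t)) = 2 * ∫ p in (0 : ℝ)..x, f (2 * p - x) := by
  have h0 : (0 : ℝ) ∈ uIcc (-x) x := by
    rcases le_total 0 x with h | h
    · rw [uIcc_of_le (by linarith)]; constructor <;> linarith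
    · rw [uIcc_of_ge (by linarith)]; constructor <;> linarith
  have i1 : IntervalIntegrable f volume (-x) 0 :=
    hf.mono_set (uIcc_subset_uIcc left_mem_uIcc h0)
  have i2 : IntervalIntegrable f volume 0 x :=
    hf.mono_set (uIcc_subset_uIcc h0 right_mem_uIcc)
  have i3 : IntervalIntegrable (fun t => f (-t)) volume 0 x := by
    have := (IntervalIntegrable.iff_comp_neg (f := f) (a := -x) (b := 0)).1 i1
    simpa using this.symm
  have h1 := intervalIntegral.smul_integral_comp_mul_sub (a := 0) (b := x) f 2 x
  have h2 := intervalIntegral.integral_comp_neg (a := 0) (b := x) f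
  have h3 := intervalIntegral.integral_add_adjacent_intervals i1 i2
  rw [intervalIntegral.integral_add i2 i3, h2, neg_zero, add_comm, h3]
  rw [show 2 * (0 : ℝ) - x = -x by ring, show 2 * x - x = x by ring] at h1
  rw [← h1, Complex.real_smul]
  push_cast
  rfl

/-- The transmutation kernel with even extension, from a solution of the Goursat problem. -/
def symKernel (G : ℝ → ℝ → ℝ) (x t : ℝ) : ℝ :=
  (G ((x + t) / 2) ((x - t) / 2) + G ((x + -t) / 2) ((x - -t) / 2)) / 2

section
variable {κ : ℝ → ℝ} {h : ℝ} {G : ℝ → ℝ → ℝ}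

theorem IsGoursatKernel.continuous_symKernel (hG : IsGoursatKernel κ h G) :
    Continuous fun p : ℝ × ℝ => symKernel G p.1 p.2 := by
  have h1 := hG.1.comp (f := fun p : ℝ × ℝ => ((p.1 + p.2) / 2, (p.1 - p.2) / 2)) (by fun_prop)
  have h2 := hG.1.comp (f := fun p : ℝ × ℝ => ((p.1 + -p.2) / 2, (p.1 - -p.2) / 2)) (by fun_prop)
  exact (h1.add h2).div_const 2

theorem IsGoursatKernel.psi_eq_symKernel (hG : IsGoursatKernel κ h G) (ρ : ℂ) (x : ℝ) :
    psi G ρ x = Complex.cos (ρ * x) +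
      ∫ t in (0 : ℝ)..x, (symKernel G x t : ℂ) * Complex.cos (ρ * t) := by
  have hf : Continuous fun t : ℝ => (G ((x + t) / 2) ((x - t) / 2) : ℂ) * Complex.cos (ρ * t) :=
    (hG.continuous_comp (u := fun t : ℝ => (x + t) / 2) (v := fun t => (x - t) / 2)
      (by fun_prop) (by fun_prop)).mul (by fun_prop)
  have h1 := integral_fold (hf.intervalIntegrable (μ := volume) (-x) x)
  rw [psi]
  congr 1
  have h2 : ∀ p : ℝ, (G ((x + (2 * p - x)) / 2) ((x - (2 * p - x)) / 2) : ℂ) *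
      Complex.cos (ρ * ((2 * p - x : ℝ) : ℂ)) =
      (G p (x - p) : ℂ) * Complex.cos (ρ * (2 * p - x)) := fun p => by
    rw [show (x + (2 * p - x)) / 2 = p by ring, show (x - (2 * p - x)) / 2 = x - p by ring]
    push_cast
    rfl
  simp_rw [h2] at h1
  have h3 : ∫ t in (0 : ℝ)..x, (symKernel G x t : ℂ) * Complex.cos (ρ * t) =
      (1 / 2) * ∫ t in (0 : ℝ)..x, ((G ((x + t) / 2) ((x - t) / 2) : ℂ) * Complex.cos (ρ * t) +
        (G ((x + -t) / 2) ((x - -t) / 2) : ℂ) * Complex.cos (ρ * ((-t : ℝ) : ℂ))) := by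
    rw [← intervalIntegral.integral_const_mul]
    refine intervalIntegral.integral_congr fun t _ => ?_
    simp only [symKernel]
    push_cast
    rw [mul_neg, Complex.cos_neg]
    ring
  rw [h3, h1]
  ring

theorem IsGoursatKernel.isTransmutationKernel (hG : IsGoursatKernel κ h G) {φ : ℂ → ℝ → ℂ}
    (hφ : ∀ ρ, ∀ x ∈ Icc 0 π, φ ρ x = psi G ρ x) : IsTransmutationKernel φ (symKernel G) :=
  ⟨hG.continuous_symKernel.continuousOn, fun ρ x hx => by
    rw [hφ ρ x hx, hG.psi_eq_symKernel]⟩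

/-- For fixed `x` the difference, extended by zero to `(0, π)`, is orthogonal to every `cos nt`, so
it vanishes almost everywhere, and by continuity on all of `(0, x)`. Statements about the
constructed kernel thereby pass to an arbitrary one. -/
theorem IsTransmutationKernel.eq_on_triangle {φ : ℂ → ℝ → ℂ} {G₁ G₂ : ℝ → ℝ → ℝ}
    (h₁ : IsTransmutationKernel φ G₁) (h₂ : IsTransmutationKernel φ G₂) {x t : ℝ}
    (hx : x ≤ π) (ht : t ∈ Ioo 0 x) : G₁ x t = G₂ x t := by
  have hx0 : 0 ≤ x := ht.1.le.trans ht.2.le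
  have hc : ∀ {G : ℝ → ℝ → ℝ}, IsTransmutationKernel φ G →
      ContinuousOn (fun t => (G x t : ℂ)) (Icc 0 x) := fun hG =>
    Complex.continuous_ofReal.comp_continuousOn
      (hG.1.comp (f := fun t : ℝ => (x, t)) (by fun_prop) fun t ht => ⟨ht.1, ht.2, hx⟩)
  have hi : ∀ {G : ℝ → ℝ → ℝ}, IsTransmutationKernel φ G →
      IntervalIntegrable (fun t => (G x t : ℂ)) volume 0 x := fun hG => by
    refine ContinuousOn.intervalIntegrable ?_
    rw [uIcc_of_le hx0]
    exact hc hG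
  set d : ℝ → ℂ := (Ioc 0 x).indicator fun t => (G₁ x t : ℂ) - G₂ x t with hd
  have hdi : IntervalIntegrable d volume 0 π := by
    rw [intervalIntegrable_iff_integrableOn_Ioc_of_le Real.pi_pos.le]
    refine Integrable.integrableOn ?_
    rw [integrable_indicator_iff measurableSet_Ioc]
    exact ((hi h₁).sub (hi h₂)).1
  have hz := ae_eq_zero_of_integral_cos_eq_zero hdi fun n => by
    have e1 := h₁.2 n x ⟨hx0, hx⟩
    have e2 := h₂.2 n x ⟨hx0, hx⟩
    have e3 : ∫ t in (0 : ℝ)..x, ((G₁ x t : ℂ) - G₂ x t) * Complex.cos (n * t) = 0 := by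
      simp_rw [sub_mul]
      rw [intervalIntegral.integral_sub
        ((hi h₁).mul_continuousOn (by fun_prop)) ((hi h₂).mul_continuousOn (by fun_prop))]
      linear_combination e2 - e1
    rw [← e3, intervalIntegral.integral_of_le Real.pi_pos.le, intervalIntegral.integral_of_le hx0]
    have e4 : ∀ t, d t * Complex.cos (n * t) =
        (Ioc 0 x).indicator (fun t => ((G₁ x t : ℂ) - G₂ x t) * Complex.cos (n * t)) t := fun t => by
      rw [hd, indicator_mul_left]
    simp_rw [e4]
    rw [setIntegral_indicator measurableSet_Ioc, inter_eq_right.2 (Ioc_subset_Ioc_right hx)]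
  have hae : (fun t => (G₁ x t : ℂ)) =ᵐ[volume.restrict (Ioo 0 x)] fun t => (G₂ x t : ℂ) := by
    refine (ae_restrict_iff' measurableSet_Ioo).2 ?_
    filter_upwards [hz] with t ht0 htx
    have := ht0 ⟨htx.1, htx.2.trans_le hx⟩
    rw [hd, indicator_of_mem (Ioo_subset_Ioc_self htx)] at this
    exact sub_eq_zero.1 this
  have := Measure.eqOn_open_of_ae_eq hae isOpen_Ioo ((hc h₁).mono Ioo_subset_Icc_self)
    ((hc h₂).mono Ioo_subset_Icc_self) ht
  exact Complex.ofReal_injective this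

end

/-! ### The derivative of the kernel at `x = π` -/

section

open Filter Topology

/-- The shear `(a, w) ↦ (a, a + w)` preserves Lebesgue measure, so the integrability of `κ` carries
over to `κ (a + w)` on strips of finite width. -/
theorem integrableOn_comp_add_mul {κ : ℝ → ℝ} (hκ : Integrable κ) {G : ℝ → ℝ → ℝ}
    (hG : Continuous fun p : ℝ × ℝ => G p.1 p.2) (a b c d : ℝ) :
    IntegrableOn (fun p : ℝ × ℝ => κ (p.1 + p.2) * G p.1 p.2) (uIoc a b ×ˢ uIoc c d) := by
  obtain ⟨C, hC⟩ := ((isCompact_uIcc (a := a) (b := b)).prod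
    (isCompact_uIcc (a := c) (b := d))).exists_bound_of_continuousOn hG.continuousOn
  have h1 : IntegrableOn (fun p : ℝ × ℝ => κ (p.1 + p.2)) (uIoc a b ×ˢ univ) := by
    have h2 : IntegrableOn (fun p : ℝ × ℝ => κ p.2) (uIoc a b ×ˢ univ) := by
      rw [IntegrableOn, Measure.volume_eq_prod, ← Measure.prod_restrict, Measure.restrict_univ]
      have : IsFiniteMeasure ((volume : Measure ℝ).restrict (uIoc a b)) :=
        inferInstanceAs (IsFiniteMeasure (volume.restrict (Ioc _ _)))
      exact hκ.comp_snd _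
    have h3 := (measurePreserving_prod_add (volume : Measure ℝ) volume)
    have h4 := (h3.integrableOn_comp_preimage
      (MeasurableEquiv.shearAddRight ℝ).measurableEmbedding (s := uIoc a b ×ˢ univ)).2 h2
    have h5 : (fun z : ℝ × ℝ => (z.1, z.1 + z.2)) ⁻¹' (uIoc a b ×ˢ univ) = uIoc a b ×ˢ univ := by
      ext; simp
    rw [h5] at h4
    exact h4
  refine Integrable.mul_bdd (c := C) (h1.mono_set (prod_mono_right (subset_univ _)))
    hG.aestronglyMeasurable ?_
  refine (ae_restrict_iff' (measurableSet_uIoc.prod measurableSet_uIoc)).2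
    (ae_of_all _ fun p hp => ?_)
  exact hC p ⟨uIoc_subset_uIcc hp.1, uIoc_subset_uIcc hp.2⟩

/-- The derivative of a Goursat kernel, at the point `(u, π - u)`, in the direction `(1, 1)`. -/
def kernelDeriv (κ : ℝ → ℝ) (G : ℝ → ℝ → ℝ) (u : ℝ) : ℝ :=
  κ u + (∫ s in u..π, κ s * G u (s - u)) + ∫ s in (π - u)..π, κ s * G (s - (π - u)) (π - u)

section
variable {κ : ℝ → ℝ} {h : ℝ} {G : ℝ → ℝ → ℝ}

/-- Both partial derivatives of the double integral exist and are continuous although `κ` is only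
integrable, so the function is differentiable and the directional derivative is their sum. -/
theorem hasDerivAt_integral_integral (hκ : Integrable κ)
    (hG : Continuous fun p : ℝ × ℝ => G p.1 p.2) (u v : ℝ) :
    HasDerivAt (fun τ => ∫ a in (0 : ℝ)..(u + τ), ∫ s in a..(a + (v + τ)), κ s * G a (s - a))
      ((∫ s in u..(u + v), κ s * G u (s - u)) + ∫ s in v..(v + u), κ s * G (s - v) v) 0 := by
  have hF : Continuous fun p : ℝ × ℝ => ∫ s in p.1..(p.1 + p.2), κ s * G p.1 (s - p.1) :=
    continuous_integral_mul (H := fun (p : ℝ × ℝ) s => G p.1 (s - p.1)) hκ.locallyIntegrable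
      (hG.comp (f := fun p : (ℝ × ℝ) × ℝ => (p.1.1, p.2 - p.1.1)) (by fun_prop))
      (by fun_prop) (by fun_prop)
  have hE : Continuous fun p : ℝ × ℝ => ∫ s in p.2..(p.2 + p.1), κ s * G (s - p.2) p.2 :=
    continuous_integral_mul (H := fun (p : ℝ × ℝ) s => G (s - p.2) p.2) hκ.locallyIntegrable
      (hG.comp (f := fun p : (ℝ × ℝ) × ℝ => (p.2 - p.1.2, p.1.2)) (by fun_prop))
      (by fun_prop) (by fun_prop)
  -- With `s = a + w` the region is the rectangle `[0, U] × [0, V]`. Integrating over `w` last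
  -- exhibits the derivative in `V`.
  have hswap : ∀ U V : ℝ, ∫ a in (0 : ℝ)..U, ∫ s in a..(a + V), κ s * G a (s - a) =
      ∫ w in (0 : ℝ)..V, ∫ s in w..(w + U), κ s * G (s - w) w := by
    intro U V
    have e1 : ∀ a, ∫ s in a..(a + V), κ s * G a (s - a) =
        ∫ w in (0 : ℝ)..V, κ (a + w) * G a w := fun a => by
      have := intervalIntegral.integral_comp_add_left (a := 0) (b := V)
        (fun s => κ s * G a (s - a)) a
      simpa using this.symm
    have e2 : ∀ w, ∫ s in w..(w + U), κ s * G (s - w) w =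
        ∫ a in (0 : ℝ)..U, κ (a + w) * G a w := fun w => by
      have := intervalIntegral.integral_comp_add_right (a := 0) (b := U)
        (fun s => κ s * G (s - w) w) w
      rw [zero_add, add_comm U] at this
      simpa using this.symm
    simp_rw [e1, e2]
    exact intervalIntegral_intervalIntegral_swap (integrableOn_comp_add_mul hκ hG 0 U 0 V)
  have hd := hasStrictFDerivAt_uncurry_coprod (𝕜 := ℝ) (u := (u, v))
    (f := fun U V => ∫ a in (0 : ℝ)..U, ∫ s in a..(a + V), κ s * G a (s - a))
    (f₁ := fun U V => ContinuousLinearMap.toSpanSingleton ℝ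
      (∫ s in U..(U + V), κ s * G U (s - U)))
    (f₂ := fun U V => ContinuousLinearMap.toSpanSingleton ℝ
      (∫ s in V..(V + U), κ s * G (s - V) V))
    (Eventually.of_forall fun p =>
      ((hF.comp (f := fun a : ℝ => (a, p.2)) (by fun_prop)).integral_hasStrictDerivAt 0
        p.1).hasDerivAt.hasFDerivAt)
    (Eventually.of_forall fun p => by
      simp_rw [hswap]
      exact ((hE.comp (f := fun w : ℝ => (p.1, w)) (by fun_prop)).integral_hasStrictDerivAt 0
        p.2).hasDerivAt.hasFDerivAt)
    ((ContinuousLinearMap.toSpanSingletonLIE ℝ ℝ).continuous.comp hF).continuousAt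
    ((ContinuousLinearMap.toSpanSingletonLIE ℝ ℝ).continuous.comp hE).continuousAt
  have hl : HasDerivAt (fun τ : ℝ => (u + τ, v + τ)) ((1 : ℝ), (1 : ℝ)) 0 :=
    ((hasDerivAt_id _).const_add u).prodMk ((hasDerivAt_id _).const_add v)
  have hd' : HasFDerivAt (fun p : ℝ × ℝ => ∫ a in (0 : ℝ)..p.1, ∫ s in a..(a + p.2),
      κ s * G a (s - a)) ((ContinuousLinearMap.toSpanSingleton ℝ
        (∫ s in u..(u + v), κ s * G u (s - u))).coprod (ContinuousLinearMap.toSpanSingleton ℝ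
        (∫ s in v..(v + u), κ s * G (s - v) v))) ((fun τ : ℝ => (u + τ, v + τ)) 0) := by
    have := hd.hasFDerivAt
    simp only [add_zero]
    exact this
  have := hd'.comp_hasDerivAt 0 hl
  refine this.congr_deriv ?_
  simp

/-- Only the primitive of `κ` can fail to be differentiable; Lebesgue's differentiation theorem
settles it for almost every `u`. The restriction `0 < u` keeps the integral equation valid nearby.
-/
theorem IsGoursatKernel.ae_hasDerivAt (hG : IsGoursatKernel κ h G) (hκ : Integrable κ) :
    ∀ᵐ u, 0 < u → HasDerivAt (fun τ => G (u + τ) (π - u + τ)) (kernelDeriv κ G u) 0 := by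
  filter_upwards [LocallyIntegrable.ae_hasDerivAt_integral hκ.locallyIntegrable] with u hu hu0
  have h1 : HasDerivAt (fun τ => ∫ a in (0 : ℝ)..(u + τ), κ a) (κ u) 0 := by
    have h2 := hu 0
    rw [← add_zero u] at h2
    have := h2.scomp (0 : ℝ) ((hasDerivAt_id (0 : ℝ)).const_add u)
    simpa [Function.comp_def] using this
  have h2 := (h1.const_add h).add (hasDerivAt_integral_integral hκ hG.1 u (π - u))
  rw [show u + (π - u) = π by ring, show π - u + u = π by ring, ← add_assoc] at h2
  refine h2.congr_of_eventuallyEq ?_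
  have : ∀ᶠ τ in 𝓝 (0 : ℝ), 0 < u + τ := by
    have : ContinuousAt (fun τ : ℝ => u + τ) 0 := by fun_prop
    exact this.eventually (lt_mem_nhds (by simpa using hu0))
  filter_upwards [this] with τ hτ
  exact hG.2 _ hτ.le _

end

end

section

open Filter Topology

theorem map_affine_volume {b : ℝ} (hb : b ≠ 0) (a : ℝ) :
    Measure.map (fun t : ℝ => a + b * t) volume = ENNReal.ofReal |b⁻¹| • volume := by
  have : (fun t : ℝ => a + b * t) = (fun t => a + t) ∘ fun t => b * t := rfl
  rw [this, ← Measure.map_map (by fun_prop) (by fun_prop), Real.map_volume_mul_left hb,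
    Measure.map_smul, map_add_left_eq_self]

theorem ae_comp_affine {p : ℝ → Prop} (hp : ∀ᵐ u, p u) {b : ℝ} (hb : b ≠ 0) (a : ℝ) :
    ∀ᵐ t : ℝ, p (a + b * t) := by
  have h : Measure.QuasiMeasurePreserving (fun t : ℝ => a + b * t) volume volume :=
    ⟨by fun_prop, by rw [map_affine_volume hb]; exact Measure.smul_absolutelyContinuous⟩
  exact h.ae hp

theorem memLp_comp_affine {f : ℝ → ℝ} (hf : MemLp f 2) {b : ℝ} (hb : b ≠ 0) (a : ℝ) :
    MemLp (fun t => f (a + b * t)) 2 := by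
  have h : MemLp f 2 (Measure.map (fun t : ℝ => a + b * t) volume) := by
    rw [map_affine_volume hb]
    exact hf.smul_measure ENNReal.ofReal_ne_top
  exact h.comp_of_map (by fun_prop)

/-- The derivative of the transmutation kernel at `x = π`. -/
def symKernelDeriv (κ : ℝ → ℝ) (G : ℝ → ℝ → ℝ) (t : ℝ) : ℝ :=
  (kernelDeriv κ G ((π + t) / 2) + kernelDeriv κ G ((π + -t) / 2)) / 4

section
variable {κ : ℝ → ℝ} {h : ℝ} {G : ℝ → ℝ → ℝ}

theorem IsGoursatKernel.ae_hasDerivAt_symKernel (hG : IsGoursatKernel κ h G)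
    (hκ : Integrable κ) : ∀ᵐ t, t ∈ Ioo 0 π →
      HasDerivAt (fun s => symKernel G s t) (symKernelDeriv κ G t) π := by
  have h1 := hG.ae_hasDerivAt hκ
  filter_upwards [ae_comp_affine h1 (b := 1 / 2) (by norm_num) (π / 2),
    ae_comp_affine h1 (b := -(1 / 2)) (by norm_num) (π / 2)] with t h2 h3 ht
  have e2 : π / 2 + 1 / 2 * t = (π + t) / 2 := by ring
  have e3 : π / 2 + -(1 / 2) * t = (π + -t) / 2 := by ring
  rw [e2] at h2
  rw [e3] at h3
  -- Moving `x` at fixed `t` moves `u` and `v` together at speed `1/2`; with the `1/2` in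
  -- `symKernel` this explains the `1/4` in `symKernelDeriv`.
  have hl : HasDerivAt (fun s : ℝ => (s - π) / 2) (1 / 2) π :=
    ((hasDerivAt_id π).sub_const π).div_const 2
  have hπ : (0 : ℝ) = (π - π) / 2 := by ring
  have k2 := h2 (by linarith [ht.1, Real.pi_pos])
  have k3 := h3 (by linarith [ht.2])
  rw [hπ] at k2 k3
  have k := ((k2.comp π hl).add (k3.comp π hl)).div_const 2
  refine (k.congr_deriv ?_).congr_of_eventuallyEq (Eventually.of_forall fun s => ?_)
  · rw [symKernelDeriv]; ring
  · simp only [symKernel, Pi.add_apply, Function.comp_apply]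
    congr 3 <;> ring

theorem IsTransmutationKernel.ae_derivWithin_eq {φ : ℂ → ℝ → ℂ} (hG : IsGoursatKernel κ h G)
    (hκ : Integrable κ) (hφ : ∀ ρ, ∀ x ∈ Icc 0 π, φ ρ x = psi G ρ x) {K : ℝ → ℝ → ℝ}
    (hK : IsTransmutationKernel φ K) : ∀ᵐ t, t ∈ Ioo 0 π →
      derivWithin (fun s => K s t) (Icc t π) π = symKernelDeriv κ G t := by
  filter_upwards [hG.ae_hasDerivAt_symKernel hκ] with t h1 ht
  have heq : ∀ s ∈ Ioc t π, K s t = symKernel G s t := fun s hs =>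
    hK.eq_on_triangle (hG.isTransmutationKernel hφ) hs.2 ⟨ht.1, hs.1⟩
  have hd : HasDerivWithinAt (fun s => K s t) (symKernelDeriv κ G t) (Icc t π) π := by
    refine (h1 ht).hasDerivWithinAt.congr_of_eventuallyEq ?_ (heq π ⟨ht.2, le_rfl⟩)
    have h2 : ∀ᶠ s in 𝓝[Icc t π] π, t < s := mem_nhdsWithin_of_mem_nhds (lt_mem_nhds ht.2)
    filter_upwards [h2, self_mem_nhdsWithin] with s hs hs' using heq s ⟨hs, hs'.2⟩
  exact hd.derivWithin (uniqueDiffOn_Icc ht.2 π ⟨ht.2.le, le_rfl⟩)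

theorem IsGoursatKernel.continuous_kernelDeriv_sub (hG : IsGoursatKernel κ h G)
    (hκ : Integrable κ) : Continuous fun u => kernelDeriv κ G u - κ u := by
  have h1 : Continuous fun u => ∫ s in u..π, κ s * G u (s - u) :=
    continuous_integral_mul (H := fun u s => G u (s - u)) hκ.locallyIntegrable
      (hG.1.comp (f := fun p : ℝ × ℝ => (p.1, p.2 - p.1)) (by fun_prop))
      (by fun_prop) (by fun_prop)
  have h2 : Continuous fun u => ∫ s in (π - u)..π, κ s * G (s - (π - u)) (π - u) :=
    continuous_integral_mul (H := fun u s => G (s - (π - u)) (π - u)) hκ.locallyIntegrable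
      (hG.1.comp (f := fun p : ℝ × ℝ => (p.2 - (π - p.1), π - p.1)) (by fun_prop))
      (by fun_prop) (by fun_prop)
  refine (h1.add h2).congr fun u => ?_
  simp only [kernelDeriv, Pi.add_apply]
  ring

theorem IsGoursatKernel.memLp_symKernelDeriv (hG : IsGoursatKernel κ h G)
    (hκ : Integrable κ) (hκ2 : MemLp κ 2) :
    MemLp (symKernelDeriv κ G) 2 (volume.restrict (Ioo 0 π)) := by
  have hc := hG.continuous_kernelDeriv_sub hκ
  have h1 : MemLp (fun t => κ (π / 2 + 1 / 2 * t) + κ (π / 2 + -(1 / 2) * t)) 2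
      (volume.restrict (Ioo 0 π)) :=
    ((memLp_comp_affine hκ2 (by norm_num) _).add
      (memLp_comp_affine hκ2 (by norm_num) _)).restrict _
  have h2 : MemLp (fun t => (kernelDeriv κ G ((π + t) / 2) - κ ((π + t) / 2)) +
      (kernelDeriv κ G ((π + -t) / 2) - κ ((π + -t) / 2))) 2 (volume.restrict (Ioo 0 π)) :=
    memLp_two_of_continuous ((hc.comp (f := fun t : ℝ => (π + t) / 2) (by fun_prop)).add
      (hc.comp (f := fun t : ℝ => (π + -t) / 2) (by fun_prop)))
  refine ((h1.add h2).const_mul (1 / 4)).ae_eq (ae_of_all _ fun t => ?_)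
  have e2 : π / 2 + 1 / 2 * t = (π + t) / 2 := by ring
  have e3 : π / 2 + -(1 / 2) * t = (π + -t) / 2 := by ring
  simp only [Pi.add_apply, symKernelDeriv, e2, e3]
  ring

/-- No differentiation is needed: the formula for `dpsi` at `π` and the integral of `symKernelDeriv`
are matched by Fubini and product-to-sum formulas. The part `1/2 ∫ κ` of the coefficient of `cos ρπ`
comes from `cos ρ(π - s) cos ρs`. -/
theorem IsGoursatKernel.dpsi_pi_eq (hG : IsGoursatKernel κ h G) (hκ : Integrable κ) (ρ : ℂ) :
    dpsi κ h G ρ π = -ρ * Complex.sin (ρ * π) +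
      (h + 1 / 2 * ∫ s in (0 : ℝ)..π, (κ s : ℂ)) * Complex.cos (ρ * π) +
      ∫ t in (0 : ℝ)..π, (symKernelDeriv κ G t : ℂ) * Complex.cos (ρ * t) := by
  have hpi := Real.pi_pos.le
  have hκc : LocallyIntegrable fun s => (κ s : ℂ) := hκ.ofReal.locallyIntegrable
  have hi : ∀ {f : ℝ → ℂ}, Continuous f → ∀ a b, IntervalIntegrable (fun s => (κ s : ℂ) * f s)
    volume a b := fun hf a b =>
      (LocallyIntegrable.intervalIntegrable hκc).mul_continuousOn hf.continuousOn
  set A : ℝ → ℂ := fun u => ∫ s in u..π, (κ s : ℂ) * G u (s - u) with hA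
  set B : ℝ → ℂ := fun w => ∫ s in w..π, (κ s : ℂ) * G (s - w) w with hB
  have hAc : Continuous A :=
    continuous_integral_mul (H := fun u s => (G u (s - u) : ℂ)) hκc
      (hG.continuous_comp (u := fun p : ℝ × ℝ => p.1) (v := fun p => p.2 - p.1) (by fun_prop)
        (by fun_prop)) (by fun_prop) (by fun_prop)
  have hBc : Continuous B :=
    continuous_integral_mul (H := fun u s => (G (s - u) u : ℂ)) hκc
      (hG.continuous_comp (u := fun p : ℝ × ℝ => p.2 - p.1) (v := fun p => p.1) (by fun_prop)
        (by fun_prop)) (by fun_prop) (by fun_prop)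
  have hkd : ∀ u, (kernelDeriv κ G u : ℂ) = κ u + A u + B (π - u) := fun u => by
    simp only [kernelDeriv, hA, hB]
    push_cast
    simp only [← intervalIntegral.integral_ofReal, Complex.ofReal_mul]
  set c : ℝ → ℂ := fun p => Complex.cos (ρ * (2 * p - π)) with hc
  have hcc : Continuous c := by fun_prop
  have hfold : ∫ t in (0 : ℝ)..π, (symKernelDeriv κ G t : ℂ) * Complex.cos (ρ * t) =
      1 / 2 * ∫ p in (0 : ℝ)..π, (kernelDeriv κ G p : ℂ) * c p := by
    have j1 : Integrable fun t => κ ((π + t) / 2) := by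
      have := (hκ.comp_add_left (π / 2)).comp_mul_left' (R := 1 / 2) (by norm_num)
      refine this.congr (ae_of_all _ fun t => ?_)
      simp only
      congr 1
      ring
    have j2 : Continuous fun t => kernelDeriv κ G ((π + t) / 2) - κ ((π + t) / 2) :=
      (hG.continuous_kernelDeriv_sub hκ).comp (f := fun t : ℝ => (π + t) / 2) (by fun_prop)
    have j3 : IntervalIntegrable (fun t => (kernelDeriv κ G ((π + t) / 2) : ℂ) *
        Complex.cos (ρ * t)) volume (-π) π := by
      refine IntervalIntegrable.mul_continuousOn (intervalIntegrable_ofReal ?_) (by fun_prop)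
      refine ((j1.intervalIntegrable (a := -π) (b := π)).add (j2.intervalIntegrable _ _)).congr
        fun t _ => ?_
      simp
    have j4 := integral_fold j3
    have j5 : ∀ p : ℝ, (kernelDeriv κ G ((π + (2 * p - π)) / 2) : ℂ) *
        Complex.cos (ρ * ((2 * p - π : ℝ) : ℂ)) = kernelDeriv κ G p * c p := fun p => by
      rw [show (π + (2 * p - π)) / 2 = p by ring]
      simp only [hc]
      push_cast
      rfl
    simp_rw [j5] at j4
    have j6 : ∫ t in (0 : ℝ)..π, (symKernelDeriv κ G t : ℂ) * Complex.cos (ρ * t) =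
        1 / 4 * ∫ t in (0 : ℝ)..π, ((kernelDeriv κ G ((π + t) / 2) : ℂ) * Complex.cos (ρ * t) +
          (kernelDeriv κ G ((π + -t) / 2) : ℂ) * Complex.cos (ρ * ((-t : ℝ) : ℂ))) := by
      rw [← intervalIntegral.integral_const_mul]
      refine intervalIntegral.integral_congr fun t _ => ?_
      simp only [symKernelDeriv]
      push_cast
      rw [mul_neg, Complex.cos_neg]
      ring
    rw [j6, j4]
    ring
  have hkint : ∫ p in (0 : ℝ)..π, (kernelDeriv κ G p : ℂ) * c p =
      (∫ s in (0 : ℝ)..π, (κ s : ℂ) * c s) + (∫ p in (0 : ℝ)..π, A p * c p) +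
        ∫ p in (0 : ℝ)..π, B p * c p := by
    -- The reflection `p ↦ π - p` changes the sign of `2p - π`, and `c` is even in that quantity.
    have e1 : ∫ p in (0 : ℝ)..π, B p * c p = ∫ p in (0 : ℝ)..π, B (π - p) * c p := by
      have := intervalIntegral.integral_comp_sub_left (a := 0) (b := π) (fun p => B p * c p) π
      rw [sub_self, sub_zero] at this
      rw [← this]
      refine intervalIntegral.integral_congr fun p _ => ?_
      simp only [hc]
      rw [← Complex.cos_neg]
      push_cast
      ring_nf
    have i1 : Continuous fun p => A p * c p := hAc.mul hcc
    have i2 : Continuous fun p => B (π - p) * c p :=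
      (hBc.comp (f := fun p : ℝ => π - p) (by fun_prop)).mul hcc
    rw [e1, ← intervalIntegral.integral_add (hi hcc _ _)
      (i1.intervalIntegrable _ _), ← intervalIntegral.integral_add
      ((hi hcc _ _).add (i1.intervalIntegrable _ _)) (i2.intervalIntegrable _ _)]
    refine intervalIntegral.integral_congr fun p _ => ?_
    simp only [hkd]
    ring
  have hA2 : ∫ p in (0 : ℝ)..π, A p * c p =
      ∫ s in (0 : ℝ)..π, (κ s : ℂ) * ∫ a in (0 : ℝ)..s, (G a (s - a) : ℂ) * c a := by
    rw [← integral_triangle_swap_mul_fst hκc (H := fun s a => (G a (s - a) : ℂ) * c a) ?_ hpi]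
    · refine intervalIntegral.integral_congr fun a _ => ?_
      simp only [hA]
      rw [← intervalIntegral.integral_mul_const]
      refine intervalIntegral.integral_congr fun s _ => ?_
      ring
    · exact (hG.continuous_comp (u := fun p : ℝ × ℝ => p.2) (v := fun p => p.1 - p.2)
        (by fun_prop) (by fun_prop)).mul (by fun_prop)
  have hB2 : ∫ p in (0 : ℝ)..π, B p * c p =
      ∫ s in (0 : ℝ)..π, (κ s : ℂ) * ∫ a in (0 : ℝ)..s, (G a (s - a) : ℂ) * c (s - a) := by
    have e1 : ∀ s : ℝ, ∫ a in (0 : ℝ)..s, (G a (s - a) : ℂ) * c (s - a) =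
        ∫ w in (0 : ℝ)..s, (G (s - w) w : ℂ) * c w := fun s => by
      have := intervalIntegral.integral_comp_sub_left (a := 0) (b := s)
        (fun w => (G (s - w) w : ℂ) * c w) s
      rw [sub_self, sub_zero] at this
      rw [← this]
      refine intervalIntegral.integral_congr fun p _ => ?_
      simp only [sub_sub_cancel]
    simp_rw [e1]
    rw [← integral_triangle_swap_mul_fst hκc (H := fun s w => (G (s - w) w : ℂ) * c w) ?_ hpi]
    · refine intervalIntegral.integral_congr fun a _ => ?_
      simp only [hB]
      rw [← intervalIntegral.integral_mul_const]
      refine intervalIntegral.integral_congr fun s _ => ?_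
      ring
    · exact (hG.continuous_comp (u := fun p : ℝ × ℝ => p.1 - p.2) (v := fun p => p.2)
        (by fun_prop) (by fun_prop)).mul (by fun_prop)
  have hC : ∀ {H : ℝ → ℝ → ℂ}, (Continuous fun p : ℝ × ℝ => H p.1 p.2) →
      Continuous fun s => ∫ a in (0 : ℝ)..s, H s a := fun hH =>
    intervalIntegral.continuous_parametric_intervalIntegral_of_continuous hH (by fun_prop)
  have hC1 : Continuous fun s : ℝ => ∫ a in (0 : ℝ)..s, (G a (s - a) : ℂ) * c a :=
    hC (H := fun s a => (G a (s - a) : ℂ) * c a)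
      ((hG.continuous_comp (u := fun p : ℝ × ℝ => p.2) (v := fun p => p.1 - p.2)
        (by fun_prop) (by fun_prop)).mul (by fun_prop))
  have hC2 : Continuous fun s : ℝ => ∫ a in (0 : ℝ)..s, (G a (s - a) : ℂ) * c (s - a) :=
    hC (H := fun s a => (G a (s - a) : ℂ) * c (s - a))
      ((hG.continuous_comp (u := fun p : ℝ × ℝ => p.2) (v := fun p => p.1 - p.2)
        (by fun_prop) (by fun_prop)).mul (by fun_prop))
  rw [hfold, hkint, hA2, hB2, dpsi]
  have hmain : ∀ s : ℝ, (κ s : ℂ) * (Complex.cos (ρ * (π - s)) * psi G ρ s) =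
      1 / 2 * ((κ s : ℂ) * Complex.cos (ρ * π) + (κ s : ℂ) * c s +
      (κ s : ℂ) * (∫ a in (0 : ℝ)..s, (G a (s - a) : ℂ) * c a) +
      (κ s : ℂ) * ∫ a in (0 : ℝ)..s, (G a (s - a) : ℂ) * c (s - a)) := by
    intro s
    have hgc : Continuous fun a : ℝ => (G a (s - a) : ℂ) :=
      hG.continuous_comp (u := fun a : ℝ => a) (v := fun a => s - a) (by fun_prop) (by fun_prop)
    have hcs : ∀ x y : ℂ, Complex.cos x * Complex.cos y =
        1 / 2 * (Complex.cos (x + y) + Complex.cos (y - x)) := fun x y => by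
      rw [Complex.cos_add, Complex.cos_sub]; ring
    have e1 : Complex.cos (ρ * (π - s)) * Complex.cos (ρ * s) =
        1 / 2 * (Complex.cos (ρ * π) + c s) := by
      rw [hcs]
      simp only [hc]
      ring_nf
    have e2 : Complex.cos (ρ * (π - s)) *
        (∫ p in (0 : ℝ)..s, (G p (s - p) : ℂ) * Complex.cos (ρ * (2 * p - s))) =
        1 / 2 * ((∫ a in (0 : ℝ)..s, (G a (s - a) : ℂ) * c a) +
          ∫ a in (0 : ℝ)..s, (G a (s - a) : ℂ) * c (s - a)) := by
      have i1 : Continuous fun a : ℝ => (G a (s - a) : ℂ) * c a := hgc.mul hcc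
      have i2 : Continuous fun a : ℝ => (G a (s - a) : ℂ) * c (s - a) := hgc.mul (by fun_prop)
      rw [← intervalIntegral.integral_add (i1.intervalIntegrable _ _)
        (i2.intervalIntegrable _ _), ← intervalIntegral.integral_const_mul,
        ← intervalIntegral.integral_const_mul]
      refine intervalIntegral.integral_congr fun a _ => ?_
      have e3 : Complex.cos (ρ * (π - s)) * Complex.cos (ρ * (2 * a - s)) =
          1 / 2 * (c (s - a) + c a) := by
        rw [hcs]
        simp only [hc]
        rw [← Complex.cos_neg (ρ * (2 * ((s - a : ℝ) : ℂ) - π))]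
        push_cast
        ring_nf
      linear_combination (G a (s - a) : ℂ) * e3
    rw [psi]
    linear_combination (κ s : ℂ) * e1 + (κ s : ℂ) * e2
  simp_rw [hmain]
  have j0 := (LocallyIntegrable.intervalIntegrable hκc (a := 0) (b := π)).mul_const
    (Complex.cos (ρ * π))
  have j1 := hi hcc 0 π
  have j2 := hi hC1 0 π
  have j3 := hi hC2 0 π
  rw [intervalIntegral.integral_const_mul, intervalIntegral.integral_add ((j0.add j1).add j2) j3,
    intervalIntegral.integral_add (j0.add j1) j2, intervalIntegral.integral_add j0 j1,
    intervalIntegral.integral_mul_const]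
  ring

end

end

/-! ### Existence of `φ` and its representation at the endpoint -/

section
variable {q : ℝ → ℝ} {h : ℝ}

theorem memLp_indicator (hq : MemLp q 2 (volume.restrict (Ioo 0 π))) :
    MemLp ((Icc 0 π).indicator q) 2 := by
  rw [memLp_indicator_iff_restrict measurableSet_Icc,
    ← Measure.restrict_congr_set (Ioo_ae_eq_Icc (μ := volume) (a := (0 : ℝ)) (b := π))]
  exact hq

theorem integrable_indicator (hq : MemLp q 2 (volume.restrict (Ioo 0 π))) :
    Integrable ((Icc 0 π).indicator q) := by
  rw [integrable_indicator_iff measurableSet_Icc, IntegrableOn,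
    ← Measure.restrict_congr_set (Ioo_ae_eq_Icc (μ := volume) (a := (0 : ℝ)) (b := π))]
  exact hq.integrable (by norm_num)

theorem exists_isPhi (hq : MemLp q 2 (volume.restrict (Ioo 0 π))) (h : ℝ) :
    ∃ φ dφ : ℂ → ℝ → ℂ, IsPhi q h φ dφ := by
  obtain ⟨G, hG⟩ := exists_goursat_kernel (integrable_indicator hq) h
  have hG : IsGoursatKernel _ h G := hG
  exact ⟨psi G, dpsi ((Icc 0 π).indicator q) h G, fun ρ =>
    ⟨hG.isSLSolution (integrable_indicator hq) (fun x hx => indicator_of_mem hx q) ρ,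
      IsGoursatKernel.psi_zero ρ, IsGoursatKernel.dpsi_zero ρ⟩⟩

theorem integral_congr_Ioo {f g : ℝ → ℝ} (hfg : ∀ᵐ t, t ∈ Ioo 0 π → f t = g t) :
    ∫ t in (0 : ℝ)..π, f t = ∫ t in (0 : ℝ)..π, g t := by
  refine intervalIntegral.integral_congr_ae ?_
  have : ∀ᵐ t : ℝ, t ≠ π := by simp [ae_iff, measure_singleton]
  filter_upwards [hfg, this] with t h1 h2 ht
  rw [uIoc_of_le Real.pi_pos.le] at ht
  exact h1 ⟨ht.1, lt_of_le_of_ne ht.2 h2⟩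

/-- Everything later arguments need at `x = π`. The coefficient identities hold for every kernel
`G`, since kernels agree on the open triangle and the coefficients see `G` and its left derivative
only there, up to null sets. -/
theorem IsPhi.exists_kernel (hq : MemLp q 2 (volume.restrict (Ioo 0 π))) {φ dφ : ℂ → ℝ → ℂ}
    (hφ : IsPhi q h φ dφ) : ∃ (K : ℝ → ℝ → ℝ) (g Γ : ℝ → ℝ), IsTransmutationKernel φ K ∧
      MemLp g 2 (volume.restrict (Ioo 0 π)) ∧
      MemLp Γ 2 (volume.restrict (Ioo 0 π)) ∧
      (∀ ρ : ℂ, φ ρ π = Complex.cos (ρ * π) +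
        ∫ t in (0 : ℝ)..π, (g t : ℂ) * Complex.cos (ρ * t)) ∧
      (∀ ρ : ℂ, dφ ρ π = -ρ * Complex.sin (ρ * π) + omegaOne q h * Complex.cos (ρ * π) +
        ∫ t in (0 : ℝ)..π, (Γ t : ℂ) * Complex.cos (ρ * t)) ∧
      ∀ G : ℝ → ℝ → ℝ, IsTransmutationKernel φ G → ∀ n : ℕ,
        gCoeff G n π = (4 * n + 1) * ∫ t in (0 : ℝ)..π, g t * legendreP (2 * n) (t / π) ∧
        gammaCoeff G n π = (4 * n + 1) * ∫ t in (0 : ℝ)..π, Γ t * legendreP (2 * n) (t / π) := by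
  set κ := (Icc 0 π).indicator q with hκd
  have hκ : Integrable κ := integrable_indicator hq
  obtain ⟨G₀, hG⟩ := exists_goursat_kernel hκ h
  have hG : IsGoursatKernel κ h G₀ := hG
  have hκq : ∀ x ∈ Icc 0 π, κ x = q x := fun x hx => indicator_of_mem hx q
  have hqi := MemLp.intervalIntegrable_of_two hq
  have huniq : ∀ ρ, ∀ x ∈ Icc 0 π, φ ρ x = psi G₀ ρ x ∧ dφ ρ x = dpsi κ h G₀ ρ x :=
    fun ρ x hx => by
      have := (hφ ρ).1.unique (hG.isSLSolution hκ hκq ρ) hqi (c := 1)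
        (by rw [(hφ ρ).2.1, IsGoursatKernel.psi_zero, one_mul])
        (by rw [(hφ ρ).2.2, IsGoursatKernel.dpsi_zero, one_mul]) x hx
      simpa using this
  have hφψ := fun ρ x hx => (huniq ρ x hx).1
  have hπ : π ∈ Icc 0 π := right_mem_Icc.2 Real.pi_pos.le
  have hK := hG.isTransmutationKernel hφψ
  refine ⟨symKernel G₀, fun t => symKernel G₀ π t, symKernelDeriv κ G₀, hK, ?_,
    hG.memLp_symKernelDeriv hκ (memLp_indicator hq), fun ρ => hK.2 ρ π hπ, fun ρ => ?_,
    fun G hG' n => ⟨?_, ?_⟩⟩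
  · exact memLp_two_of_continuous (hG.continuous_symKernel.comp (f := fun t : ℝ => (π, t)) (by fun_prop))
  · rw [(huniq ρ π hπ).2, hG.dpsi_pi_eq hκ, omegaOne]
    have : ∫ s in (0 : ℝ)..π, (κ s : ℂ) = ((∫ s in (0 : ℝ)..π, q s : ℝ) : ℂ) := by
      rw [← intervalIntegral.integral_ofReal]
      refine intervalIntegral.integral_congr fun s hs => ?_
      rw [uIcc_of_le Real.pi_pos.le] at hs
      simp only [hκq s hs]
    rw [this]
    push_cast
    ring
  · rw [gCoeff]
    congr 1
    refine integral_congr_Ioo (ae_of_all _ fun t ht => ?_)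
    rw [hG'.eq_on_triangle hK le_rfl ht]
  · rw [gammaCoeff]
    congr 1
    refine integral_congr_Ioo ?_
    filter_upwards [hG'.ae_derivWithin_eq hG hκ hφψ] with t h1 ht
    rw [h1 ht]

end

/-! ### Wronskian identities and the characterisation of eigenvalues -/

section

open Filter Topology

/-- Integration by parts for absolutely continuous functions. -/
theorem integral_mul_primitive {a b : ℝ → ℂ} {x : ℝ} (hx : 0 ≤ x)
    (ha : IntervalIntegrable a volume 0 x) (hb : IntervalIntegrable b volume 0 x) :
    (∫ u in (0 : ℝ)..x, a u * ∫ s in (0 : ℝ)..u, b s) +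
      ∫ s in (0 : ℝ)..x, b s * ∫ u in (0 : ℝ)..s, a u =
      (∫ u in (0 : ℝ)..x, a u) * ∫ s in (0 : ℝ)..x, b s := by
  have hF : IntegrableOn (fun p : ℝ × ℝ => a p.1 * b p.2) (Ioc 0 x ×ˢ Ioc 0 x) := by
    rw [IntegrableOn, Measure.volume_eq_prod, ← Measure.prod_restrict]
    exact ha.1.mul_prod hb.1
  have h1 := integral_triangle_swap (F := fun u s => a u * b s) hx hF
  simp_rw [intervalIntegral.integral_const_mul, intervalIntegral.integral_mul_const] at h1
  have hAc := intervalIntegral.continuousOn_primitive_interval' ha left_mem_uIcc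
  have h2 : ∫ s in (0 : ℝ)..x, (∫ u in s..x, a u) * b s =
      (∫ u in (0 : ℝ)..x, a u) * (∫ s in (0 : ℝ)..x, b s) -
        ∫ s in (0 : ℝ)..x, b s * ∫ u in (0 : ℝ)..s, a u := by
    rw [← intervalIntegral.integral_const_mul, ← intervalIntegral.integral_sub (hb.const_mul _)
      (hb.mul_continuousOn hAc)]
    refine intervalIntegral.integral_congr fun s hs => ?_
    have h3 := intervalIntegral.integral_add_adjacent_intervals
      (ha.mono_set (uIcc_subset_uIcc left_mem_uIcc hs))
      (ha.mono_set (uIcc_subset_uIcc hs right_mem_uIcc))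
    simp only [← h3]
    ring
  rw [h1, h2]
  ring

section
variable {q : ℝ → ℝ} {h : ℝ}

/-- Since `dy₂` is only a primitive of an integrable function, the product rule is replaced by
`integral_mul_primitive`. -/
theorem IsSLSolution.mul_deriv_eq {z₁ z₂ : ℂ} {y₁ dy₁ y₂ dy₂ : ℝ → ℂ}
    (h₁ : IsSLSolution q z₁ y₁ dy₁) (h₂ : IsSLSolution q z₂ y₂ dy₂)
    (hq : IntervalIntegrable q volume 0 π) :
    y₁ π * dy₂ π = y₁ 0 * dy₂ 0 + (∫ t in (0 : ℝ)..π, dy₁ t * dy₂ t) +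
      ∫ t in (0 : ℝ)..π, ((q t : ℂ) - z₂) * (y₁ t * y₂ t) := by
  have hpi := Real.pi_pos.le
  have hπ : π ∈ Icc 0 π := right_mem_Icc.2 hpi
  have i1 : IntervalIntegrable dy₁ volume 0 π :=
    ContinuousOn.intervalIntegrable (by rw [uIcc_of_le hpi]; exact h₁.continuousOn_deriv hq)
  have i2 := intervalIntegrable_sub_mul hq z₂ h₂.continuousOn
  have i4 := intervalIntegrable_sub_mul (y := fun t => y₁ t * y₂ t) hq z₂
    (h₁.continuousOn.mul h₂.continuousOn)
  have i3 : IntervalIntegrable (fun t => dy₁ t * dy₂ t) volume 0 π :=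
    ContinuousOn.intervalIntegrable (by
      rw [uIcc_of_le hpi]; exact (h₁.continuousOn_deriv hq).mul (h₂.continuousOn_deriv hq))
  have k := integral_mul_primitive hpi i1 i2
  have e1 : ∫ u in (0 : ℝ)..π, dy₁ u * ∫ s in (0 : ℝ)..u, ((q s : ℂ) - z₂) * y₂ s =
      (∫ u in (0 : ℝ)..π, dy₁ u * dy₂ u) - (∫ u in (0 : ℝ)..π, dy₁ u) * dy₂ 0 := by
    rw [← intervalIntegral.integral_mul_const, ← intervalIntegral.integral_sub i3
      (i1.mul_const _)]
    refine intervalIntegral.integral_congr fun t ht => ?_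
    rw [uIcc_of_le hpi] at ht
    simp only [h₂.eqn t ht]
    ring
  have e2 : ∫ s in (0 : ℝ)..π, (((q s : ℂ) - z₂) * y₂ s) * ∫ u in (0 : ℝ)..s, dy₁ u =
      (∫ t in (0 : ℝ)..π, ((q t : ℂ) - z₂) * (y₁ t * y₂ t)) -
      (∫ t in (0 : ℝ)..π, ((q t : ℂ) - z₂) * y₂ t) * y₁ 0 := by
    rw [← intervalIntegral.integral_mul_const, ← intervalIntegral.integral_sub i4
      (i2.mul_const _)]
    refine intervalIntegral.integral_congr fun t ht => ?_
    rw [uIcc_of_le hpi] at ht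
    simp only [h₁.integral_deriv hq ht]
    ring
  rw [e1, e2, h₁.integral_deriv hq hπ] at k
  have e3 := h₂.eqn π hπ
  have e4 : ∫ t in (0 : ℝ)..π, ((q t : ℂ) - z₂) * y₂ t = dy₂ π - dy₂ 0 := by
    rw [e3]; ring
  rw [e4] at k
  linear_combination -k

theorem IsSLSolution.wronskian {z₁ z₂ : ℂ} {y₁ dy₁ y₂ dy₂ : ℝ → ℂ}
    (h₁ : IsSLSolution q z₁ y₁ dy₁) (h₂ : IsSLSolution q z₂ y₂ dy₂)
    (hq : IntervalIntegrable q volume 0 π) :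
    y₁ π * dy₂ π - dy₁ π * y₂ π = y₁ 0 * dy₂ 0 - dy₁ 0 * y₂ 0 +
      (z₁ - z₂) * ∫ t in (0 : ℝ)..π, y₁ t * y₂ t := by
  have k1 := h₁.mul_deriv_eq h₂ hq
  have k2 := h₂.mul_deriv_eq h₁ hq
  have i1 := intervalIntegrable_sub_mul (y := fun t => y₂ t * y₁ t) hq z₁
    (h₂.continuousOn.mul h₁.continuousOn)
  have i2 := intervalIntegrable_sub_mul (y := fun t => y₁ t * y₂ t) hq z₂
    (h₁.continuousOn.mul h₂.continuousOn)
  have e : (z₁ - z₂) * ∫ t in (0 : ℝ)..π, y₁ t * y₂ t =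
      (∫ t in (0 : ℝ)..π, ((q t : ℂ) - z₂) * (y₁ t * y₂ t)) -
      ∫ t in (0 : ℝ)..π, ((q t : ℂ) - z₁) * (y₂ t * y₁ t) := by
    rw [← intervalIntegral.integral_sub i2 i1, ← intervalIntegral.integral_const_mul]
    refine intervalIntegral.integral_congr fun t _ => ?_
    ring
  have e2 : ∫ t in (0 : ℝ)..π, dy₂ t * dy₁ t = ∫ t in (0 : ℝ)..π, dy₁ t * dy₂ t :=
    intervalIntegral.integral_congr fun t _ => mul_comm _ _
  rw [e]
  rw [e2] at k2
  linear_combination k1 - k2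

theorem IsSLSolution.conj {z : ℂ} {y dy : ℝ → ℂ} (hy : IsSLSolution q z y dy)
    (hz : (starRingEnd ℂ) z = z) :
    IsSLSolution q z (fun x => (starRingEnd ℂ) (y x)) (fun x => (starRingEnd ℂ) (dy x)) := by
  refine ⟨fun x hx => ?_, fun x hx => ?_⟩
  · have := Complex.conjCLE.toContinuousLinearMap.hasFDerivAt.comp_hasDerivWithinAt x (hy.deriv x hx)
    simpa using! this
  · rw [hy.eqn x hx, map_add]
    congr 1
    rw [intervalIntegral.intervalIntegral_eq_integral_uIoc,
      intervalIntegral.intervalIntegral_eq_integral_uIoc, Complex.real_smul, Complex.real_smul,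
      map_mul, ← integral_conj, Complex.conj_ofReal]
    simp [hz]

section
variable {φ dφ : ℂ → ℝ → ℂ}

theorem IsPhi.conj_eq (hφ : IsPhi q h φ dφ) (hq : IntervalIntegrable q volume 0 π) {ρ : ℂ}
    (hρ : (starRingEnd ℂ) (ρ ^ 2) = ρ ^ 2) {x : ℝ} (hx : x ∈ Icc 0 π) :
    (starRingEnd ℂ) (φ ρ x) = φ ρ x ∧ (starRingEnd ℂ) (dφ ρ x) = dφ ρ x := by
  have := ((hφ ρ).1.conj hρ).unique (hφ ρ).1 hq (c := 1) (by simp [(hφ ρ).2.1])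
    (by simp [(hφ ρ).2.2]) x hx
  simpa using this

theorem IsPhi.wronskian (hφ : IsPhi q h φ dφ) (hq : IntervalIntegrable q volume 0 π) (ρ σ : ℂ) :
    φ ρ π * dφ σ π - dφ ρ π * φ σ π =
      (ρ ^ 2 - σ ^ 2) * ∫ t in (0 : ℝ)..π, φ ρ t * φ σ t := by
  rw [(hφ ρ).1.wronskian (hφ σ).1 hq, (hφ ρ).2.1, (hφ ρ).2.2, (hφ σ).2.1, (hφ σ).2.2]
  ring

theorem IsPhi.integral_sq_pos (hφ : IsPhi q h φ dφ) (hq : IntervalIntegrable q volume 0 π) {ρ : ℂ}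
    (hρ : (starRingEnd ℂ) (ρ ^ 2) = ρ ^ 2) :
    ∃ r : ℝ, 0 < r ∧ ∫ t in (0 : ℝ)..π, φ ρ t ^ 2 = r := by
  have hpi := Real.pi_pos
  have hc : ContinuousOn (fun t => (φ ρ t).re ^ 2) (Icc 0 π) :=
    (Complex.continuous_re.comp_continuousOn (hφ ρ).1.continuousOn).pow 2
  refine ⟨∫ t in (0 : ℝ)..π, (φ ρ t).re ^ 2, ?_, ?_⟩
  · refine intervalIntegral.integral_pos hpi hc (fun t _ => sq_nonneg _)
      ⟨0, left_mem_Icc.2 hpi.le, ?_⟩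
    simp [(hφ ρ).2.1]
  · rw [← intervalIntegral.integral_ofReal]
    refine intervalIntegral.integral_congr fun t ht => ?_
    rw [uIcc_of_le hpi.le] at ht
    have := Complex.conj_eq_iff_re.1 (hφ.conj_eq hq hρ ht).1
    conv_lhs => rw [← this]
    push_cast
    rfl

/-- The condition at `0` makes every eigenfunction a multiple of `φ` with factor `y 0`, which
therefore cannot vanish. -/
theorem IsPhi.mem_eigenvalues (hφ : IsPhi q h φ dφ) (hq : IntervalIntegrable q volume 0 π)
    {ρ : ℂ} {y dy : ℝ → ℂ} (hy : IsSLSolution q (ρ ^ 2) y dy) (hy0 : ∃ x ∈ Icc 0 π, y x ≠ 0)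
    (hbc : dy 0 - h * y 0 = 0) : y 0 ≠ 0 ∧ y π = y 0 * φ ρ π ∧ dy π = y 0 * dφ ρ π := by
  have k := hy.unique (hφ ρ).1 hq (c := y 0) (by simp [(hφ ρ).2.1])
    (by rw [(hφ ρ).2.2]; linear_combination hbc)
  refine ⟨fun h0 => ?_, k π (right_mem_Icc.2 Real.pi_pos.le)⟩
  obtain ⟨x, hx, hxy⟩ := hy0
  exact hxy (by rw [(k x hx).1, h0, zero_mul])

theorem IsPhi.sq_mem_dirichletEigenvalues (hφ : IsPhi q h φ dφ)
    (hq : IntervalIntegrable q volume 0 π) (ρ : ℂ) :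
    ρ ^ 2 ∈ dirichletEigenvalues q h ↔ φ ρ π = 0 := by
  constructor
  · rintro ⟨y, dy, hy, hy0, hbc, hπ⟩
    obtain ⟨h1, h2, -⟩ := hφ.mem_eigenvalues hq hy hy0 hbc
    rw [hπ] at h2
    exact (mul_eq_zero.1 h2.symm).resolve_left h1
  · intro h0
    exact ⟨φ ρ, dφ ρ, (hφ ρ).1, ⟨0, left_mem_Icc.2 Real.pi_pos.le, by simp [(hφ ρ).2.1]⟩,
      by simp [(hφ ρ).2.1, (hφ ρ).2.2], h0⟩

theorem IsPhi.sq_mem_robinEigenvalues (hφ : IsPhi q h φ dφ)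
    (hq : IntervalIntegrable q volume 0 π) (H : ℝ) (ρ : ℂ) :
    ρ ^ 2 ∈ robinEigenvalues q h H ↔ dφ ρ π + H * φ ρ π = 0 := by
  constructor
  · rintro ⟨y, dy, hy, hy0, hbc, hπ⟩
    obtain ⟨h1, h2, h3⟩ := hφ.mem_eigenvalues hq hy hy0 hbc
    rw [h2, h3] at hπ
    have : y 0 * (dφ ρ π + H * φ ρ π) = 0 := by linear_combination hπ
    exact (mul_eq_zero.1 this).resolve_left h1
  · intro h0
    exact ⟨φ ρ, dφ ρ, (hφ ρ).1, ⟨0, left_mem_Icc.2 Real.pi_pos.le, by simp [(hφ ρ).2.1]⟩,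
      by simp [(hφ ρ).2.1, (hφ ρ).2.2], h0⟩

theorem IsPhi.exists_continuous (hφ : IsPhi q h φ dφ)
    (hq : MemLp q 2 (volume.restrict (Ioo 0 π))) :
    ∃ ψ : ℂ → ℝ → ℂ, Continuous (fun p : ℂ × ℝ => ψ p.1 p.2) ∧
      ∀ ρ, ∀ x ∈ Icc 0 π, φ ρ x = ψ ρ x := by
  obtain ⟨G, hG⟩ := exists_goursat_kernel (integrable_indicator hq) h
  have hG : IsGoursatKernel _ h G := hG
  refine ⟨psi G, ?_, fun ρ x hx => ?_⟩
  · unfold psi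
    refine Continuous.add (by fun_prop) ?_
    refine intervalIntegral.continuous_parametric_intervalIntegral_of_continuous
      (f := fun (p : ℂ × ℝ) (s : ℝ) => (G s (p.2 - s) : ℂ) * Complex.cos (p.1 * (2 * s - p.2)))
      ?_ (by fun_prop)
    exact (hG.continuous_comp (u := fun p : (ℂ × ℝ) × ℝ => p.2) (v := fun p => p.1.2 - p.2)
      (by fun_prop) (by fun_prop)).mul (by fun_prop)
  · have := (hφ ρ).1.unique (hG.isSLSolution (integrable_indicator hq)
      (fun x hx => indicator_of_mem hx q) ρ) (MemLp.intervalIntegrable_of_two hq) (c := 1)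
      (by rw [(hφ ρ).2.1, IsGoursatKernel.psi_zero, one_mul])
      (by rw [(hφ ρ).2.2, IsGoursatKernel.dpsi_zero, one_mul]) x hx
    simpa using this.1

/-- Divide `A(ρ²) D(σ²) - D(ρ²) A(σ²) = (ρ² - σ²) ∫ φ(ρ, ·) φ(σ, ·)` by `ρ² - σ²` and let `ρ → σ`.
One identity yields the simplicity of both spectra, the sign argument for `νₖ`, and the norming
constants. -/
theorem IsPhi.deriv_wronskian (hφ : IsPhi q h φ dφ) (hq : MemLp q 2 (volume.restrict (Ioo 0 π)))
    {H : ℝ} {A D : ℂ → ℂ} (hA : Differentiable ℂ A) (hD : Differentiable ℂ D)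
    (hAφ : ∀ ρ, A (ρ ^ 2) = φ ρ π) (hDφ : ∀ ρ, D (ρ ^ 2) = dφ ρ π + H * φ ρ π) (σ : ℂ) :
    deriv A (σ ^ 2) * D (σ ^ 2) - deriv D (σ ^ 2) * A (σ ^ 2) = ∫ t in (0 : ℝ)..π, φ σ t ^ 2 := by
  have hqi := MemLp.intervalIntegrable_of_two hq
  obtain ⟨ψ, hψ, hφψ⟩ := hφ.exists_continuous hq
  set f : ℂ → ℂ := fun w => A w * D (σ ^ 2) - D w * A (σ ^ 2) with hf
  have hfd : HasDerivAt f (deriv A (σ ^ 2) * D (σ ^ 2) - deriv D (σ ^ 2) * A (σ ^ 2)) (σ ^ 2) :=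
    ((hA _).hasDerivAt.mul_const _).sub ((hD _).hasDerivAt.mul_const _)
  have hN : Continuous fun ρ => ∫ t in (0 : ℝ)..π, ψ ρ t * ψ σ t :=
    intervalIntegral.continuous_parametric_intervalIntegral_of_continuous'
      (f := fun ρ t => ψ ρ t * ψ σ t)
      (hψ.mul (hψ.comp (f := fun p : ℂ × ℝ => (σ, p.2)) (by fun_prop))) 0 π
  have hne : ∀ᶠ ρ in 𝓝[≠] σ, ρ ^ 2 ≠ σ ^ 2 := by
    rcases eq_or_ne σ 0 with rfl | h0
    · filter_upwards [self_mem_nhdsWithin] with ρ hρ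
      have : ρ ≠ 0 := hρ
      simpa using this
    · have : ∀ᶠ ρ in 𝓝[≠] σ, ρ ≠ -σ :=
        (mem_nhdsWithin_of_mem_nhds (isOpen_ne.mem_nhds (fun h => h0 (self_eq_neg.1 h))))
      filter_upwards [self_mem_nhdsWithin, this] with ρ h1 h2 h3
      rcases sq_eq_sq_iff_eq_or_eq_neg.1 h3 with h4 | h4
      exacts [h1 h4, h2 h4]
  have hsq : Tendsto (fun ρ : ℂ => ρ ^ 2) (𝓝[≠] σ) (𝓝[≠] (σ ^ 2)) :=
    tendsto_nhdsWithin_iff.2 ⟨((continuous_pow 2).tendsto σ).mono_left nhdsWithin_le_nhds, hne⟩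
  have h1 := hfd.tendsto_slope.comp hsq
  have h2 := (hN.tendsto σ).mono_left (nhdsWithin_le_nhds (s := {σ}ᶜ))
  have h3 : ∀ ρ, ∫ t in (0 : ℝ)..π, ψ ρ t * ψ σ t = ∫ t in (0 : ℝ)..π, φ ρ t * φ σ t := fun ρ => by
    refine intervalIntegral.integral_congr fun t ht => ?_
    rw [uIcc_of_le Real.pi_pos.le] at ht
    simp only [hφψ ρ t ht, hφψ σ t ht]
  simp_rw [h3] at h2
  have h4 := tendsto_nhds_unique_of_eventuallyEq h1 h2 (by
    filter_upwards [hne] with ρ hρ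
    have h5 := hφ.wronskian hqi ρ σ
    have h6 : ρ ^ 2 - σ ^ 2 ≠ 0 := sub_ne_zero.2 hρ
    simp only [Function.comp_apply, slope_def_field, hf, hAφ, hDφ]
    rw [div_eq_iff h6]
    linear_combination h5)
  rw [h4]
  simp_rw [sq]

end

end

end

/-! ### Characteristic functions: derivatives, growth and uniqueness -/

section

open Filter Topology

/-- The characteristic function of the Dirichlet-type problem. -/
def charA (g : ℝ → ℂ) (w : ℂ) : ℂ := cosSqrt (w * π ^ 2) + cosTransform g w

/-- The characteristic function of the Robin problem. -/
def charD (ω : ℂ) (f : ℝ → ℂ) (w : ℂ) : ℂ :=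
  2 * π * w * deriv cosSqrt (w * π ^ 2) + ω * cosSqrt (w * π ^ 2) + cosTransform f w

theorem charA_sq (g : ℝ → ℂ) (ρ : ℂ) :
    charA g (ρ ^ 2) = Complex.cos (ρ * π) + cosTransform g (ρ ^ 2) := by
  rw [charA, ← mul_pow, cosSqrt_sq]

theorem charD_sq (ω : ℂ) (f : ℝ → ℂ) (ρ : ℂ) :
    charD ω f (ρ ^ 2) = -ρ * Complex.sin (ρ * π) + ω * Complex.cos (ρ * π) +
      cosTransform f (ρ ^ 2) := by
  have := mul_deriv_cosSqrt_sq (ρ * π)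
  rw [charD, ← mul_pow, cosSqrt_sq]
  linear_combination ρ * this

section
variable {f g : ℝ → ℂ} {ω : ℂ}

theorem hasDerivAt_cosSqrt_mul (c w : ℂ) :
    HasDerivAt (fun w => cosSqrt (w * c)) (deriv cosSqrt (w * c) * c) w := by
  have h : HasDerivAt (fun w : ℂ => w * c) c w := by simpa using (hasDerivAt_id w).mul_const c
  exact (differentiable_cosSqrt (w * c)).hasDerivAt.comp w h

theorem hasDerivAt_comp_sq {F : ℂ → ℂ} (hF : Differentiable ℂ F) (ρ : ℂ) :
    HasDerivAt (fun ρ => F (ρ ^ 2)) (2 * ρ * deriv F (ρ ^ 2)) ρ := by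
  have := (hF (ρ ^ 2)).hasDerivAt.comp ρ (hasDerivAt_pow 2 ρ)
  exact this.congr_deriv (by push_cast; ring)

theorem differentiable_charA (hg : IntervalIntegrable g volume 0 π) :
    Differentiable ℂ (charA g) := fun w =>
  ((hasDerivAt_cosSqrt_mul (π ^ 2) w).differentiableAt).add (differentiable_cosTransform hg w)

theorem differentiable_deriv_cosSqrt_mul (c : ℂ) :
    Differentiable ℂ fun w => deriv cosSqrt (w * c) :=
  differentiable_deriv_cosSqrt.comp (by fun_prop : Differentiable ℂ fun w : ℂ => w * c)

theorem differentiable_charD (hf : IntervalIntegrable f volume 0 π) :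
    Differentiable ℂ (charD ω f) := fun w =>
  ((DifferentiableAt.mul (by fun_prop) (differentiable_deriv_cosSqrt_mul (π ^ 2) w)).add
    ((hasDerivAt_cosSqrt_mul (π ^ 2) w).differentiableAt.const_mul ω)).add
    (differentiable_cosTransform hf w)

theorem mul_deriv_charD_sq (hf : IntervalIntegrable f volume 0 π) (ρ : ℂ) :
    2 * ρ * deriv (charD ω f) (ρ ^ 2) = -Complex.sin (ρ * π) - π * ρ * Complex.cos (ρ * π) -
      ω * π * Complex.sin (ρ * π) + ∫ t in (0 : ℝ)..π, f t * -(t * Complex.sin (ρ * t)) := by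
  rw [← mul_deriv_cosTransform_sq hf]
  have h1 : HasDerivAt (fun ρ => charD ω f (ρ ^ 2)) (2 * ρ * deriv (charD ω f) (ρ ^ 2)) ρ :=
    hasDerivAt_comp_sq (differentiable_charD hf) ρ
  have h2 : HasDerivAt (fun ρ => cosTransform f (ρ ^ 2))
      (2 * ρ * deriv (cosTransform f) (ρ ^ 2)) ρ :=
    hasDerivAt_comp_sq (differentiable_cosTransform hf) ρ
  have hm : HasDerivAt (fun ρ : ℂ => ρ * π) π ρ := by simpa using (hasDerivAt_id ρ).mul_const (π : ℂ)
  have h3 : HasDerivAt (fun ρ : ℂ => Complex.sin (ρ * π)) (Complex.cos (ρ * π) * π) ρ :=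
    (Complex.hasDerivAt_sin _).comp ρ hm
  have h4 : HasDerivAt (fun ρ : ℂ => Complex.cos (ρ * π)) (-Complex.sin (ρ * π) * π) ρ :=
    (Complex.hasDerivAt_cos _).comp ρ hm
  have h5 := (((hasDerivAt_id ρ).neg.mul h3).add (h4.const_mul ω)).add h2
  have h6 := h1.unique (h5.congr_of_eventuallyEq (Eventually.of_forall fun ρ => charD_sq ω f ρ))
  rw [h6]
  simp only [Pi.neg_apply, id]
  ring

theorem deriv_charD_zero (hf : IntervalIntegrable f volume 0 π) :
    deriv (charD ω f) 0 = -π - ω * π ^ 2 / 2 - 1 / 2 * ∫ t in (0 : ℝ)..π, f t * t ^ 2 := by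
  have h1 : HasDerivAt (fun w : ℂ => 2 * π * w) (2 * π) 0 := by
    simpa using (hasDerivAt_id (0 : ℂ)).const_mul (2 * π : ℂ)
  have h2 := ((h1.mul (differentiable_deriv_cosSqrt_mul (π ^ 2) 0).hasDerivAt).add
    ((hasDerivAt_cosSqrt_mul (π ^ 2) 0).const_mul ω)).add
    (differentiable_cosTransform hf 0).hasDerivAt
  have h3 : deriv (charD ω f) 0 = _ := h2.deriv
  rw [h3, deriv_cosTransform_zero hf]
  simp only [zero_mul, mul_zero, deriv_cosSqrt_zero]
  ring

/-- On `‖ρ‖ = n` the circle avoids the zeros of `cos ρπ`, and by the Riemann–Lebesgue lemma the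
transform takes at most half of the lower bound for the cosine. -/
theorem exists_le_norm_charA (hg : IntervalIntegrable g volume 0 π) :
    ∃ δ > 0, ∃ N : ℕ, ∀ n ≥ N, ∀ ρ : ℂ, ‖ρ‖ = n →
      δ * Real.exp (π * |ρ.im|) ≤ ‖charA g (ρ ^ 2)‖ := by
  set δ := Real.exp (-π) / 8 with hδ
  have hδ0 : 0 < δ := by positivity
  obtain ⟨R, hR⟩ := exists_norm_cosTransform_le hg hδ0
  refine ⟨δ, hδ0, max 4 ⌈R⌉₊, fun n hn ρ hρ => ?_⟩
  have h1 := exp_le_norm_cos ((le_max_left _ _).trans hn) hρ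
  have h2 := hR ρ (by
    rw [hρ]
    exact (Nat.le_ceil R).trans (by exact_mod_cast (le_max_right _ _).trans hn))
  rw [charA_sq]
  have h3 := norm_sub_le_norm_add (Complex.cos (ρ * π)) (cosTransform g (ρ ^ 2))
  have h4 : Real.exp (-π) / 4 = 2 * δ := by rw [hδ]; ring
  rw [h4] at h1
  linarith

/-- The leading term `-ρ sin ρπ` has an extra factor `‖ρ‖`, so any constant `C` is allowed; the
radii `n + 1/2` avoid the zeros of the sine. -/
theorem exists_le_norm_charD (hf : IntervalIntegrable f volume 0 π) (C : ℝ) :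
    ∃ N : ℕ, ∀ n ≥ N, ∀ ρ : ℂ, ‖ρ‖ = n + 1 / 2 →
      C * Real.exp (π * |ρ.im|) ≤ ‖charD ω f (ρ ^ 2)‖ := by
  set δ := Real.exp (-π) / 4 with hδ
  have hδ0 : 0 < δ := by positivity
  set M := ∫ t in (0 : ℝ)..π, ‖f t‖
  refine ⟨max 4 ⌈(C + ‖ω‖ + M) / δ⌉₊, fun n hn ρ hρ => ?_⟩
  have h1 := exp_le_norm_sin ((le_max_left _ _).trans hn) hρ
  have h2 : (C + ‖ω‖ + M) / δ ≤ n :=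
    (Nat.le_ceil _).trans (by exact_mod_cast (le_max_right _ _).trans hn)
  rw [div_le_iff₀ hδ0] at h2
  have h3 := norm_cosTransform_sq_le hf ρ
  have h4 := norm_cos_mul_le ρ (right_mem_Icc.2 Real.pi_pos.le)
  rw [charD_sq, add_assoc]
  have h5 := norm_sub_le_norm_add (-ρ * Complex.sin (ρ * π))
    (ω * Complex.cos (ρ * π) + cosTransform f (ρ ^ 2))
  have h6 : ‖ω * Complex.cos (ρ * π) + cosTransform f (ρ ^ 2)‖ ≤
      ‖ω‖ * Real.exp (π * |ρ.im|) + M * Real.exp (π * |ρ.im|) := by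
    refine (norm_add_le _ _).trans (add_le_add ?_ h3)
    rw [norm_mul]
    gcongr
  have h7 : (n : ℝ) * (δ * Real.exp (π * |ρ.im|)) ≤ ‖-ρ * Complex.sin (ρ * π)‖ := by
    rw [norm_mul, norm_neg]
    gcongr
    rw [hρ]
    linarith
  have h8 := mul_le_mul_of_nonneg_right h2 (Real.exp_pos (π * |ρ.im|)).le
  linarith

theorem eq_zero_of_cosTransform_eq_zero (hf : IntervalIntegrable f volume 0 π)
    (h0 : ∀ w, cosTransform f w = 0) : ∀ᵐ t, t ∈ Ioo 0 π → f t = 0 :=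
  ae_eq_zero_of_integral_cos_eq_zero hf fun n => by
    rw [← cosTransform_sq]
    exact h0 _

theorem eq_sq_of_norm_eq {z : ℂ} {r : ℝ} (hr : 0 ≤ r) (hz : ‖z‖ = r ^ 2) :
    ∃ ρ : ℂ, ρ ^ 2 = z ∧ ‖ρ‖ = r := by
  obtain ⟨ρ, hρ⟩ := IsAlgClosed.exists_pow_nat_eq z (n := 2) (by norm_num)
  refine ⟨ρ, hρ, ?_⟩
  rw [← hρ, norm_pow] at hz
  exact (sq_eq_sq₀ (norm_nonneg _) hr).1 hz

theorem exists_nat_sq_gt (R c : ℝ) (hc : 0 ≤ c) (N : ℕ) : ∃ n ≥ N, R < ((n : ℝ) + c) ^ 2 := by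
  refine ⟨max N (⌈R⌉₊ + 1), le_max_left _ _, ?_⟩
  have h1 : R ≤ ⌈R⌉₊ := Nat.le_ceil R
  have h2 : ((⌈R⌉₊ + 1 : ℕ) : ℝ) ≤ (max N (⌈R⌉₊ + 1) : ℕ) := by exact_mod_cast le_max_right _ _
  push_cast at h2 ⊢
  have h3 : (0 : ℝ) ≤ ⌈R⌉₊ := Nat.cast_nonneg _
  nlinarith

theorem cosTransform_eq_zero_of_charA (hf : IntervalIntegrable f volume 0 π)
    (hg : IntervalIntegrable g volume 0 π)
    (hz : ∀ z, charA g z = 0 → cosTransform f z = 0 ∧ deriv (charA g) z ≠ 0) (z : ℂ) :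
    cosTransform f z = 0 := by
  refine eq_zero_of_vanishing_at_simple_zeros (differentiable_cosTransform hf)
    (differentiable_charA hg) hz (fun ε hε R => ?_) z
  obtain ⟨δ, hδ, N, hN⟩ := exists_le_norm_charA hg
  obtain ⟨R', hR'⟩ := exists_norm_cosTransform_le hf (mul_pos hε hδ)
  obtain ⟨n, hn, hnR⟩ := exists_nat_sq_gt R 0 le_rfl (max N ⌈R'⌉₊)
  rw [add_zero] at hnR
  refine ⟨(n : ℝ) ^ 2, hnR, fun z hz => ?_⟩
  obtain ⟨ρ, rfl, hρ⟩ := eq_sq_of_norm_eq n.cast_nonneg hz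
  have h1 := hN n ((le_max_left _ _).trans hn) ρ hρ
  have h2 := hR' ρ (by
    rw [hρ]
    exact (Nat.le_ceil R').trans (by exact_mod_cast (le_max_right _ _).trans hn))
  have he := Real.exp_pos (π * |ρ.im|)
  refine ⟨norm_pos_iff.1 (lt_of_lt_of_le (by positivity) h1), h2.trans ?_⟩
  rw [mul_assoc]
  gcongr

theorem eq_zero_of_charD {c : ℂ} (hf : IntervalIntegrable f volume 0 π)
    (hg : IntervalIntegrable g volume 0 π)
    (hz : ∀ z, charD ω g z = 0 → c * cosSqrt (z * π ^ 2) - cosTransform f z = 0 ∧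
      deriv (charD ω g) z ≠ 0) (z : ℂ) :
    c * cosSqrt (z * π ^ 2) - cosTransform f z = 0 := by
  refine eq_zero_of_vanishing_at_simple_zeros
    (F := fun z => c * cosSqrt (z * π ^ 2) - cosTransform f z)
    (fun w => ((hasDerivAt_cosSqrt_mul (π ^ 2) w).differentiableAt.const_mul c).sub
      (differentiable_cosTransform hf w)) (differentiable_charD hg) hz (fun ε hε R => ?_) z
  set M := ∫ t in (0 : ℝ)..π, ‖f t‖ with hM
  have hM0 : 0 ≤ M := intervalIntegral.integral_nonneg Real.pi_pos.le fun t _ => norm_nonneg _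
  obtain ⟨N, hN⟩ := exists_le_norm_charD (ω := ω) hg ((‖c‖ + M + 1) / ε)
  obtain ⟨n, hn, hnR⟩ := exists_nat_sq_gt R (1 / 2) (by norm_num) N
  refine ⟨((n : ℝ) + 1 / 2) ^ 2, hnR, fun z hz => ?_⟩
  obtain ⟨ρ, rfl, hρ⟩ := eq_sq_of_norm_eq (by positivity) hz
  have h1 := hN n hn ρ hρ
  have he := Real.exp_pos (π * |ρ.im|)
  refine ⟨norm_pos_iff.1 (lt_of_lt_of_le (by positivity) h1), ?_⟩
  have h3 := norm_cosTransform_sq_le hf ρ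
  have h4 := norm_cos_mul_le ρ (right_mem_Icc.2 Real.pi_pos.le)
  rw [← mul_pow, cosSqrt_sq]
  calc _ ≤ ‖c * Complex.cos (ρ * π)‖ + ‖cosTransform f (ρ ^ 2)‖ := norm_sub_le _ _
    _ ≤ ‖c‖ * Real.exp (π * |ρ.im|) + M * Real.exp (π * |ρ.im|) := by
      rw [norm_mul]
      gcongr
    _ ≤ ε * ((‖c‖ + M + 1) / ε * Real.exp (π * |ρ.im|)) := by
      rw [← mul_assoc, mul_div_cancel₀ _ hε.ne']
      linarith
    _ ≤ _ := by gcongr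

/-- By the Riemann–Lebesgue lemma, a cosine transform is a multiple of `cos ρπ` only if both
vanish. -/
theorem eq_zero_of_mul_cosSqrt_sub {c : ℂ} (hf : IntervalIntegrable f volume 0 π)
    (h0 : ∀ z, c * cosSqrt (z * π ^ 2) - cosTransform f z = 0) :
    c = 0 ∧ ∀ w, cosTransform f w = 0 := by
  have hc : c = 0 := by
    rw [← norm_le_zero_iff]
    refine le_of_forall_pos_le_add fun ε hε => ?_
    obtain ⟨R, hR⟩ := exists_norm_cosTransform_le hf hε
    -- At even integers `cos ρπ = 1`, so the identity makes `c` a value of the transform at large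
    -- real frequency.
    have h1 := hR ((2 * ⌈R⌉₊ : ℕ) : ℂ) (by
      rw [Complex.norm_natCast]
      push_cast
      linarith [Nat.le_ceil R, (Nat.cast_nonneg ⌈R⌉₊ : (0 : ℝ) ≤ _)])
    have h2 := h0 (((2 * ⌈R⌉₊ : ℕ) : ℂ) ^ 2)
    rw [← mul_pow, cosSqrt_sq] at h2
    have h3 : Complex.cos (((2 * ⌈R⌉₊ : ℕ) : ℂ) * π) = 1 := by
      have := Complex.cos_nat_mul_two_pi ⌈R⌉₊
      rw [← this]
      push_cast
      ring_nf
    rw [h3, mul_one] at h2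
    rw [sub_eq_zero.1 h2, zero_add]
    simpa using h1
  refine ⟨hc, fun w => ?_⟩
  have := h0 w
  rw [hc] at this
  simpa using this

theorem cos_ofReal_mul_I_mul_pi (τ : ℝ) :
    Complex.cos (τ * Complex.I * π) = (Real.cosh (τ * π) : ℂ) := by
  rw [mul_right_comm, Complex.cos_mul_I]
  push_cast
  rfl

theorem sin_ofReal_mul_I_mul_pi (τ : ℝ) :
    Complex.sin (τ * Complex.I * π) = (Real.sinh (τ * π) : ℂ) * Complex.I := by
  rw [mul_right_comm, Complex.sin_mul_I]
  push_cast
  rfl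

theorem neg_norm_le_re (z : ℂ) : -‖z‖ ≤ z.re := (abs_le.1 (Complex.abs_re_le_norm z)).1

/-- At `ρ = iτ` the leading term is `cosh τπ`, which dominates the transform; for `charD` it is `τ
sinh τπ`. -/
theorem exists_charA_pos (hg : IntervalIntegrable g volume 0 π) :
    ∃ T : ℝ, ∀ τ ≥ T, 0 < (charA g ((τ * Complex.I) ^ 2)).re := by
  obtain ⟨R, hR⟩ := exists_norm_cosTransform_le hg (show (0 : ℝ) < 1 / 4 by norm_num)
  refine ⟨max 0 R, fun τ hτ => ?_⟩
  have h0 : 0 ≤ τ := (le_max_left _ _).trans hτ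
  have h1 := hR (τ * Complex.I) (by
    simp only [norm_mul, Complex.norm_real, Complex.norm_I, mul_one, Real.norm_eq_abs]
    exact ((le_max_right _ _).trans hτ).trans (le_abs_self τ))
  have him : ((τ : ℂ) * Complex.I).im = τ := by simp
  rw [him, abs_of_nonneg h0, mul_comm π] at h1
  rw [charA_sq, cos_ofReal_mul_I_mul_pi, Complex.add_re, Complex.ofReal_re, Real.cosh_eq]
  have h2 := neg_norm_le_re (cosTransform g ((τ * Complex.I) ^ 2))
  have h3 := Real.exp_pos (τ * π)
  have h4 := Real.exp_pos (-(τ * π))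
  linarith

theorem exists_charD_pos (hf : IntervalIntegrable f volume 0 π) :
    ∃ T : ℝ, ∀ τ ≥ T, 0 < (charD ω f ((τ * Complex.I) ^ 2)).re := by
  set M := ∫ t in (0 : ℝ)..π, ‖f t‖ with hM
  have hM0 : 0 ≤ M := intervalIntegral.integral_nonneg Real.pi_pos.le fun t _ => norm_nonneg _
  refine ⟨4 * (‖ω‖ + M) + 1, fun τ hτ => ?_⟩
  have h0 : 1 ≤ τ := by linarith [norm_nonneg ω]
  have h1 := norm_cosTransform_sq_le hf (τ * Complex.I)
  have h2 := norm_cos_mul_le (τ * Complex.I) (right_mem_Icc.2 Real.pi_pos.le)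
  have him : ((τ : ℂ) * Complex.I).im = τ := by simp
  rw [him, abs_of_nonneg (by linarith), mul_comm π] at h1 h2
  have h3 : -τ * Complex.I * Complex.sin (τ * Complex.I * π) = (τ * Real.sinh (τ * π) : ℝ) := by
    rw [sin_ofReal_mul_I_mul_pi]
    push_cast
    linear_combination (-τ * Complex.sinh (τ * π) : ℂ) * Complex.I_mul_I
  rw [charD_sq, ← neg_mul, h3, Complex.add_re, Complex.add_re, Complex.ofReal_re, Real.sinh_eq]
  have h4 := neg_norm_le_re (cosTransform f ((τ * Complex.I) ^ 2))
  have h5 := neg_norm_le_re (ω * Complex.cos (τ * Complex.I * π))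
  have h6 : ‖ω * Complex.cos (τ * Complex.I * π)‖ ≤ ‖ω‖ * Real.exp (τ * π) := by
    rw [norm_mul]
    gcongr
  have h7 := Real.exp_pos (τ * π)
  have h8 : Real.exp (-(τ * π)) ≤ 1 := Real.exp_le_one_iff.2 (by
    have := Real.pi_pos
    simp only [Left.neg_nonpos_iff]
    positivity)
  have h9 : 2 ≤ Real.exp (τ * π) := by
    have := Real.add_one_le_exp (τ * π)
    nlinarith [Real.pi_gt_three]
  have h10 : τ * (Real.exp (τ * π) / 4) ≤
      τ * ((Real.exp (τ * π) - Real.exp (-(τ * π))) / 2) :=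
    mul_le_mul_of_nonneg_left (by linarith) (by linarith)
  have h11 := mul_le_mul_of_nonneg_right hτ.le h7.le
  linarith

end

end

/-! ### Parseval series for the transforms -/

section

open Filter Topology

section
variable {f : ℝ → ℂ} {c : ℕ → ℝ}

theorem memLp_cos (ρ : ℂ) :
    MemLp (fun t : ℝ => Complex.cos (ρ * t)) 2 (volume.restrict (Ioo 0 π)) :=
  memLp_two_of_continuous (by fun_prop)

theorem hasSum_gTerm (hf : MemLp f 2 (volume.restrict (Ioo 0 π)))
    (hc : ∀ n : ℕ, (4 * n + 1) * legendreMoment f n = c n) (ρ : ℂ) :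
    HasSum (gTerm c ρ) (cosTransform f (ρ ^ 2)) := by
  have hp : (π : ℂ) ≠ 0 := by exact_mod_cast Real.pi_pos.ne'
  rw [cosTransform_sq]
  refine (hasSum_legendreMoment_mul hf (memLp_cos ρ)).congr_fun fun n => ?_
  rw [legendreMoment_cos, gTerm, ← hc]
  field_simp

theorem hasSum_hTerm (hf : MemLp f 2 (volume.restrict (Ioo 0 π)))
    (hc : ∀ n : ℕ, (4 * n + 1) * legendreMoment f n = c n) {ρ : ℂ} (hρ : ρ ≠ 0) :
    HasSum (hTerm c ρ) (-∫ t in (0 : ℝ)..π, f t * -(t * Complex.sin (ρ * t))) := by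
  have hp : (π : ℂ) ≠ 0 := by exact_mod_cast Real.pi_pos.ne'
  refine (hasSum_legendreMoment_mul hf (g := fun t : ℝ => -(t * Complex.sin (ρ * t)))
    (memLp_two_of_continuous (by fun_prop))).neg.congr_fun fun n => ?_
  rw [legendreMoment_sin hρ, hTerm, ← hc]
  field_simp
  ring

theorem legendreP_zero (x : ℝ) : legendreP 0 x = 1 := by
  simp [legendreP, Polynomial.shiftedLegendre]

theorem legendreP_two (x : ℝ) : legendreP 2 x = (3 * x ^ 2 - 1) / 2 := by
  simp [legendreP, Polynomial.shiftedLegendre, Finset.sum_range_succ, Nat.choose]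
  simp only [map_ofNat]
  ring

theorem integral_eq_of_legendreMoment (hc : ∀ n : ℕ, (4 * n + 1) * legendreMoment f n = c n) :
    ∫ t in (0 : ℝ)..π, f t = c 0 := by
  have := hc 0
  simpa [legendreMoment, legendreP_zero] using this

/-- Expansion of `t² = π² (1/3 + (2/3) P₂(t/π))`; this is why only the coefficients of index `0` and
`1` enter `α₀`. -/
theorem integral_mul_sq_eq_of_legendreMoment (hf : IntervalIntegrable f volume 0 π)
    (hc : ∀ n : ℕ, (4 * n + 1) * legendreMoment f n = c n) :
    ∫ t in (0 : ℝ)..π, f t * t ^ 2 = π ^ 2 / 3 * c 0 + 2 * π ^ 2 / 15 * c 1 := by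
  have hp : (π : ℂ) ≠ 0 := by exact_mod_cast Real.pi_pos.ne'
  have h0 := integral_eq_of_legendreMoment hc
  have h1 := hc 1
  rw [legendreMoment] at h1
  have h2 : ∫ t in (0 : ℝ)..π, f t * t ^ 2 = π ^ 2 / 3 * (∫ t in (0 : ℝ)..π, f t) +
      2 * π ^ 2 / 3 * ∫ t in (0 : ℝ)..π, f t * legendreP (2 * 1) (t / π) := by
    rw [← intervalIntegral.integral_const_mul, ← intervalIntegral.integral_const_mul,
      ← intervalIntegral.integral_add (hf.const_mul _)
      ((hf.mul_continuousOn (g := fun t : ℝ => (legendreP (2 * 1) (t / π) : ℂ))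
        (by fun_prop)).const_mul _)]
    refine intervalIntegral.integral_congr fun t _ => ?_
    simp only [mul_one, legendreP_two]
    push_cast
    field_simp
    ring
  rw [h2, h0]
  push_cast at h1
  linear_combination 2 * π ^ 2 / 15 * h1

theorem cosTransform_sub {g : ℝ → ℂ} (hf : IntervalIntegrable f volume 0 π)
    (hg : IntervalIntegrable g volume 0 π) (w : ℂ) :
    cosTransform (fun t => f t - g t) w = cosTransform f w - cosTransform g w := by
  unfold cosTransform
  rw [← intervalIntegral.integral_sub (hf.mul_continuousOn (by fun_prop))
    (hg.mul_continuousOn (by fun_prop))]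
  refine intervalIntegral.integral_congr fun t _ => ?_
  ring

theorem cosTransform_zero (f : ℝ → ℂ) : cosTransform f 0 = ∫ t in (0 : ℝ)..π, f t := by
  have := cosTransform_sq f 0
  simpa using this

theorem legendreMoment_congr_ae {g : ℝ → ℂ} (h : ∀ᵐ t, t ∈ Ioo 0 π → f t - g t = 0) (n : ℕ) :
    legendreMoment f n = legendreMoment g n := by
  unfold legendreMoment
  rw [← setIntegral_Ioo_eq, ← setIntegral_Ioo_eq]
  refine setIntegral_congr_ae measurableSet_Ioo ?_
  filter_upwards [h] with t h1 ht
  rw [sub_eq_zero.1 (h1 ht)]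

end

/-! ### Zeros of the characteristic functions and positivity of the second spectrum -/

theorem pos_of_forall_lt_ne_zero {f : ℝ → ℝ} (hf : Continuous f) {x₀ T : ℝ}
    (hT : ∀ τ ≥ T, 0 < f (-τ ^ 2)) (h0 : ∀ x < x₀, f x ≠ 0) {x : ℝ} (hx : x < x₀) : 0 < f x := by
  by_contra! hcon
  set τ := max T (1 + |x|) with hτ
  have h1 := hT τ (le_max_left _ _)
  have h2 : 1 + |x| ≤ τ := le_max_right _ _
  have h3 : -τ ^ 2 ≤ x := by nlinarith [neg_abs_le x, abs_nonneg x]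
  obtain ⟨y, hy, hy0⟩ := intermediate_value_Icc' h3 hf.continuousOn ⟨hcon, h1.le⟩
  exact h0 y (hy.2.trans_lt hx) hy0

theorem deriv_nonpos_of_pos_left {f : ℝ → ℝ} {f' x₀ : ℝ} (hf : HasDerivAt f f' x₀)
    (h0 : f x₀ = 0) (hpos : ∀ x < x₀, 0 < f x) : f' ≤ 0 := by
  have h1 := hf.hasDerivWithinAt (s := Iio x₀)
  rw [hasDerivWithinAt_iff_tendsto_slope' (by simp)] at h1
  refine le_of_tendsto h1 ?_
  filter_upwards [self_mem_nhdsWithin] with x hx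
  have hx : x < x₀ := hx
  rw [slope_def_field, h0, sub_zero]
  exact div_nonpos_of_nonneg_of_nonpos (hpos x hx).le (by linarith)

section
variable {q : ℝ → ℝ} {h H : ℝ} {φ dφ : ℂ → ℝ → ℂ} {A D : ℂ → ℂ} {lam nu : ℕ → ℝ}

theorem exists_sq_eq (z : ℂ) : ∃ ρ : ℂ, ρ ^ 2 = z :=
  IsAlgClosed.exists_pow_nat_eq z (by norm_num)

theorem IsPhi.eq_zero_iff_dirichlet (hφ : IsPhi q h φ dφ) (hq : IntervalIntegrable q volume 0 π)
    (hAφ : ∀ ρ, A (ρ ^ 2) = φ ρ π) (hnu : IsSpectrum (dirichletEigenvalues q h) nu) (z : ℂ) :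
    A z = 0 ↔ ∃ k, (nu k : ℂ) = z := by
  obtain ⟨ρ, rfl⟩ := exists_sq_eq z
  rw [hAφ, ← hφ.sq_mem_dirichletEigenvalues hq, ← hnu.2]
  rfl

theorem IsPhi.eq_zero_iff_robin (hφ : IsPhi q h φ dφ) (hq : IntervalIntegrable q volume 0 π)
    (hDφ : ∀ ρ, D (ρ ^ 2) = dφ ρ π + H * φ ρ π) (hlam : IsSpectrum (robinEigenvalues q h H) lam)
    (z : ℂ) : D z = 0 ↔ ∃ k, (lam k : ℂ) = z := by
  obtain ⟨ρ, rfl⟩ := exists_sq_eq z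
  rw [hDφ, ← hφ.sq_mem_robinEigenvalues hq H, ← hlam.2]
  rfl

theorem IsPhi.deriv_wronskian_pos (hφ : IsPhi q h φ dφ)
    (hq : MemLp q 2 (volume.restrict (Ioo 0 π)))
    (hA : Differentiable ℂ A) (hD : Differentiable ℂ D)
    (hAφ : ∀ ρ, A (ρ ^ 2) = φ ρ π) (hDφ : ∀ ρ, D (ρ ^ 2) = dφ ρ π + H * φ ρ π) (x : ℝ) :
    ∃ r : ℝ, 0 < r ∧ deriv A x * D x - deriv D x * A x = r := by
  obtain ⟨ρ, hρ⟩ := exists_sq_eq (x : ℂ)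
  obtain ⟨r, hr, hr'⟩ := hφ.integral_sq_pos (MemLp.intervalIntegrable_of_two hq) (ρ := ρ)
    (by rw [hρ, Complex.conj_ofReal])
  refine ⟨r, hr, ?_⟩
  rw [← hr', ← hφ.deriv_wronskian hq hA hD hAφ hDφ ρ, hρ]

theorem IsPhi.im_eq_zero (hφ : IsPhi q h φ dφ) (hq : IntervalIntegrable q volume 0 π)
    (hAφ : ∀ ρ, A (ρ ^ 2) = φ ρ π) (hDφ : ∀ ρ, D (ρ ^ 2) = dφ ρ π + H * φ ρ π) (x : ℝ) :
    (A x).im = 0 ∧ (D x).im = 0 := by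
  obtain ⟨ρ, hρ⟩ := exists_sq_eq (x : ℂ)
  obtain ⟨h1, h2⟩ := hφ.conj_eq hq (ρ := ρ) (by rw [hρ, Complex.conj_ofReal])
    (right_mem_Icc.2 Real.pi_pos.le)
  rw [← hρ, hAφ, hDφ, ← Complex.conj_eq_iff_im, ← Complex.conj_eq_iff_im]
  simp [h1, h2]

/-- Needed because `√(nu k)` is a real square root. As `λ₀ = 0` is the least zero of `D`, which is
positive far to the left, `D ≥ 0` on `(-∞, 0]`. If `ν₀ ≤ 0`, then `A > 0` to the left of `ν₀`, so
`A'(ν₀) ≤ 0` and `A'(ν₀) D(ν₀) ≤ 0`, against the positive Wronskian. -/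
theorem IsPhi.dirichlet_pos (hφ : IsPhi q h φ dφ) (hq : MemLp q 2 (volume.restrict (Ioo 0 π)))
    (hA : Differentiable ℂ A) (hD : Differentiable ℂ D)
    (hAφ : ∀ ρ, A (ρ ^ 2) = φ ρ π) (hDφ : ∀ ρ, D (ρ ^ 2) = dφ ρ π + H * φ ρ π)
    (hApos : ∃ T : ℝ, ∀ τ ≥ T, 0 < (A ((τ * Complex.I) ^ 2)).re)
    (hDpos : ∃ T : ℝ, ∀ τ ≥ T, 0 < (D ((τ * Complex.I) ^ 2)).re)
    (hlam : IsSpectrum (robinEigenvalues q h H) lam)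
    (hnu : IsSpectrum (dirichletEigenvalues q h) nu) (hlam0 : lam 0 = 0) (k : ℕ) : 0 < nu k := by
  have hqi := MemLp.intervalIntegrable_of_two hq
  have hAz := hφ.eq_zero_iff_dirichlet hqi hAφ hnu
  have hDz := hφ.eq_zero_iff_robin hqi hDφ hlam
  have him := hφ.im_eq_zero hqi hAφ hDφ
  have hsq : ∀ τ : ℝ, ((τ : ℂ) * Complex.I) ^ 2 = ((-τ ^ 2 : ℝ) : ℂ) := fun τ => by
    rw [mul_pow, Complex.I_sq]; push_cast; ring
  simp_rw [hsq] at hApos hDpos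
  obtain ⟨TA, hTA⟩ := hApos
  obtain ⟨TD, hTD⟩ := hDpos
  have hdnn : ∀ x : ℝ, x ≤ 0 → 0 ≤ (D x).re := by
    intro x hx
    rcases hx.eq_or_lt with rfl | hx
    · rw [(hDz _).2 ⟨0, by rw [hlam0]⟩, Complex.zero_re]
    · refine (pos_of_forall_lt_ne_zero (f := fun x : ℝ => (D x).re)
        (Complex.continuous_re.comp (hD.continuous.comp Complex.continuous_ofReal)) hTD
        (fun y hy h0 => ?_) hx).le
      obtain ⟨k, hk⟩ := (hDz y).1 (Complex.ext h0 (him y).2)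
      have h1 : lam k = y := Complex.ofReal_injective hk
      have h2 := hlam.1.monotone (Nat.zero_le k)
      linarith
  by_contra! hk
  have hnu0 : nu 0 ≤ 0 := (hnu.1.monotone (Nat.zero_le k)).trans hk
  have hapos : ∀ x < nu 0, 0 < (A x).re := fun x hx =>
    pos_of_forall_lt_ne_zero (f := fun x : ℝ => (A x).re)
      (Complex.continuous_re.comp (hA.continuous.comp Complex.continuous_ofReal)) hTA
      (fun y hy h0 => by
        obtain ⟨k, hk⟩ := (hAz y).1 (Complex.ext h0 (him y).1)
        have h1 : nu k = y := Complex.ofReal_injective hk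
        have h2 := hnu.1.monotone (Nat.zero_le k)
        linarith) hx
  have hA0 : A (nu 0) = 0 := (hAz _).2 ⟨0, rfl⟩
  have hd := deriv_nonpos_of_pos_left (hA (nu 0)).hasDerivAt.real_of_complex
    (by rw [hA0, Complex.zero_re]) hapos
  obtain ⟨r, hr, hr'⟩ := hφ.deriv_wronskian_pos hq hA hD hAφ hDφ (nu 0)
  have h1 := congrArg Complex.re hr'
  rw [hA0, mul_zero, sub_zero, Complex.mul_re, (him _).2, mul_zero, sub_zero,
    Complex.ofReal_re] at h1
  have h2 := mul_nonpos_of_nonpos_of_nonneg hd (hdnn _ hnu0)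
  linarith

end

end

/-! ### Unique solvability of the two linear systems -/

section
variable {f g : ℝ → ℂ} {c : ℕ → ℝ} {nu lam : ℕ → ℝ}

theorem sqrt_sq_cast {x : ℝ} (hx : 0 ≤ x) : ((√x : ℝ) : ℂ) ^ 2 = x := by
  rw [← Complex.ofReal_pow, Real.sq_sqrt hx]

theorem cosSqrt_mul_pi_sq {x : ℝ} (hx : 0 ≤ x) :
    cosSqrt (x * π ^ 2) = Complex.cos ((√x : ℝ) * π) := by
  rw [← sqrt_sq_cast hx, ← mul_pow, cosSqrt_sq]

theorem eq_of_legendreMoment_eq {c' : ℕ → ℝ}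
    (hc : ∀ n : ℕ, (4 * n + 1) * legendreMoment f n = c n)
    (hc' : ∀ n : ℕ, (4 * n + 1) * legendreMoment g n = c' n)
    (hfg : ∀ᵐ t, t ∈ Ioo 0 π → f t - g t = 0) : c = c' := by
  funext n
  apply Complex.ofReal_injective
  rw [← hc, ← hc', legendreMoment_congr_ae hfg]

/-- The system prescribes the transform of the unknown function at every zero of `charA g`, with the
values that the transform of `g` takes there. -/
theorem solvesSecondSystem_iff {c₀ : ℕ → ℝ} (hg : MemLp g 2 (volume.restrict (Ioo 0 π)))
    (hc₀ : ∀ n : ℕ, (4 * n + 1) * legendreMoment g n = c₀ n) (hc₀2 : IsLegendreL2 c₀)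
    (hz : ∀ z, charA g z = 0 ↔ ∃ k, (nu k : ℂ) = z)
    (hs : ∀ z, charA g z = 0 → deriv (charA g) z ≠ 0) (hnu : ∀ k, 0 < nu k) (c : ℕ → ℝ) :
    SolvesSecondSystem nu c ↔ c = c₀ := by
  have hA : ∀ k, cosTransform g (nu k) = -Complex.cos ((√(nu k) : ℝ) * π) := fun k => by
    have := (hz (nu k)).2 ⟨k, rfl⟩
    rw [charA, cosSqrt_mul_pi_sq (hnu k).le] at this
    linear_combination this
  constructor
  · rintro ⟨hc, hck⟩
    obtain ⟨f, hf, hfc⟩ := exists_memLp_of_isLegendreL2 hc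
    have hfi := MemLp.intervalIntegrable_of_two hf
    have hgi := MemLp.intervalIntegrable_of_two hg
    refine eq_of_legendreMoment_eq hfc hc₀ (eq_zero_of_cosTransform_eq_zero (hfi.sub hgi) ?_)
    refine cosTransform_eq_zero_of_charA (hfi.sub hgi) hgi fun z hz0 => ⟨?_, hs z hz0⟩
    obtain ⟨k, rfl⟩ := (hz z).1 hz0
    have h1 := (hasSum_gTerm hf hfc (√(nu k) : ℝ)).unique (hck k)
    rw [sqrt_sq_cast (hnu k).le] at h1
    have h2 := cosTransform_sub hfi hgi (nu k)
    rw [h1, hA, sub_self] at h2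
    exact h2
  · rintro rfl
    refine ⟨hc₀2, fun k => ?_⟩
    have h1 := hasSum_gTerm hg hc₀ (√(nu k) : ℝ)
    rw [sqrt_sq_cast (hnu k).le, hA] at h1
    exact h1

/-- Here `d 0` is also the unknown coefficient of `cos ρπ`, so the function vanishing on the
spectrum is `(d₀ - d₀') cos ρπ` minus a transform, `d₀` and `d₀'` being the two leading
coefficients. That it vanishes identically forces both parts to vanish. -/
theorem solvesFirstSystem_iff {d₀ : ℕ → ℝ} {ω : ℂ} (hg : MemLp g 2 (volume.restrict (Ioo 0 π)))
    (hd₀ : ∀ n : ℕ, (4 * n + 1) * legendreMoment g n = d₀ n) (hd₀2 : IsLegendreL2 d₀)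
    (hz : ∀ z, charD ω g z = 0 ↔ ∃ k, (lam k : ℂ) = z)
    (hs : ∀ z, charD ω g z = 0 → deriv (charD ω g) z ≠ 0) (hlam : ∀ k, 0 ≤ lam k)
    (hlam0 : lam 0 = 0) (hω : ω = -d₀ 0) (d : ℕ → ℝ) :
    SolvesFirstSystem lam d ↔ d = d₀ := by
  have hD : ∀ k, cosTransform g (lam k) = d₀ 0 * Complex.cos ((√(lam k) : ℝ) * π) +
      (√(lam k) : ℝ) * Complex.sin ((√(lam k) : ℝ) * π) := fun k => by
    have := (hz (lam k)).2 ⟨k, rfl⟩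
    rw [← sqrt_sq_cast (hlam k), charD_sq, hω] at this
    rw [← sqrt_sq_cast (hlam k)]
    linear_combination this
  constructor
  · rintro ⟨hd, hdk⟩
    obtain ⟨f, hf, hfd⟩ := exists_memLp_of_isLegendreL2 hd
    have hfi := MemLp.intervalIntegrable_of_two hf
    have hgi := MemLp.intervalIntegrable_of_two hg
    refine eq_of_legendreMoment_eq hfd hd₀ (eq_zero_of_cosTransform_eq_zero (hfi.sub hgi) ?_)
    refine (eq_zero_of_mul_cosSqrt_sub (c := d 0 - d₀ 0) (hfi.sub hgi) ?_).2
    refine eq_zero_of_charD (hfi.sub hgi) hgi fun z hz0 => ⟨?_, hs z hz0⟩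
    obtain ⟨k, rfl⟩ := (hz z).1 hz0
    have h1 : cosTransform f (lam k) = d 0 * Complex.cos ((√(lam k) : ℝ) * π) +
        (√(lam k) : ℝ) * Complex.sin ((√(lam k) : ℝ) * π) := by
      -- The system omits `k = 0`; there `ρ = 0` and the equation reads `∫ f = d 0`, which holds for
      -- any coefficient sequence because `P₀ = 1`.
      rcases Nat.eq_zero_or_pos k with rfl | hk
      · rw [hlam0, Complex.ofReal_zero, cosTransform_zero, integral_eq_of_legendreMoment hfd]
        simp
      · have h1 := (hasSum_gTerm hf hfd (√(lam k) : ℝ)).unique (hdk k hk)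
        rwa [sqrt_sq_cast (hlam k)] at h1
    rw [cosTransform_sub hfi hgi, h1, hD, cosSqrt_mul_pi_sq (hlam k)]
    ring
  · rintro rfl
    refine ⟨hd₀2, fun k _ => ?_⟩
    have h1 := hasSum_gTerm hg hd₀ (√(lam k) : ℝ)
    rw [sqrt_sq_cast (hlam k), hD] at h1
    exact h1

end

end NSBF

end

/-! ### The main theorem -/

theorem mainTheorem5 (q : ℝ → ℝ) (hq : MemLp q 2 (volume.restrict (Ioo 0 π))) (h H : ℝ)
    (lam nu : ℕ → ℝ)
    (hlam : NSBF.IsSpectrum (NSBF.robinEigenvalues q h H) lam)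
    (hnu : NSBF.IsSpectrum (NSBF.dirichletEigenvalues q h) nu)
    (hlam0 : lam 0 = 0) :
    (∃ φ dφ : ℂ → ℝ → ℂ, NSBF.IsPhi q h φ dφ) ∧
    ∀ φ dφ : ℂ → ℝ → ℂ, NSBF.IsPhi q h φ dφ →
      (∃ G : ℝ → ℝ → ℝ, NSBF.IsTransmutationKernel φ G) ∧
      ∀ G : ℝ → ℝ → ℝ, NSBF.IsTransmutationKernel φ G →
        -- the series representations of `φ(ρ, π)` and `φ'(ρ, π)`
        (∀ ρ : ℂ, HasSum (NSBF.gTerm (fun n => NSBF.gCoeff G n π) ρ)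
          (φ ρ π - Complex.cos (ρ * π))) ∧
        (∀ ρ : ℂ, HasSum (NSBF.gTerm (fun n => NSBF.gammaCoeff G n π) ρ)
          (dφ ρ π + ρ * Complex.sin (ρ * π) - NSBF.omegaOne q h * Complex.cos (ρ * π))) ∧
        -- the coefficients `gₙ(π)` are determined by the second spectrum
        (∀ c : ℕ → ℝ, NSBF.SolvesSecondSystem nu c ↔ c = fun n => NSBF.gCoeff G n π) ∧
        -- the coefficients `hₙ` and `ω` are determined by the first spectrum
        (∀ d : ℕ → ℝ, NSBF.SolvesFirstSystem lam d ↔ d = NSBF.hCoeff G H) ∧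
        NSBF.omega q h H = -NSBF.hCoeff G H 0 ∧
        -- the norming constants `αₙ`, `n ≥ 1`
        (∀ n : ℕ, 1 ≤ n → ∀ ρ : ℂ, ρ = (√(lam n) : ℝ) →
          Summable (NSBF.gTerm (fun k => NSBF.gCoeff G k π) ρ) ∧
          Summable (NSBF.hTerm (NSBF.hCoeff G H) ρ) ∧
          NSBF.normingConstant φ lam n =
            1 / (2 * ρ) *
              (Complex.cos (ρ * π) + ∑' k : ℕ, NSBF.gTerm (fun k => NSBF.gCoeff G k π) ρ k) *
              ((1 + π * NSBF.omega q h H) * Complex.sin (ρ * π) + π * ρ * Complex.cos (ρ * π)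
                + ∑' k : ℕ, NSBF.hTerm (NSBF.hCoeff G H) ρ k)) ∧
        -- the norming constant `α₀`
        NSBF.normingConstant φ lam 0 =
          (((1 + NSBF.gCoeff G 0 π) *
            (π + NSBF.omega q h H * (π ^ 2 / 3) + NSBF.hCoeff G H 1 * (π ^ 2 / 15)) : ℝ) : ℂ) := by
  have hqi := NSBF.MemLp.intervalIntegrable_of_two hq
  refine ⟨NSBF.exists_isPhi hq h, fun φ dφ hφ => ?_⟩
  obtain ⟨K, g, Γ, hK, hg, hΓ, hφπ, hdφπ, hcoeff⟩ := hφ.exists_kernel hq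
  refine ⟨⟨K, hK⟩, fun G hG => ?_⟩
  have hmom : ∀ (u : ℝ → ℝ) (c : ℕ → ℝ),
      (∀ n : ℕ, c n = (4 * n + 1) * ∫ t in (0 : ℝ)..π, u t * NSBF.legendreP (2 * n) (t / π)) →
      ∀ n : ℕ, (4 * n + 1) * NSBF.legendreMoment (fun t => (u t : ℂ)) n = c n := by
    intro u c hc n
    rw [NSBF.legendreMoment_ofReal, hc]
    push_cast
    rfl
  set f : ℝ → ℝ := fun t => Γ t + H * g t with hf
  have hf2 : MemLp f 2 (volume.restrict (Ioo 0 π)) := hΓ.add (hg.const_mul H)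
  have hgC : MemLp (fun t => (g t : ℂ)) 2 (volume.restrict (Ioo 0 π)) := hg.ofReal
  have hΓC : MemLp (fun t => (Γ t : ℂ)) 2 (volume.restrict (Ioo 0 π)) := hΓ.ofReal
  have hfC : MemLp (fun t => (f t : ℂ)) 2 (volume.restrict (Ioo 0 π)) := hf2.ofReal
  have hgi := NSBF.MemLp.intervalIntegrable_of_two hgC
  have hΓi := NSBF.MemLp.intervalIntegrable_of_two hΓC
  have hfi := NSBF.MemLp.intervalIntegrable_of_two hfC
  have hgr := NSBF.MemLp.intervalIntegrable_of_two hg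
  have hΓr := NSBF.MemLp.intervalIntegrable_of_two hΓ
  have hgc := hmom g (fun n => NSBF.gCoeff G n π) fun n => (hcoeff G hG n).1
  have hΓc := hmom Γ (fun n => NSBF.gammaCoeff G n π) fun n => (hcoeff G hG n).2
  have hfh : ∀ n : ℕ, NSBF.hCoeff G H n =
      (4 * n + 1) * ∫ t in (0 : ℝ)..π, f t * NSBF.legendreP (2 * n) (t / π) := fun n => by
    have hP : ContinuousOn (fun t : ℝ => NSBF.legendreP (2 * n) (t / π)) (uIcc 0 π) := by fun_prop
    rw [NSBF.hCoeff, (hcoeff G hG n).1, (hcoeff G hG n).2]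
    simp only [hf, add_mul, mul_assoc]
    rw [intervalIntegral.integral_add (hΓr.mul_continuousOn hP)
      ((hgr.mul_continuousOn hP).const_mul H), intervalIntegral.integral_const_mul]
    ring
  have hfc := hmom f (NSBF.hCoeff G H) hfh
  have hg2 : NSBF.IsLegendreL2 fun n => NSBF.gCoeff G n π := by
    simp_rw [fun n => (hcoeff G hG n).1]
    exact NSBF.isLegendreL2_of_memLp hg
  have hh2 : NSBF.IsLegendreL2 (NSBF.hCoeff G H) := by
    rw [funext hfh]
    exact NSBF.isLegendreL2_of_memLp hf2
  set A := NSBF.charA fun t => (g t : ℂ) with hAdef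
  set D := NSBF.charD (NSBF.omega q h H : ℂ) fun t => (f t : ℂ) with hDdef
  have hA : Differentiable ℂ A := NSBF.differentiable_charA hgi
  have hD : Differentiable ℂ D := NSBF.differentiable_charD hfi
  have hAφ : ∀ ρ, A (ρ ^ 2) = φ ρ π := fun ρ => by
    rw [hAdef, NSBF.charA_sq, hφπ, NSBF.cosTransform_sq]
  have hDφ : ∀ ρ, D (ρ ^ 2) = dφ ρ π + H * φ ρ π := fun ρ => by
    have hcos : ContinuousOn (fun t : ℝ => Complex.cos (ρ * t)) (uIcc 0 π) := by fun_prop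
    rw [hDdef, NSBF.charD_sq, hφπ, hdφπ, NSBF.cosTransform_sq, NSBF.omega, NSBF.omegaOne]
    simp only [hf, Complex.ofReal_add, Complex.ofReal_mul, add_mul, mul_assoc]
    rw [intervalIntegral.integral_add (hΓi.mul_continuousOn hcos)
      ((hgi.mul_continuousOn hcos).const_mul (H : ℂ)), intervalIntegral.integral_const_mul]
    ring
  have hAz := hφ.eq_zero_iff_dirichlet hqi hAφ hnu
  have hDz := hφ.eq_zero_iff_robin hqi hDφ hlam
  have hnupos := hφ.dirichlet_pos hq hA hD hAφ hDφ (NSBF.exists_charA_pos hgi)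
    (NSBF.exists_charD_pos hfi) hlam hnu hlam0
  have hlampos : ∀ k, 0 ≤ lam k := fun k => hlam0 ▸ hlam.1.monotone (Nat.zero_le k)
  have hW := hφ.deriv_wronskian_pos hq hA hD hAφ hDφ
  -- Since `λ₀ = 0`, this is `D(0) = ω + ∫ f = 0`.
  have hω : (NSBF.omega q h H : ℂ) = -NSBF.hCoeff G H 0 := by
    have h1 := NSBF.charD_sq (NSBF.omega q h H) (fun t => (f t : ℂ)) 0
    rw [← NSBF.integral_eq_of_legendreMoment hfc, ← NSBF.cosTransform_zero]
    have h2 : D 0 = 0 := (hDz 0).2 ⟨0, by rw [hlam0, Complex.ofReal_zero]⟩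
    rw [zero_pow two_ne_zero, ← hDdef, h2] at h1
    simp at h1
    linear_combination -h1
  -- The Wronskian identity at a zero of `D`.
  have hnorm : ∀ n, NSBF.normingConstant φ lam n =
      -(deriv D ((√(lam n) : ℝ) ^ 2 : ℂ) * A ((√(lam n) : ℝ) ^ 2 : ℂ)) := fun n => by
    have h1 := hφ.deriv_wronskian hq hA hD hAφ hDφ (√(lam n) : ℝ)
    have h2 : D ((√(lam n) : ℝ) ^ 2 : ℂ) = 0 := by
      rw [NSBF.sqrt_sq_cast (hlampos n)]
      exact (hDz _).2 ⟨n, rfl⟩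
    rw [NSBF.normingConstant, ← h1, h2]
    ring
  refine ⟨fun ρ => ?_, fun ρ => ?_, ?_, ?_, ?_, ?_, ?_⟩
  · rw [hφπ, add_sub_cancel_left, ← NSBF.cosTransform_sq]
    exact NSBF.hasSum_gTerm hgC hgc ρ
  · have h1 := NSBF.hasSum_gTerm hΓC hΓc ρ
    rw [NSBF.cosTransform_sq] at h1
    rw [hdφπ]
    convert h1 using 1
    ring
  · refine NSBF.solvesSecondSystem_iff hgC hgc hg2 hAz (fun z hz0 hd => ?_) hnupos
    obtain ⟨k, rfl⟩ := (hAz z).1 hz0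
    obtain ⟨r, hr, hr'⟩ := hW (nu k)
    rw [← hAdef] at hz0 hd
    rw [hd, hz0, zero_mul, mul_zero, sub_zero] at hr'
    exact hr.ne (Complex.ofReal_injective hr')
  · refine NSBF.solvesFirstSystem_iff hfC hfc hh2 hDz (fun z hz0 hd => ?_) hlampos hlam0 hω
    obtain ⟨k, rfl⟩ := (hDz z).1 hz0
    obtain ⟨r, hr, hr'⟩ := hW (lam k)
    rw [← hDdef] at hz0 hd
    rw [hd, hz0, zero_mul, mul_zero, sub_zero] at hr'
    exact hr.ne (Complex.ofReal_injective hr')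
  · exact_mod_cast hω
  · rintro n hn ρ rfl
    have hlam_pos : 0 < lam n := hlam0 ▸ hlam.1 (Nat.pos_of_ne_zero (by omega))
    have hρ : ((√(lam n) : ℝ) : ℂ) ≠ 0 := by
      exact_mod_cast (Real.sqrt_pos.2 hlam_pos).ne'
    have h1 := NSBF.hasSum_gTerm hgC hgc (√(lam n) : ℝ)
    have h2 := NSBF.hasSum_hTerm hfC hfc hρ
    refine ⟨h1.summable, h2.summable, ?_⟩
    -- The derivative of `D(ρ²)` in `ρ` is `2ρ D'(ρ²)`; this is the source of the prefactor `1 /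
    -- (2ρ)`.
    have h3 := NSBF.mul_deriv_charD_sq (ω := NSBF.omega q h H) hfi (√(lam n) : ℝ)
    rw [← hDdef] at h3
    rw [h1.tsum_eq, h2.tsum_eq, hnorm, ← NSBF.charA_sq, ← hAdef]
    generalize (∫ t in (0 : ℝ)..π, (f t : ℂ) * -(t * Complex.sin ((√(lam n) : ℝ) * t))) = I at h3 ⊢
    field_simp
    linear_combination (-A ((√(lam n) : ℝ) ^ 2 : ℂ)) * h3
  · have h1 := NSBF.deriv_charD_zero (ω := NSBF.omega q h H) hfi
    rw [NSBF.integral_mul_sq_eq_of_legendreMoment hfi hfc, ← hDdef] at h1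
    have h2 := NSBF.charA_sq (fun t => (g t : ℂ)) 0
    rw [zero_pow two_ne_zero, NSBF.cosTransform_zero, NSBF.integral_eq_of_legendreMoment hgc,
      ← hAdef, zero_mul, Complex.cos_zero] at h2
    rw [hnorm, hlam0, Real.sqrt_zero, Complex.ofReal_zero, zero_pow two_ne_zero, h1, h2]
    push_cast
    -- Replacing `h₀` by `-ω` turns `ω π²/2 + h₀ π²/6` into `ω π²/3`.
    linear_combination ((1 + (NSBF.gCoeff G 0 π : ℂ)) * π ^ 2 / 6) * hω
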